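/- **Setting.** Let $\mathcal V$ be a semi-strict braided monoidal bicategory. Explicitly, $\mathcal V$ is a Gray monoid, i.e. a monoid for the Gray tensor product of 2-categories: a 2-category with a strictly associative and unital tensor product of objects (written by juxtaposition, unit $\mathbb 1$), strict 2-functors $A\otimes-$ and $-\otimes B$ that are strictly associative and unital, and natural invertible interchangers $\Sigma_{f,g}\colon (f\otimes B')\circ(A\otimes g)\Rightarrow(A'\otimes g)\circ(f\otimes B)$ for $f\colon A\to A'$, $g\colon B\to B'$, compatible with identities, composition and tensoring. It carries a pseudonatural equivalence $\beta_{A,B}\colon AB\to BA$ from $\otimes$ to $\otimes\circ\sigma$ (where $\sigma$ is the symmetry of the Gray tensor product) and invertible modifications $$R_{A,B,C}\colon \beta_{A,BC}\Rightarrow (B\beta_{A,C})\circ(\beta_{A,B}C),\qquad S_{A,B,C}\colon \beta_{AB,C}\Rightarrow(\beta_{A,C}B)\circ(A\beta_{B,C}),$$ subject to the following four braiding axioms, each an equality of pasted 2-cells (whiskering is left implicit and 2-cells are listed in the order in which they are applied): 1. as 2-cells from $\beta_{A,BCD}$: $R_{A,B,CD}$ then $B\,R_{A,C,D}$ equals $R_{A,BC,D}$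 then $R_{A,B,C}\,D$; 2. as 2-cells from $\beta_{ABC,D}$: $S_{AB,C,D}$ then $S_{A,B,D}\,C$ equals $S_{A,BC,D}$ then $A\,S_{B,C,D}$; 3. as 2-cells $(C\beta_{AB,D})(\beta_{AB,C}D)\Rightarrow(\beta_{A,CD}B)(A\beta_{B,CD})$: $S_{A,B,C}D$ and $C\,S_{A,B,D}$, then $\Sigma^{-1}_{\beta_{A,C},\beta_{B,D}}$, then $R^{-1}_{A,C,D}B$ and $A\,R^{-1}_{B,C,D}$, equals $R^{-1}_{AB,C,D}$ then $S_{A,B,CD}$; 4. as 2-cells $(\beta_{B,C}A)(B\beta_{A,C})(\beta_{A,B}C)\Rightarrow(C\beta_{A,B})(\beta_{A,C}B)(A\beta_{B,C})$: $R^{-1}_{A,B,C}$, then naturality of $\beta$ at $(A,\beta_{B,C})$, then $R_{A,C,B}$, equals $S^{-1}_{B,A,C}$, then naturality of $\beta$ at $(\beta_{A,B},C)$, then $S_{A,B,C}$. Finally the unit axioms hold: $\beta_{A,\mathbb 1}=\beta_{\mathbb 1,A}=\mathrm{id}_A$, and the 2-cells $R_{A,B,\mathbb 1}$, $R_{A,\mathbb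 1,B}$, $S_{\mathbb 1,A,B}$, $S_{A,\mathbb 1,B}$ (on $\beta_{A,B}$) and $R_{\mathbb 1,A,B}$, $S_{A,B,\mathbb 1}$ (on $\mathrm{id}_{AB}$) are identities. **$\mathcal V$-bicategories.** A $\mathcal V$-bicategory $\mathcal C$ consists of a class of objects, hom-objects $\mathcal C(c,d)\in\mathcal V$, 1-cells $m_{c,d,e}\colon\mathcal C(d,e)\,\mathcal C(c,d)\to\mathcal C(c,e)$ and $u_c\colon\mathbb 1\to\mathcal C(c,c)$, and invertible 2-cells $\alpha\colon m\circ(m\otimes 1)\Rightarrow m\circ(1\otimes m)$, $\lambda\colon m\circ(u\otimes1)\Rightarrow 1$, $\rho\colon m\circ(1\otimes u)\Rightarrow1$, such that the following hold (with the same conventions). * (IC) As 2-cells $m\circ(m\otimes1)\circ(1\otimes u\otimes 1)\Rightarrow m$: $\alpha$ followed by $1\otimes\lambda$ equals $\rho\otimes 1$. * (AC) As 2-cells $m\circ(m\otimes1)\circ(m\otimes1\otimes1)\Rightarrow m\circ(1\otimes m)\circ(1\otimes1\otimes m)$: $\alpha\otimes1$, then $\alpha$, then $1\otimes\alpha$ equals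 $\alpha$, then $\Sigma_{m,m}^{-1}$, then $\alpha$. **Theorem.** Let $\mathcal C$ be a $\mathcal V$-bicategory. Let $\mathcal C^{\mathsf{op}}$ have the same objects, hom-objects $\mathcal C^{\mathsf{op}}(a,b)=\mathcal C(b,a)$, composition $$\underline m_{c,d,e}\colon\mathcal C(e,d)\,\mathcal C(d,c)\xrightarrow{\ \beta\ }\mathcal C(d,c)\,\mathcal C(e,d)\xrightarrow{\ m_{e,d,c}\ }\mathcal C(e,c),$$ units $\underline u_c=u_c$, and the following invertible 2-cells. * The associator $\underline\alpha$: with $X=\mathcal C(f,e)$, $Y=\mathcal C(e,d)$, $Z=\mathcal C(d,c)$, it is the composite $$\begin{aligned}m\,\beta_{\mathcal C(f,d),Z}\,(mZ)(\beta_{X,Y}Z)&\Rightarrow m\,(Zm)(Z\beta_{X,Y})\,\beta_{XY,Z}\Rightarrow m\,(Zm)(Z\beta_{X,Y})(\beta_{X,Z}Y)(X\beta_{Y,Z})\\&\Rightarrow m\,(Zm)\,\beta_{X,ZY}(X\beta_{Y,Z})\Rightarrow m\,(mX)\,\beta_{X,ZY}(X\beta_{Y,Z})\Rightarrow m\,\beta_{X,\mathcal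 C(e,c)}(Xm)(X\beta_{Y,Z})\end{aligned}$$ of, in this order, naturality of $\beta$, $S_{X,Y,Z}$, $R_{X,Z,Y}^{-1}$, $\alpha^{-1}$, and naturality of $\beta$. * The left unitor $\underline\lambda\colon m\,\beta\,(u\otimes1)\Rightarrow m\,(1\otimes u)\,\beta_{\mathbb 1,-}=m\,(1\otimes u)\Rightarrow 1$, given by naturality of $\beta$ followed by $\rho$. * The right unitor $\underline\rho\colon m\,\beta\,(1\otimes u)\Rightarrow m\,(u\otimes 1)\,\beta_{-,\mathbb 1}=m\,(u\otimes1)\Rightarrow1$, given by naturality of $\beta$ followed by $\lambda$. Then these data satisfy (IC) and (AC); that is, $\mathcal C^{\mathsf{op}}$ is a $\mathcal V$-bicategory. -/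

import Mathlib

open CategoryTheory Bicategory

universe w v u t

/-! ### Pasting in a strict 2-category

1-cells compose in diagrammatic order: `f ≫ g` is "first `f`, then `g`".  In a Gray monoid the
tensor product of objects is associative and unital on the nose, so a 1-cell has to be read
between objects that are equal without being syntactically the same; `⟪f⟫` is that reading. -/

section Pasting

variable {V : Type u} [Bicategory.{w, v} V]

/-- The 1-cell `f : A ⟶ B`, regarded as a 1-cell `X ⟶ Y` along `X = A` and `Y = B`. -/
def hcast {A B : V} (f : A ⟶ B) {X Y : V}
    (hX : X = A := by simp only [mul_assoc, mul_one, one_mul])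
    (hY : Y = B := by simp only [mul_assoc, mul_one, one_mul]) : X ⟶ Y := by
  subst hX hY
  exact f

/-- The invertible 2-cell `η : f ≅ g`, regarded as one between the transported 1-cells. -/
def hcastIso {A B : V} {f g : A ⟶ B} (η : f ≅ g) {X Y : V} (hX : X = A) (hY : Y = B) :
    hcast f hX hY ≅ hcast g hX hY := by
  subst hX hY
  exact η

variable [Bicategory.Strict V]

theorem hcast_eq {A B : V} (f : A ⟶ B) {X Y : V} (hX : X = A) (hY : Y = B) :
    hcast f hX hY = eqToHom hX ≫ f ≫ eqToHom hY.symm := by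
  subst hX hY
  exact (Bicategory.Strict.id_comp f).symm.trans
    (congrArg (𝟙 _ ≫ ·) (Bicategory.Strict.comp_id f).symm)

theorem eq_of_heq_one_cell {A B X Y : V} {f : A ⟶ B} {g : X ⟶ Y} (hX : X = A) (hY : Y = B)
    (h : HEq f g) : g = eqToHom hX ≫ f ≫ eqToHom hY.symm := by
  subst hX hY
  rw [← eq_of_heq h]
  exact hcast_eq f rfl rfl

theorem eqTo_comp {A B C : V} (h : A = B) (h' : B = C) :
    eqToHom h ≫ eqToHom h' = eqToHom (h.trans h') := by
  subst h h'
  exact Bicategory.Strict.id_comp _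

theorem eqTo_comp_assoc {A B C D : V} (h : A = B) (h' : B = C) (f : C ⟶ D) :
    eqToHom h ≫ eqToHom h' ≫ f = eqToHom (h.trans h') ≫ f := by
  rw [← Bicategory.Strict.assoc, eqTo_comp]

end Pasting

/-- `⟪f⟫` is `f` regarded as a 1-cell between objects that equal its source and target by the
strict associativity and unitality of the tensor product. -/
notation "⟪" f "⟫" => hcast f

/-! ### Gray monoids -/

/-- The operations of a Gray monoid on a 2-category `V`: a strictly associative and unital tensor
product `A * B` of objects with unit `1`, the operations `A ⊗ -` and `- ⊗ B` on 1-cells and 2-cells,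
and the interchangers `Σ_{f,g} : (f ⊗ B') ∘ (A ⊗ g) ≅ (A' ⊗ g) ∘ (f ⊗ B)`. -/
class GrayTensor (V : Type u) [Bicategory.{w, v} V] extends Monoid V where
  tensorL (A : V) {B B' : V} (g : B ⟶ B') : A * B ⟶ A * B'
  tensorR {A A' : V} (f : A ⟶ A') (B : V) : A * B ⟶ A' * B
  tensorL₂ (A : V) {B B' : V} {g g' : B ⟶ B'} (η : g ⟶ g') : tensorL A g ⟶ tensorL A g'
  tensorR₂ {A A' : V} {f f' : A ⟶ A'} (η : f ⟶ f') (B : V) : tensorR f B ⟶ tensorR f' B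
  interchanger {A A' B B' : V} (f : A ⟶ A') (g : B ⟶ B') :
    tensorL A g ≫ tensorR f B' ≅ tensorR f B ≫ tensorL A' g

infixr:90 " ⊗ₗ " => GrayTensor.tensorL
infixl:90 " ⊗ᵣ " => GrayTensor.tensorR
infixr:90 " ⊗ₗ₂ " => GrayTensor.tensorL₂
infixl:90 " ⊗ᵣ₂ " => GrayTensor.tensorR₂

/-- A Gray monoid: a monoid for the Gray tensor product of 2-categories.  Equalities between cells
whose boundaries agree only by strict associativity, unitality and functoriality are written with
`HEq`. -/
class GrayMonoid (V : Type u) [Bicategory.{w, v} V] [Bicategory.Strict V] extends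
    GrayTensor V where
  -- `A ⊗ -` is a strict 2-functor
  tensorL_id (A B : V) : A ⊗ₗ 𝟙 B = 𝟙 (A * B)
  tensorL_comp (A : V) {B B' B'' : V} (g : B ⟶ B') (g' : B' ⟶ B'') :
    A ⊗ₗ (g ≫ g') = A ⊗ₗ g ≫ A ⊗ₗ g'
  tensorL₂_id (A : V) {B B' : V} (g : B ⟶ B') : A ⊗ₗ₂ 𝟙 g = 𝟙 (A ⊗ₗ g)
  tensorL₂_comp (A : V) {B B' : V} {g g' g'' : B ⟶ B'} (η : g ⟶ g') (θ : g' ⟶ g'') :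
    A ⊗ₗ₂ (η ≫ θ) = A ⊗ₗ₂ η ≫ A ⊗ₗ₂ θ
  tensorL₂_whiskerLeft (A : V) {B B' B'' : V} (h : B ⟶ B') {g g' : B' ⟶ B''} (η : g ⟶ g') :
    HEq (A ⊗ₗ₂ (h ◁ η)) ((A ⊗ₗ h) ◁ (A ⊗ₗ₂ η))
  tensorL₂_whiskerRight (A : V) {B B' B'' : V} {g g' : B ⟶ B'} (η : g ⟶ g') (h : B' ⟶ B'') :
    HEq (A ⊗ₗ₂ (η ▷ h)) ((A ⊗ₗ₂ η) ▷ (A ⊗ₗ h))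
  -- `- ⊗ B` is a strict 2-functor
  tensorR_id (A B : V) : 𝟙 A ⊗ᵣ B = 𝟙 (A * B)
  tensorR_comp {A A' A'' : V} (f : A ⟶ A') (f' : A' ⟶ A'') (B : V) :
    (f ≫ f') ⊗ᵣ B = f ⊗ᵣ B ≫ f' ⊗ᵣ B
  tensorR₂_id {A A' : V} (f : A ⟶ A') (B : V) : 𝟙 f ⊗ᵣ₂ B = 𝟙 (f ⊗ᵣ B)
  tensorR₂_comp {A A' : V} {f f' f'' : A ⟶ A'} (η : f ⟶ f') (θ : f' ⟶ f'') (B : V) :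
    (η ≫ θ) ⊗ᵣ₂ B = η ⊗ᵣ₂ B ≫ θ ⊗ᵣ₂ B
  tensorR₂_whiskerLeft {A A' A'' : V} (h : A ⟶ A') {f f' : A' ⟶ A''} (η : f ⟶ f') (B : V) :
    HEq ((h ◁ η) ⊗ᵣ₂ B) ((h ⊗ᵣ B) ◁ (η ⊗ᵣ₂ B))
  tensorR₂_whiskerRight {A A' A'' : V} {f f' : A ⟶ A'} (η : f ⟶ f') (h : A' ⟶ A'') (B : V) :
    HEq ((η ▷ h) ⊗ᵣ₂ B) ((η ⊗ᵣ₂ B) ▷ (h ⊗ᵣ B))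
  -- strict associativity and unitality on 1-cells
  mul_tensorL (A B : V) {C C' : V} (h : C ⟶ C') : HEq ((A * B) ⊗ₗ h) (A ⊗ₗ (B ⊗ₗ h))
  tensorL_tensorR (A : V) {B B' : V} (g : B ⟶ B') (C : V) :
    HEq ((A ⊗ₗ g) ⊗ᵣ C) (A ⊗ₗ (g ⊗ᵣ C))
  tensorR_mul {A A' : V} (f : A ⟶ A') (B C : V) : HEq (f ⊗ᵣ (B * C)) ((f ⊗ᵣ B) ⊗ᵣ C)
  one_tensorL {A A' : V} (f : A ⟶ A') : HEq ((1 : V) ⊗ₗ f) f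
  tensorR_one {A A' : V} (f : A ⟶ A') : HEq (f ⊗ᵣ (1 : V)) f
  -- strict associativity and unitality on 2-cells
  mul_tensorL₂ (A B : V) {C C' : V} {h h' : C ⟶ C'} (η : h ⟶ h') :
    HEq ((A * B) ⊗ₗ₂ η) (A ⊗ₗ₂ (B ⊗ₗ₂ η))
  tensorL₂_tensorR₂ (A : V) {B B' : V} {g g' : B ⟶ B'} (η : g ⟶ g') (C : V) :
    HEq ((A ⊗ₗ₂ η) ⊗ᵣ₂ C) (A ⊗ₗ₂ (η ⊗ᵣ₂ C))
  tensorR₂_mul {A A' : V} {f f' : A ⟶ A'} (η : f ⟶ f') (B C : V) :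
    HEq (η ⊗ᵣ₂ (B * C)) ((η ⊗ᵣ₂ B) ⊗ᵣ₂ C)
  one_tensorL₂ {A A' : V} {f f' : A ⟶ A'} (η : f ⟶ f') : HEq ((1 : V) ⊗ₗ₂ η) η
  tensorR₂_one {A A' : V} {f f' : A ⟶ A'} (η : f ⟶ f') : HEq (η ⊗ᵣ₂ (1 : V)) η
  -- interchangers and identity 1-cells
  interchanger_id_left (A : V) {B B' : V} (g : B ⟶ B') :
    HEq (GrayTensor.interchanger (𝟙 A) g).hom (𝟙 (A ⊗ₗ g))
  interchanger_id_right {A A' : V} (f : A ⟶ A') (B : V) :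
    HEq (GrayTensor.interchanger f (𝟙 B)).hom (𝟙 (f ⊗ᵣ B))
  -- interchangers and the tensor product
  tensorL₂_interchanger (C : V) {A A' B B' : V} (f : A ⟶ A') (g : B ⟶ B') :
    HEq (C ⊗ₗ₂ (GrayTensor.interchanger f g).hom) (GrayTensor.interchanger (C ⊗ₗ f) g).hom
  interchanger_tensor {A A' : V} (f : A ⟶ A') (C : V) {B B' : V} (g : B ⟶ B') :
    HEq (GrayTensor.interchanger (f ⊗ᵣ C) g).hom (GrayTensor.interchanger f (C ⊗ₗ g)).hom
  tensorR₂_interchanger {A A' B B' : V} (f : A ⟶ A') (g : B ⟶ B') (C : V) :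
    HEq ((GrayTensor.interchanger f g).hom ⊗ᵣ₂ C) (GrayTensor.interchanger f (g ⊗ᵣ C)).hom
  -- naturality of interchangers in 2-cells
  interchanger_natural_left {A A' B B' : V} {f f' : A ⟶ A'} (η : f ⟶ f') (g : B ⟶ B') :
    (GrayTensor.interchanger f g).hom ≫ (η ⊗ᵣ₂ B) ▷ (A' ⊗ₗ g) =
      (A ⊗ₗ g) ◁ (η ⊗ᵣ₂ B') ≫ (GrayTensor.interchanger f' g).hom
  interchanger_natural_right {A A' B B' : V} (f : A ⟶ A') {g g' : B ⟶ B'} (θ : g ⟶ g') :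
    (GrayTensor.interchanger f g).hom ≫ (f ⊗ᵣ B) ◁ (A' ⊗ₗ₂ θ) =
      (A ⊗ₗ₂ θ) ▷ (f ⊗ᵣ B') ≫ (GrayTensor.interchanger f g').hom
  -- interchangers and composition of 1-cells
  interchanger_comp_left {A A' A'' B B' : V} (f : A ⟶ A') (f' : A' ⟶ A'') (g : B ⟶ B') :
    HEq (GrayTensor.interchanger (f ≫ f') g).hom
      ((GrayTensor.interchanger f g).hom ▷ (f' ⊗ᵣ B') ≫ (α_ _ _ _).hom ≫
        (f ⊗ᵣ B) ◁ (GrayTensor.interchanger f' g).hom)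
  interchanger_comp_right {A A' B B' B'' : V} (f : A ⟶ A') (g : B ⟶ B') (g' : B' ⟶ B'') :
    HEq (GrayTensor.interchanger f (g ≫ g')).hom
      ((A ⊗ₗ g) ◁ (GrayTensor.interchanger f g').hom ≫ (α_ _ _ _).inv ≫
        (GrayTensor.interchanger f g).hom ▷ (A' ⊗ₗ g'))

namespace GrayMonoid

variable {V : Type u} [Bicategory.{w, v} V] [Bicategory.Strict V] [GrayMonoid V]

/-- `A ⊗ η` for an invertible 2-cell `η`. -/
@[simps]
def tensorLIso (A : V) {B B' : V} {g g' : B ⟶ B'} (η : g ≅ g') : A ⊗ₗ g ≅ A ⊗ₗ g' where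
  hom := A ⊗ₗ₂ η.hom
  inv := A ⊗ₗ₂ η.inv
  hom_inv_id := by rw [← tensorL₂_comp, η.hom_inv_id, tensorL₂_id]
  inv_hom_id := by rw [← tensorL₂_comp, η.inv_hom_id, tensorL₂_id]

/-- `η ⊗ B` for an invertible 2-cell `η`. -/
@[simps]
def tensorRIso {A A' : V} {f f' : A ⟶ A'} (η : f ≅ f') (B : V) : f ⊗ᵣ B ≅ f' ⊗ᵣ B where
  hom := η.hom ⊗ᵣ₂ B
  inv := η.inv ⊗ᵣ₂ B
  hom_inv_id := by rw [← tensorR₂_comp, η.hom_inv_id, tensorR₂_id]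
  inv_hom_id := by rw [← tensorR₂_comp, η.inv_hom_id, tensorR₂_id]

theorem mul_tensorL_eq (A B : V) {C C' : V} (h : C ⟶ C') :
    (A * B) ⊗ₗ h =
      eqToHom (mul_assoc A B C) ≫ A ⊗ₗ (B ⊗ₗ h) ≫ eqToHom (mul_assoc A B C').symm :=
  eq_of_heq_one_cell _ (mul_assoc _ _ _) (mul_tensorL A B h).symm

theorem tensorL_tensorR_eq (A : V) {B B' : V} (g : B ⟶ B') (C : V) :
    (A ⊗ₗ g) ⊗ᵣ C =
      eqToHom (mul_assoc A B C) ≫ A ⊗ₗ (g ⊗ᵣ C) ≫ eqToHom (mul_assoc A B' C).symm :=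
  eq_of_heq_one_cell _ (mul_assoc _ _ _) (tensorL_tensorR A g C).symm

theorem tensorR_mul_eq {A A' : V} (f : A ⟶ A') (B C : V) :
    f ⊗ᵣ (B * C) =
      eqToHom (mul_assoc A B C).symm ≫ (f ⊗ᵣ B) ⊗ᵣ C ≫ eqToHom (mul_assoc A' B C) :=
  eq_of_heq_one_cell _ (mul_assoc _ _ _).symm (tensorR_mul f B C).symm

theorem one_tensorL_eq {A A' : V} (f : A ⟶ A') :
    (1 : V) ⊗ₗ f = eqToHom (one_mul A) ≫ f ≫ eqToHom (one_mul A').symm :=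
  eq_of_heq_one_cell _ (one_mul _) (one_tensorL f).symm

theorem tensorR_one_eq {A A' : V} (f : A ⟶ A') :
    f ⊗ᵣ (1 : V) = eqToHom (mul_one A) ≫ f ≫ eqToHom (mul_one A').symm :=
  eq_of_heq_one_cell _ (mul_one _) (tensorR_one f).symm

theorem tensorL_eqToHom (A : V) {B B' : V} (h : B = B') :
    A ⊗ₗ eqToHom h = eqToHom (congrArg (A * ·) h) := by
  subst h
  simp [tensorL_id]

theorem tensorR_eqToHom {A A' : V} (h : A = A') (B : V) :
    eqToHom h ⊗ᵣ B = eqToHom (congrArg (· * B) h) := by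
  subst h
  simp [tensorR_id]

end GrayMonoid

open GrayMonoid

/-! ### Braidings -/

/-- The operations of a braiding on a Gray monoid: the 1-cells `β_{A,B} : A ⊗ B ⟶ B ⊗ A` with
their invertible naturality 2-cells in either variable, and the invertible 2-cells
`R : β_{A,BC} ≅ (B ⊗ β_{A,C}) ∘ (β_{A,B} ⊗ C)` and
`S : β_{AB,C} ≅ (β_{A,C} ⊗ B) ∘ (A ⊗ β_{B,C})`. -/
class GrayBraiding (V : Type u) [Bicategory.{w, v} V] [Bicategory.Strict V] [GrayMonoid V] where
  β (A B : V) : A * B ⟶ B * A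
  βL {A A' : V} (f : A ⟶ A') (B : V) : f ⊗ᵣ B ≫ β A' B ≅ β A B ≫ B ⊗ₗ f
  βR (A : V) {B B' : V} (g : B ⟶ B') : A ⊗ₗ g ≫ β A B' ≅ β A B ≫ g ⊗ᵣ A
  R (A B C : V) : (⟪β A (B * C)⟫ : A * B * C ⟶ B * C * A) ≅
    β A B ⊗ᵣ C ≫ (⟪B ⊗ₗ β A C⟫ : B * A * C ⟶ B * C * A)
  S (A B C : V) : (⟪β (A * B) C⟫ : A * B * C ⟶ C * A * B) ≅
    (⟪A ⊗ₗ β B C⟫ : A * B * C ⟶ A * C * B) ≫ β A C ⊗ᵣ B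

open GrayTensor GrayBraiding

theorem β_mul_right {V : Type u} [Bicategory.{w, v} V] [Bicategory.Strict V] [GrayMonoid V]
    [GrayBraiding V] (A B C D : V) :
    β A (B * (C * D)) =
      eqToHom (congrArg (A * ·) (mul_assoc B C D).symm) ≫ β A (B * C * D) ≫
        eqToHom (congrArg (· * A) (mul_assoc B C D)) :=
  eq_of_heq_one_cell _ (congrArg (· * A) (mul_assoc B C D).symm) (by rw [mul_assoc B C D])

theorem β_mul_left {V : Type u} [Bicategory.{w, v} V] [Bicategory.Strict V] [GrayMonoid V]
    [GrayBraiding V] (A B C D : V) :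
    β (A * (B * C)) D =
      eqToHom (congrArg (· * D) (mul_assoc A B C).symm) ≫ β (A * B * C) D ≫
        eqToHom (congrArg (D * ·) (mul_assoc A B C)) :=
  eq_of_heq_one_cell _ (congrArg (D * ·) (mul_assoc A B C).symm) (by rw [mul_assoc A B C])

section Step

variable {V : Type u} [Bicategory.{w, v} V] [Bicategory.Strict V] [GrayMonoid V]

/-- One layer of a string diagram: the invertible 2-cell `η : f ≅ g` whiskered by `p` before it
and by `q` after it, as a 2-cell from `F = p ≫ f ≫ q` to `G = p ≫ g ≫ q`.  The four equations say
that the boundaries agree in the strict structure. -/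
def step {W X Y Z A B : V} (p : W ⟶ X) {f g : A ⟶ B} (η : f ≅ g) (q : Y ⟶ Z) {F G : W ⟶ Z}
    (hX : X = A := by simp only [mul_assoc, mul_one, one_mul])
    (hY : Y = B := by simp only [mul_assoc, mul_one, one_mul])
    (hF : F = p ≫ hcast f hX hY ≫ q := by
      simp only [hcast_eq, mul_tensorL_eq, tensorL_tensorR_eq, tensorR_mul_eq, one_tensorL_eq,
        tensorR_one_eq, tensorL_eqToHom, tensorR_eqToHom, tensorL_comp, tensorR_comp, tensorL_id,
        tensorR_id, Bicategory.Strict.assoc, Bicategory.Strict.id_comp, Bicategory.Strict.comp_id,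
        eqTo_comp, eqTo_comp_assoc, eqToHom_refl, β_mul_right, β_mul_left])
    (hG : G = p ≫ hcast g hX hY ≫ q := by
      simp only [hcast_eq, mul_tensorL_eq, tensorL_tensorR_eq, tensorR_mul_eq, one_tensorL_eq,
        tensorR_one_eq, tensorL_eqToHom, tensorR_eqToHom, tensorL_comp, tensorR_comp, tensorL_id,
        tensorR_id, Bicategory.Strict.assoc, Bicategory.Strict.id_comp, Bicategory.Strict.comp_id,
        eqTo_comp, eqTo_comp_assoc, eqToHom_refl, β_mul_right, β_mul_left]) : F ≅ G :=
  eqToIso hF ≪≫ whiskerLeftIso p (whiskerRightIso (hcastIso η hX hY) q) ≪≫ eqToIso hG.symm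

end Step

/-- A braided Gray monoid: `β` is a pseudonatural equivalence `⊗ ⇒ ⊗ ∘ σ` of 2-functors on the
Gray tensor square, `R` and `S` are modifications, and the four braiding axioms hold. -/
class BraidedGrayMonoid (V : Type u) [Bicategory.{w, v} V] [Bicategory.Strict V]
    [GrayMonoid V] [GrayBraiding V] : Prop where
  -- `β` is an equivalence
  β_equivalence (A B : V) : ∃ e : (A * B) ≌ (B * A), e.hom = β A B
  -- pseudonaturality of `β`: identities, composites, 2-cells, interchangers
  βL_id (A B : V) : HEq (βL (𝟙 A) B).hom (𝟙 (β A B))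
  βR_id (A B : V) : HEq (βR A (𝟙 B)).hom (𝟙 (β A B))
  βL_comp {A A' A'' : V} (f : A ⟶ A') (f' : A' ⟶ A'') (B : V) :
    HEq (βL (f ≫ f') B).hom
      ((f ⊗ᵣ B) ◁ (βL f' B).hom ≫ (α_ _ _ _).inv ≫ (βL f B).hom ▷ (B ⊗ₗ f'))
  βR_comp (A : V) {B B' B'' : V} (g : B ⟶ B') (g' : B' ⟶ B'') :
    HEq (βR A (g ≫ g')).hom
      ((A ⊗ₗ g) ◁ (βR A g').hom ≫ (α_ _ _ _).inv ≫ (βR A g).hom ▷ (g' ⊗ᵣ A))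
  βL_natural {A A' : V} {f f' : A ⟶ A'} (η : f ⟶ f') (B : V) :
    (η ⊗ᵣ₂ B) ▷ β A' B ≫ (βL f' B).hom = (βL f B).hom ≫ β A B ◁ (B ⊗ₗ₂ η)
  βR_natural (A : V) {B B' : V} {g g' : B ⟶ B'} (θ : g ⟶ g') :
    (A ⊗ₗ₂ θ) ▷ β A B' ≫ (βR A g').hom = (βR A g).hom ≫ β A B ◁ (θ ⊗ᵣ₂ A)
  β_interchanger {A A' B B' : V} (f : A ⟶ A') (g : B ⟶ B') :
    (interchanger f g).hom ▷ β A' B' ≫ (α_ _ _ _).hom ≫ (f ⊗ᵣ B) ◁ (βR A' g).hom ≫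
        (α_ _ _ _).inv ≫ (βL f B).hom ▷ (g ⊗ᵣ A') ≫ (α_ _ _ _).hom =
      (α_ _ _ _).hom ≫ (A ⊗ₗ g) ◁ (βL f B').hom ≫ (α_ _ _ _).inv ≫
        (βR A g).hom ▷ (B' ⊗ₗ f) ≫ (α_ _ _ _).hom ≫ β A B ◁ (interchanger g f).inv
  -- `R` is a modification
  R_natural₁ {A A' : V} (f : A ⟶ A') (B C : V) :
    (step (𝟙 _) (βL f (B * C)) (𝟙 _) :
        f ⊗ᵣ B ⊗ᵣ C ≫ (⟪β A' (B * C)⟫ : A' * B * C ⟶ B * C * A') ≅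
          (⟪β A (B * C)⟫ : A * B * C ⟶ B * C * A) ≫ (B * C) ⊗ₗ f) ≪≫
      (step (𝟙 _) (R A B C) ((B * C) ⊗ₗ f) :
        _ ≅ β A B ⊗ᵣ C ≫ (⟪B ⊗ₗ β A C⟫ : B * A * C ⟶ B * C * A) ≫ (B * C) ⊗ₗ f) =
    (step (f ⊗ᵣ B ⊗ᵣ C) (R A' B C) (𝟙 _) :
        _ ≅ f ⊗ᵣ B ⊗ᵣ C ≫ β A' B ⊗ᵣ C ≫ (⟪B ⊗ₗ β A' C⟫ : B * A' * C ⟶ B * C * A')) ≪≫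
      (step (𝟙 _) (tensorRIso (βL f B) C) (⟪B ⊗ₗ β A' C⟫ : B * A' * C ⟶ B * C * A') :
        _ ≅ β A B ⊗ᵣ C ≫ (B ⊗ₗ f) ⊗ᵣ C ≫ (⟪B ⊗ₗ β A' C⟫ : B * A' * C ⟶ B * C * A')) ≪≫
      step (β A B ⊗ᵣ C) (tensorLIso B (βL f C)) (𝟙 _)
  R_natural₂ (A : V) {B B' : V} (g : B ⟶ B') (C : V) :
    (step (𝟙 _) (βR A (g ⊗ᵣ C)) (𝟙 _) :
        (A ⊗ₗ g) ⊗ᵣ C ≫ (⟪β A (B' * C)⟫ : A * B' * C ⟶ B' * C * A) ≅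
          (⟪β A (B * C)⟫ : A * B * C ⟶ B * C * A) ≫ g ⊗ᵣ C ⊗ᵣ A) ≪≫
      (step (𝟙 _) (R A B C) (g ⊗ᵣ C ⊗ᵣ A) :
        _ ≅ β A B ⊗ᵣ C ≫ (⟪B ⊗ₗ β A C⟫ : B * A * C ⟶ B * C * A) ≫ g ⊗ᵣ C ⊗ᵣ A) =
    (step ((A ⊗ₗ g) ⊗ᵣ C) (R A B' C) (𝟙 _) :
        _ ≅ (A ⊗ₗ g) ⊗ᵣ C ≫ β A B' ⊗ᵣ C ≫ (⟪B' ⊗ₗ β A C⟫ : B' * A * C ⟶ B' * C * A)) ≪≫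
      (step (𝟙 _) (tensorRIso (βR A g) C) (⟪B' ⊗ₗ β A C⟫ : B' * A * C ⟶ B' * C * A) :
        _ ≅ β A B ⊗ᵣ C ≫ g ⊗ᵣ A ⊗ᵣ C ≫ (⟪B' ⊗ₗ β A C⟫ : B' * A * C ⟶ B' * C * A)) ≪≫
      step (β A B ⊗ᵣ C) (interchanger g (β A C)).symm (𝟙 _)
  R_natural₃ (A B : V) {C C' : V} (h : C ⟶ C') :
    (step (𝟙 _) (βR A (B ⊗ₗ h)) (𝟙 _) :
        (A * B) ⊗ₗ h ≫ (⟪β A (B * C')⟫ : A * B * C' ⟶ B * C' * A) ≅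
          (⟪β A (B * C)⟫ : A * B * C ⟶ B * C * A) ≫ (B ⊗ₗ h) ⊗ᵣ A) ≪≫
      (step (𝟙 _) (R A B C) ((B ⊗ₗ h) ⊗ᵣ A) :
        _ ≅ β A B ⊗ᵣ C ≫ (⟪B ⊗ₗ β A C⟫ : B * A * C ⟶ B * C * A) ≫ (B ⊗ₗ h) ⊗ᵣ A) =
    (step ((A * B) ⊗ₗ h) (R A B C') (𝟙 _) :
        _ ≅ (A * B) ⊗ₗ h ≫ β A B ⊗ᵣ C' ≫ (⟪B ⊗ₗ β A C'⟫ : B * A * C' ⟶ B * C' * A)) ≪≫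
      (step (𝟙 _) (interchanger (β A B) h) (⟪B ⊗ₗ β A C'⟫ : B * A * C' ⟶ B * C' * A) :
        _ ≅ β A B ⊗ᵣ C ≫ (B * A) ⊗ₗ h ≫ (⟪B ⊗ₗ β A C'⟫ : B * A * C' ⟶ B * C' * A)) ≪≫
      step (β A B ⊗ᵣ C) (tensorLIso B (βR A h)) (𝟙 _)
  -- `S` is a modification
  S_natural₁ {A A' : V} (f : A ⟶ A') (B C : V) :
    (step (𝟙 _) (βL (f ⊗ᵣ B) C) (𝟙 _) :
        f ⊗ᵣ B ⊗ᵣ C ≫ (⟪β (A' * B) C⟫ : A' * B * C ⟶ C * A' * B) ≅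
          (⟪β (A * B) C⟫ : A * B * C ⟶ C * A * B) ≫ (C ⊗ₗ f) ⊗ᵣ B) ≪≫
      (step (𝟙 _) (S A B C) ((C ⊗ₗ f) ⊗ᵣ B) :
        _ ≅ (⟪A ⊗ₗ β B C⟫ : A * B * C ⟶ A * C * B) ≫ β A C ⊗ᵣ B ≫ (C ⊗ₗ f) ⊗ᵣ B) =
    (step (f ⊗ᵣ B ⊗ᵣ C) (S A' B C) (𝟙 _) :
        _ ≅ f ⊗ᵣ B ⊗ᵣ C ≫ (⟪A' ⊗ₗ β B C⟫ : A' * B * C ⟶ A' * C * B) ≫ β A' C ⊗ᵣ B) ≪≫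
      (step (𝟙 _) (interchanger f (β B C)).symm (β A' C ⊗ᵣ B) :
        _ ≅ (⟪A ⊗ₗ β B C⟫ : A * B * C ⟶ A * C * B) ≫ f ⊗ᵣ C ⊗ᵣ B ≫ β A' C ⊗ᵣ B) ≪≫
      step (⟪A ⊗ₗ β B C⟫ : A * B * C ⟶ A * C * B) (tensorRIso (βL f C) B) (𝟙 _)
  S_natural₂ (A : V) {B B' : V} (g : B ⟶ B') (C : V) :
    (step (𝟙 _) (βL (A ⊗ₗ g) C) (𝟙 _) :
        (A ⊗ₗ g) ⊗ᵣ C ≫ (⟪β (A * B') C⟫ : A * B' * C ⟶ C * A * B') ≅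
          (⟪β (A * B) C⟫ : A * B * C ⟶ C * A * B) ≫ (C * A) ⊗ₗ g) ≪≫
      (step (𝟙 _) (S A B C) ((C * A) ⊗ₗ g) :
        _ ≅ (⟪A ⊗ₗ β B C⟫ : A * B * C ⟶ A * C * B) ≫ β A C ⊗ᵣ B ≫ (C * A) ⊗ₗ g) =
    (step ((A ⊗ₗ g) ⊗ᵣ C) (S A B' C) (𝟙 _) :
        _ ≅ (A ⊗ₗ g) ⊗ᵣ C ≫ (⟪A ⊗ₗ β B' C⟫ : A * B' * C ⟶ A * C * B') ≫ β A C ⊗ᵣ B') ≪≫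
      (step (𝟙 _) (tensorLIso A (βL g C)) (β A C ⊗ᵣ B') :
        _ ≅ (⟪A ⊗ₗ β B C⟫ : A * B * C ⟶ A * C * B) ≫ (A * C) ⊗ₗ g ≫ β A C ⊗ᵣ B') ≪≫
      step (⟪A ⊗ₗ β B C⟫ : A * B * C ⟶ A * C * B) (interchanger (β A C) g) (𝟙 _)
  S_natural₃ (A B : V) {C C' : V} (h : C ⟶ C') :
    (step (𝟙 _) (βR (A * B) h) (𝟙 _) :
        (A * B) ⊗ₗ h ≫ (⟪β (A * B) C'⟫ : A * B * C' ⟶ C' * A * B) ≅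
          (⟪β (A * B) C⟫ : A * B * C ⟶ C * A * B) ≫ h ⊗ᵣ A ⊗ᵣ B) ≪≫
      (step (𝟙 _) (S A B C) (h ⊗ᵣ A ⊗ᵣ B) :
        _ ≅ (⟪A ⊗ₗ β B C⟫ : A * B * C ⟶ A * C * B) ≫ β A C ⊗ᵣ B ≫ h ⊗ᵣ A ⊗ᵣ B) =
    (step ((A * B) ⊗ₗ h) (S A B C') (𝟙 _) :
        _ ≅ (A * B) ⊗ₗ h ≫ (⟪A ⊗ₗ β B C'⟫ : A * B * C' ⟶ A * C' * B) ≫ β A C' ⊗ᵣ B) ≪≫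
      (step (𝟙 _) (tensorLIso A (βR B h)) (β A C' ⊗ᵣ B) :
        _ ≅ (⟪A ⊗ₗ β B C⟫ : A * B * C ⟶ A * C * B) ≫ (A ⊗ₗ h) ⊗ᵣ B ≫ β A C' ⊗ᵣ B) ≪≫
      step (⟪A ⊗ₗ β B C⟫ : A * B * C ⟶ A * C * B) (tensorRIso (βR A h) B) (𝟙 _)
  -- the four braiding axioms
  braiding₁ (A B C D : V) :
    (step (𝟙 _) (R A B (C * D)) (𝟙 _) :
        (⟪β A (B * C * D)⟫ : A * B * C * D ⟶ B * C * D * A) ≅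
          β A B ⊗ᵣ C ⊗ᵣ D ≫ (⟪B ⊗ₗ β A (C * D)⟫ : B * A * C * D ⟶ B * C * D * A)) ≪≫
      (step (β A B ⊗ᵣ C ⊗ᵣ D) (tensorLIso B (R A C D)) (𝟙 _) :
        _ ≅ β A B ⊗ᵣ C ⊗ᵣ D ≫ (⟪(B ⊗ₗ β A C) ⊗ᵣ D⟫ : B * A * C * D ⟶ B * C * A * D) ≫
          (⟪(B * C) ⊗ₗ β A D⟫ : B * C * A * D ⟶ B * C * D * A)) =
    (step (𝟙 _) (R A (B * C) D) (𝟙 _) :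
        _ ≅ (⟪β A (B * C) ⊗ᵣ D⟫ : A * B * C * D ⟶ B * C * A * D) ≫
          (⟪(B * C) ⊗ₗ β A D⟫ : B * C * A * D ⟶ B * C * D * A)) ≪≫
      step (𝟙 _) (tensorRIso (R A B C) D) (⟪(B * C) ⊗ₗ β A D⟫ : B * C * A * D ⟶ B * C * D * A)
  braiding₂ (A B C D : V) :
    (step (𝟙 _) (S (A * B) C D) (𝟙 _) :
        (⟪β (A * B * C) D⟫ : A * B * C * D ⟶ D * A * B * C) ≅
          (⟪(A * B) ⊗ₗ β C D⟫ : A * B * C * D ⟶ A * B * D * C) ≫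
            (⟪β (A * B) D ⊗ᵣ C⟫ : A * B * D * C ⟶ D * A * B * C)) ≪≫
      (step (⟪(A * B) ⊗ₗ β C D⟫ : A * B * C * D ⟶ A * B * D * C) (tensorRIso (S A B D) C) (𝟙 _) :
        _ ≅ (⟪(A * B) ⊗ₗ β C D⟫ : A * B * C * D ⟶ A * B * D * C) ≫
          (⟪(A ⊗ₗ β B D) ⊗ᵣ C⟫ : A * B * D * C ⟶ A * D * B * C) ≫ β A D ⊗ᵣ B ⊗ᵣ C) =
    (step (𝟙 _) (S A (B * C) D) (𝟙 _) :
        _ ≅ (⟪A ⊗ₗ β (B * C) D⟫ : A * B * C * D ⟶ A * D * B * C) ≫ β A D ⊗ᵣ B ⊗ᵣ C) ≪≫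
      step (𝟙 _) (tensorLIso A (S B C D)) (β A D ⊗ᵣ B ⊗ᵣ C)
  braiding₃ (A B C D : V) :
    (step (𝟙 _) (tensorRIso (S A B C) D) (⟪C ⊗ₗ β (A * B) D⟫ : C * A * B * D ⟶ C * D * A * B) :
        (⟪β (A * B) C ⊗ᵣ D⟫ : A * B * C * D ⟶ C * A * B * D) ≫
            (⟪C ⊗ₗ β (A * B) D⟫ : C * A * B * D ⟶ C * D * A * B) ≅
          (⟪(A ⊗ₗ β B C) ⊗ᵣ D⟫ : A * B * C * D ⟶ A * C * B * D) ≫ β A C ⊗ᵣ B ⊗ᵣ D ≫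
            (⟪C ⊗ₗ β (A * B) D⟫ : C * A * B * D ⟶ C * D * A * B)) ≪≫
      (step ((⟪(A ⊗ₗ β B C) ⊗ᵣ D⟫ : A * B * C * D ⟶ A * C * B * D) ≫ β A C ⊗ᵣ B ⊗ᵣ D)
          (tensorLIso C (S A B D)) (𝟙 _) :
        _ ≅ (⟪(A ⊗ₗ β B C) ⊗ᵣ D⟫ : A * B * C * D ⟶ A * C * B * D) ≫ β A C ⊗ᵣ B ⊗ᵣ D ≫
            (⟪(C * A) ⊗ₗ β B D⟫ : C * A * B * D ⟶ C * A * D * B) ≫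
            (⟪(C ⊗ₗ β A D) ⊗ᵣ B⟫ : C * A * D * B ⟶ C * D * A * B)) ≪≫
      (step (⟪(A ⊗ₗ β B C) ⊗ᵣ D⟫ : A * B * C * D ⟶ A * C * B * D)
          (interchanger (β A C) (β B D)).symm
          (⟪(C ⊗ₗ β A D) ⊗ᵣ B⟫ : C * A * D * B ⟶ C * D * A * B) :
        _ ≅ (⟪(A ⊗ₗ β B C) ⊗ᵣ D⟫ : A * B * C * D ⟶ A * C * B * D) ≫
            (⟪(A * C) ⊗ₗ β B D⟫ : A * C * B * D ⟶ A * C * D * B) ≫ β A C ⊗ᵣ D ⊗ᵣ B ≫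
            (⟪(C ⊗ₗ β A D) ⊗ᵣ B⟫ : C * A * D * B ⟶ C * D * A * B)) ≪≫
      (step ((⟪(A ⊗ₗ β B C) ⊗ᵣ D⟫ : A * B * C * D ⟶ A * C * B * D) ≫
            (⟪(A * C) ⊗ₗ β B D⟫ : A * C * B * D ⟶ A * C * D * B))
          (tensorRIso (R A C D).symm B) (𝟙 _) :
        _ ≅ (⟪(A ⊗ₗ β B C) ⊗ᵣ D⟫ : A * B * C * D ⟶ A * C * B * D) ≫
            (⟪(A * C) ⊗ₗ β B D⟫ : A * C * B * D ⟶ A * C * D * B) ≫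
            (⟪β A (C * D) ⊗ᵣ B⟫ : A * C * D * B ⟶ C * D * A * B)) ≪≫
      (step (𝟙 _) (tensorLIso A (R B C D).symm)
          (⟪β A (C * D) ⊗ᵣ B⟫ : A * C * D * B ⟶ C * D * A * B) :
        _ ≅ (⟪A ⊗ₗ β B (C * D)⟫ : A * B * C * D ⟶ A * C * D * B) ≫
            (⟪β A (C * D) ⊗ᵣ B⟫ : A * C * D * B ⟶ C * D * A * B)) =
    (step (𝟙 _) (R (A * B) C D).symm (𝟙 _) :
        _ ≅ (⟪β (A * B) (C * D)⟫ : A * B * C * D ⟶ C * D * A * B)) ≪≫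
      step (𝟙 _) (S A B (C * D)) (𝟙 _)
  braiding₄ (A B C : V) :
    (step (𝟙 _) (R A B C).symm (β B C ⊗ᵣ A) :
        β A B ⊗ᵣ C ≫ (⟪B ⊗ₗ β A C⟫ : B * A * C ⟶ B * C * A) ≫ β B C ⊗ᵣ A ≅
          (⟪β A (B * C)⟫ : A * B * C ⟶ B * C * A) ≫ β B C ⊗ᵣ A) ≪≫
      (step (𝟙 _) (βR A (β B C)).symm (𝟙 _) :
        _ ≅ (⟪A ⊗ₗ β B C⟫ : A * B * C ⟶ A * C * B) ≫
          (⟪β A (C * B)⟫ : A * C * B ⟶ C * B * A)) ≪≫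
      (step (⟪A ⊗ₗ β B C⟫ : A * B * C ⟶ A * C * B) (R A C B) (𝟙 _) :
        _ ≅ (⟪A ⊗ₗ β B C⟫ : A * B * C ⟶ A * C * B) ≫ β A C ⊗ᵣ B ≫
          (⟪C ⊗ₗ β A B⟫ : C * A * B ⟶ C * B * A)) =
    (step (β A B ⊗ᵣ C) (S B A C).symm (𝟙 _) :
        _ ≅ β A B ⊗ᵣ C ≫ (⟪β (B * A) C⟫ : B * A * C ⟶ C * B * A)) ≪≫
      (step (𝟙 _) (βL (β A B) C) (𝟙 _) :
        _ ≅ (⟪β (A * B) C⟫ : A * B * C ⟶ C * A * B) ≫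
          (⟪C ⊗ₗ β A B⟫ : C * A * B ⟶ C * B * A)) ≪≫
      step (𝟙 _) (S A B C) (⟪C ⊗ₗ β A B⟫ : C * A * B ⟶ C * B * A)

/-- A semi-strict braided monoidal bicategory: a braided Gray monoid satisfying the further unit
axioms on `β`, `R` and `S`. -/
class SemistrictBraided (V : Type u) [Bicategory.{w, v} V] [Bicategory.Strict V]
    [GrayMonoid V] [GrayBraiding V] extends BraidedGrayMonoid V where
  β_one_right (A : V) : HEq (β A 1) (𝟙 A)
  β_one_left (A : V) : HEq (β 1 A) (𝟙 A)
  R_one_right (A B : V) : HEq (R A B 1).hom (𝟙 (β A B))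
  R_one_middle (A B : V) : HEq (R A 1 B).hom (𝟙 (β A B))
  S_one_left (A B : V) : HEq (S 1 A B).hom (𝟙 (β A B))
  S_one_middle (A B : V) : HEq (S A 1 B).hom (𝟙 (β A B))
  R_one_left (A B : V) : HEq (R 1 A B).hom (𝟙 (𝟙 (A * B)))
  S_one_right (A B : V) : HEq (S A B 1).hom (𝟙 (𝟙 (A * B)))

namespace SemistrictBraided

variable {V : Type u} [Bicategory.{w, v} V] [Bicategory.Strict V] [GrayMonoid V]
  [GrayBraiding V] [SemistrictBraided V]

theorem β_one_right_eq (A : V) :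
    β A 1 = eqToHom (mul_one A) ≫ 𝟙 A ≫ eqToHom (one_mul A).symm :=
  eq_of_heq_one_cell _ (one_mul A) (β_one_right A).symm

theorem β_one_left_eq (A : V) :
    β 1 A = eqToHom (one_mul A) ≫ 𝟙 A ≫ eqToHom (mul_one A).symm :=
  eq_of_heq_one_cell _ (mul_one A) (β_one_left A).symm

end SemistrictBraided

open SemistrictBraided

/-! ### Enriched bicategories -/

/-- The data of a bicategory enriched in the Gray monoid `V`, with class of objects `Obj`. -/
structure VBicategoryData (V : Type u) [Bicategory.{w, v} V] [Bicategory.Strict V] [GrayMonoid V]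
    (Obj : Type t) where
  hom : Obj → Obj → V
  m (c d e : Obj) : hom d e * hom c d ⟶ hom c e
  unit (c : Obj) : 1 ⟶ hom c c
  assoc (c d e f : Obj) : m d e f ⊗ᵣ hom c d ≫ m c d f ≅
    (⟪hom e f ⊗ₗ m c d e⟫ : hom e f * hom d e * hom c d ⟶ hom e f * hom c e) ≫ m c e f
  leftUnitor (c d : Obj) :
    (⟪unit d ⊗ᵣ hom c d⟫ : hom c d ⟶ hom d d * hom c d) ≫ m c d d ≅ 𝟙 (hom c d)
  rightUnitor (c d : Obj) :
    (⟪hom c d ⊗ₗ unit c⟫ : hom c d ⟶ hom c d * hom c c) ≫ m c c d ≅ 𝟙 (hom c d)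

namespace VBicategoryData

variable {V : Type u} [Bicategory.{w, v} V] [Bicategory.Strict V] [GrayMonoid V] {Obj : Type t}

/-- The identity coherence axiom: `λ` after `α` is `ρ`. -/
def IdentityCoherence (C : VBicategoryData V Obj) : Prop :=
  ∀ c d e : Obj,
    (step (⟪(C.hom d e ⊗ₗ C.unit d) ⊗ᵣ C.hom c d⟫ :
          C.hom d e * C.hom c d ⟶ C.hom d e * C.hom d d * C.hom c d) (C.assoc c d d e) (𝟙 _) :
        (⟪(C.hom d e ⊗ₗ C.unit d) ⊗ᵣ C.hom c d⟫ :
          C.hom d e * C.hom c d ⟶ C.hom d e * C.hom d d * C.hom c d) ≫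
            C.m d d e ⊗ᵣ C.hom c d ≫ C.m c d e ≅
        (⟪(C.hom d e ⊗ₗ C.unit d) ⊗ᵣ C.hom c d⟫ :
          C.hom d e * C.hom c d ⟶ C.hom d e * C.hom d d * C.hom c d) ≫
            (⟪C.hom d e ⊗ₗ C.m c d d⟫ :
              C.hom d e * C.hom d d * C.hom c d ⟶ C.hom d e * C.hom c d) ≫ C.m c d e) ≪≫
      (step (𝟙 _) (tensorLIso (C.hom d e) (C.leftUnitor c d)) (C.m c d e) : _ ≅ C.m c d e) =
    step (𝟙 _) (tensorRIso (C.rightUnitor d e) (C.hom c d)) (C.m c d e)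

/-- The associativity coherence (pentagon) axiom. -/
def AssociativityCoherence (C : VBicategoryData V Obj) : Prop :=
  ∀ c d e f g : Obj,
    (step (𝟙 _) (tensorRIso (C.assoc d e f g) (C.hom c d)) (C.m c d g) :
        C.m e f g ⊗ᵣ C.hom d e ⊗ᵣ C.hom c d ≫ C.m d e g ⊗ᵣ C.hom c d ≫ C.m c d g ≅
          (⟪(C.hom f g ⊗ₗ C.m d e f) ⊗ᵣ C.hom c d⟫ :
            C.hom f g * C.hom e f * C.hom d e * C.hom c d ⟶
              C.hom f g * C.hom d f * C.hom c d) ≫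
            C.m d f g ⊗ᵣ C.hom c d ≫ C.m c d g) ≪≫
      (step (⟪(C.hom f g ⊗ₗ C.m d e f) ⊗ᵣ C.hom c d⟫ :
            C.hom f g * C.hom e f * C.hom d e * C.hom c d ⟶
              C.hom f g * C.hom d f * C.hom c d) (C.assoc c d f g) (𝟙 _) :
        _ ≅ (⟪(C.hom f g ⊗ₗ C.m d e f) ⊗ᵣ C.hom c d⟫ :
            C.hom f g * C.hom e f * C.hom d e * C.hom c d ⟶
              C.hom f g * C.hom d f * C.hom c d) ≫
            (⟪C.hom f g ⊗ₗ C.m c d f⟫ :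
              C.hom f g * C.hom d f * C.hom c d ⟶ C.hom f g * C.hom c f) ≫ C.m c f g) ≪≫
      (step (𝟙 _) (tensorLIso (C.hom f g) (C.assoc c d e f)) (C.m c f g) :
        _ ≅ (⟪(C.hom f g * C.hom e f) ⊗ₗ C.m c d e⟫ :
            C.hom f g * C.hom e f * C.hom d e * C.hom c d ⟶
              C.hom f g * C.hom e f * C.hom c e) ≫
            (⟪C.hom f g ⊗ₗ C.m c e f⟫ :
              C.hom f g * C.hom e f * C.hom c e ⟶ C.hom f g * C.hom c f) ≫ C.m c f g) =
    (step (C.m e f g ⊗ᵣ C.hom d e ⊗ᵣ C.hom c d) (C.assoc c d e g) (𝟙 _) :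
        _ ≅ C.m e f g ⊗ᵣ C.hom d e ⊗ᵣ C.hom c d ≫
            (⟪C.hom e g ⊗ₗ C.m c d e⟫ :
              C.hom e g * C.hom d e * C.hom c d ⟶ C.hom e g * C.hom c e) ≫ C.m c e g) ≪≫
      (step (𝟙 _) (interchanger (C.m e f g) (C.m c d e)).symm (C.m c e g) :
        _ ≅ (⟪(C.hom f g * C.hom e f) ⊗ₗ C.m c d e⟫ :
            C.hom f g * C.hom e f * C.hom d e * C.hom c d ⟶
              C.hom f g * C.hom e f * C.hom c e) ≫
            C.m e f g ⊗ᵣ C.hom c e ≫ C.m c e g) ≪≫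
      step (⟪(C.hom f g * C.hom e f) ⊗ₗ C.m c d e⟫ :
            C.hom f g * C.hom e f * C.hom d e * C.hom c d ⟶
              C.hom f g * C.hom e f * C.hom c e) (C.assoc c e f g) (𝟙 _)

/-- The data `C` form a `V`-bicategory. -/
structure IsVBicategory (C : VBicategoryData V Obj) : Prop where
  identity_coherence : C.IdentityCoherence
  associativity_coherence : C.AssociativityCoherence

end VBicategoryData

/-- A bicategory enriched in the Gray monoid `V`. -/
structure VBicategory (V : Type u) [Bicategory.{w, v} V] [Bicategory.Strict V] [GrayMonoid V]
    (Obj : Type t) extends VBicategoryData V Obj where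
  isVBicategory : toVBicategoryData.IsVBicategory

namespace VBicategoryData

variable {V : Type u} [Bicategory.{w, v} V] [Bicategory.Strict V] [GrayMonoid V]
  [GrayBraiding V] [SemistrictBraided V] {Obj : Type t}

/-- The opposite data: `C^op(a, b) = C(b, a)`, with composition `m ∘ β` and the units of `C`. -/
def op (C : VBicategoryData V Obj) : VBicategoryData V Obj where
  hom a b := C.hom b a
  m c d e := β (C.hom e d) (C.hom d c) ≫ C.m e d c
  unit c := C.unit c
  -- naturality of `β`, then `S`, then `R⁻¹`, then `α⁻¹`, then naturality of `β`
  assoc c d e f :=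
    (step (𝟙 _) (βL (β (C.hom f e) (C.hom e d) ≫ C.m f e d) (C.hom d c)) (C.m f d c) :
        (β (C.hom f e) (C.hom e d) ≫ C.m f e d) ⊗ᵣ C.hom d c ≫ β (C.hom f d) (C.hom d c) ≫
            C.m f d c ≅
          (⟪β (C.hom f e * C.hom e d) (C.hom d c)⟫ :
            C.hom f e * C.hom e d * C.hom d c ⟶ C.hom d c * C.hom f e * C.hom e d) ≫
          (⟪C.hom d c ⊗ₗ β (C.hom f e) (C.hom e d)⟫ :
            C.hom d c * C.hom f e * C.hom e d ⟶ C.hom d c * C.hom e d * C.hom f e) ≫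
          (⟪C.hom d c ⊗ₗ C.m f e d⟫ :
            C.hom d c * C.hom e d * C.hom f e ⟶ C.hom d c * C.hom f d) ≫ C.m f d c) ≪≫
      (step (𝟙 _) (S (C.hom f e) (C.hom e d) (C.hom d c))
          ((⟪C.hom d c ⊗ₗ β (C.hom f e) (C.hom e d)⟫ :
            C.hom d c * C.hom f e * C.hom e d ⟶ C.hom d c * C.hom e d * C.hom f e) ≫
          (⟪C.hom d c ⊗ₗ C.m f e d⟫ :
            C.hom d c * C.hom e d * C.hom f e ⟶ C.hom d c * C.hom f d) ≫ C.m f d c) :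
        _ ≅ (⟪C.hom f e ⊗ₗ β (C.hom e d) (C.hom d c)⟫ :
            C.hom f e * C.hom e d * C.hom d c ⟶ C.hom f e * C.hom d c * C.hom e d) ≫
          β (C.hom f e) (C.hom d c) ⊗ᵣ C.hom e d ≫
          (⟪C.hom d c ⊗ₗ β (C.hom f e) (C.hom e d)⟫ :
            C.hom d c * C.hom f e * C.hom e d ⟶ C.hom d c * C.hom e d * C.hom f e) ≫
          (⟪C.hom d c ⊗ₗ C.m f e d⟫ :
            C.hom d c * C.hom e d * C.hom f e ⟶ C.hom d c * C.hom f d) ≫ C.m f d c) ≪≫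
      (step (⟪C.hom f e ⊗ₗ β (C.hom e d) (C.hom d c)⟫ :
            C.hom f e * C.hom e d * C.hom d c ⟶ C.hom f e * C.hom d c * C.hom e d)
          (R (C.hom f e) (C.hom d c) (C.hom e d)).symm
          ((⟪C.hom d c ⊗ₗ C.m f e d⟫ :
            C.hom d c * C.hom e d * C.hom f e ⟶ C.hom d c * C.hom f d) ≫ C.m f d c) :
        _ ≅ (⟪C.hom f e ⊗ₗ β (C.hom e d) (C.hom d c)⟫ :
            C.hom f e * C.hom e d * C.hom d c ⟶ C.hom f e * C.hom d c * C.hom e d) ≫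
          (⟪β (C.hom f e) (C.hom d c * C.hom e d)⟫ :
            C.hom f e * C.hom d c * C.hom e d ⟶ C.hom d c * C.hom e d * C.hom f e) ≫
          (⟪C.hom d c ⊗ₗ C.m f e d⟫ :
            C.hom d c * C.hom e d * C.hom f e ⟶ C.hom d c * C.hom f d) ≫ C.m f d c) ≪≫
      (step ((⟪C.hom f e ⊗ₗ β (C.hom e d) (C.hom d c)⟫ :
            C.hom f e * C.hom e d * C.hom d c ⟶ C.hom f e * C.hom d c * C.hom e d) ≫
          (⟪β (C.hom f e) (C.hom d c * C.hom e d)⟫ :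
            C.hom f e * C.hom d c * C.hom e d ⟶ C.hom d c * C.hom e d * C.hom f e))
          (C.assoc f e d c).symm (𝟙 _) :
        _ ≅ (⟪C.hom f e ⊗ₗ β (C.hom e d) (C.hom d c)⟫ :
            C.hom f e * C.hom e d * C.hom d c ⟶ C.hom f e * C.hom d c * C.hom e d) ≫
          (⟪β (C.hom f e) (C.hom d c * C.hom e d)⟫ :
            C.hom f e * C.hom d c * C.hom e d ⟶ C.hom d c * C.hom e d * C.hom f e) ≫
          C.m e d c ⊗ᵣ C.hom f e ≫ C.m f e c) ≪≫
      step (⟪C.hom f e ⊗ₗ β (C.hom e d) (C.hom d c)⟫ :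
            C.hom f e * C.hom e d * C.hom d c ⟶ C.hom f e * C.hom d c * C.hom e d)
          (βR (C.hom f e) (C.m e d c)).symm (C.m f e c)
  -- naturality of `β`, whose component at the unit object is an identity, then `ρ`
  leftUnitor c d :=
    (step (𝟙 _) (βL (C.unit d) (C.hom d c)) (C.m d d c)
        (hG := by simp only [hcast_eq, β_one_left_eq, Bicategory.Strict.assoc,
          Bicategory.Strict.id_comp, eqTo_comp, eqTo_comp_assoc, eqToHom_refl]) :
        _ ≅ (⟪C.hom d c ⊗ₗ C.unit d⟫ : C.hom d c ⟶ C.hom d c * C.hom d d) ≫ C.m d d c) ≪≫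
      C.rightUnitor d c
  -- naturality of `β`, whose component at the unit object is an identity, then `λ`
  rightUnitor c d :=
    (step (𝟙 _) (βR (C.hom d c) (C.unit c)) (C.m d c c)
        (hG := by simp only [hcast_eq, β_one_right_eq, Bicategory.Strict.assoc,
          Bicategory.Strict.id_comp, eqTo_comp, eqTo_comp_assoc, eqToHom_refl]) :
        _ ≅ (⟪C.unit c ⊗ᵣ C.hom d c⟫ : C.hom d c ⟶ C.hom c c * C.hom d c) ≫ C.m d c c) ≪≫
      C.leftUnitor d c

end VBicategoryData

/-! The heart of the matter is the 2-cell `Om A B C`, which compares the two ways of reversing a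
triple product: braid `A` with `B` and then `BA` past `C`, or braid `B` with `C` and then `A` past
`CB`. It is defined from `S`, `R⁻¹` and naturality of `β` at `β_{B,C}`. The fourth braiding axiom
says that naturality of `β` at `β_{A,B}`, followed by `S` and `R⁻¹`, gives the same cell (`Om_eq`).
In this second form it is visible inside the associator of the opposite, which is therefore
naturality of `β` at a composition, then `Om`, then `α⁻¹`, then inverse naturality of `β` at a
composition (`lay_op_assoc`).

Two facts about `Om` involve no enrichment. It is natural in each variable (`Om_natural₁`,
`Om_natural₂`, `Om_natural₃`), because `R` and `S` are modifications and `β` is pseudonatural. It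
also satisfies a cocycle identity on four objects (`Om_coherence`), which uses all four braiding
axioms.

For (AC), naturality of `β` and of `Om` moves the reversals in front of the associators on both
sides (`reversed_associativity_left`, `reversed_associativity_right`). The sides then differ in two
blocks only. The block of reversals is settled by `Om_coherence`; the block of associators is the
inverse of the pentagon of `C` for the reversed string of objects. Compatibility of `β` with
interchangers converts the interchanger of the opposite into the one which that pentagon requires.

For (IC), the unit axioms make `Om A 1 B` an identity. Naturality of `Om` at a unit in the middle
variable then writes the reversal along that unit through naturality of `β` alone (`lay_Om_unit`),
and naturality of `β` at the unitors reduces the claim to (IC) for `C`.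

Tensor products are associative only up to equality of objects, so typed pastings are full of
transports. The calculation therefore takes place in `OneCell` and `TwoCell`, whose types do not
record boundaries: heterogeneous equalities become equalities, mismatched composites are zero, and a
pasting becomes a word in layers `lay p x q`, to be rewritten in a semigroup. `iso_injective`
returns the result to typed 2-cells. -/

set_option linter.unusedSectionVars false

/-! ### The untyped calculus of 1-cells and 2-cells -/

/-- A 1-cell with arbitrary boundary, or a formal unit, or a formal zero (the value of an ill-typed
composite). -/
inductive OneCell (V : Type u) [Bicategory.{w, v} V] : Type max u v
  | one : OneCell V
  | zero : OneCell V
  | arr {A B : V} (f : A ⟶ B) : OneCell V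

/-- An invertible 2-cell with arbitrary boundary, or a formal zero. -/
inductive TwoCell (V : Type u) [Bicategory.{w, v} V] : Type max u v w
  | zero : TwoCell V
  | iso {A B : V} {f g : A ⟶ B} (η : f ≅ g) : TwoCell V

section Untyped

variable {V : Type u} [Bicategory.{w, v} V]

/-! ### Untyped 1-cells as a monoid with zero -/

namespace OneCell

open Classical in
/-- Diagrammatic composition, zero when the boundaries do not match. -/
noncomputable def comp : OneCell V → OneCell V → OneCell V
  | one, y => y
  | x, one => x
  | zero, _ => zero
  | _, zero => zero
  | @arr _ _ _ B f, @arr _ _ B' _ g => if h : B = B' then arr (f ≫ hcast g h rfl) else zero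

noncomputable instance : One (OneCell V) := ⟨one⟩
noncomputable instance : Zero (OneCell V) := ⟨zero⟩
noncomputable instance : Mul (OneCell V) := ⟨comp⟩

theorem arr_comp {A B C : V} (f : A ⟶ B) (g : B ⟶ C) : arr (f ≫ g) = arr f * arr g := by
  change _ = comp (arr f) (arr g)
  simp [comp, hcast]

theorem arr_mul_arr_of_ne {A B B' C : V} (f : A ⟶ B) (g : B' ⟶ C) (h : B ≠ B') :
    arr f * arr g = 0 := by
  change comp (arr f) (arr g) = zero
  simp [comp, h]

@[simp] theorem arr_hcast {A B X Y : V} (f : A ⟶ B) (hX : X = A) (hY : Y = B) :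
    arr (hcast f hX hY) = arr f := by
  subst hX hY
  rfl

/-- The heterogeneous strictness axioms for 1-cells enter here: once the endpoints are forgotten,
they are plain equalities usable by `simp`. -/
theorem arr_eq_of_heq {A B X Y : V} {f : A ⟶ B} {g : X ⟶ Y} (hX : A = X) (hY : B = Y)
    (h : HEq f g) : arr f = arr g := by
  subst hX hY
  rw [eq_of_heq h]

theorem comp_zero (x : OneCell V) : comp x zero = zero := by
  cases x <;> rfl

theorem zero_comp (x : OneCell V) : comp zero x = zero := by
  cases x <;> rfl

theorem comp_one (x : OneCell V) : comp x one = x := by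
  cases x <;> rfl

/-- The unit is the formal `one`, since no single identity 1-cell composes with everything; `arr (𝟙
A)` differs from `1`. Associativity is the strict law when all boundaries match; when a boundary
between two genuine 1-cells fails to match, both bracketings are zero. -/
noncomputable instance [Bicategory.Strict V] : MonoidWithZero (OneCell V) where
  one_mul _ := rfl
  mul_one := comp_one
  zero_mul := zero_comp
  mul_zero := comp_zero
  mul_assoc x y z := by
    rcases x with _ | _ | @⟨A, B, f⟩
    · rfl
    · change comp (comp zero y) z = comp zero _
      simp [zero_comp]
    rcases y with _ | _ | @⟨B', C, g⟩
    · rfl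
    · change comp (comp _ zero) z = comp _ (comp zero z)
      simp [zero_comp, comp_zero]
    rcases z with _ | _ | @⟨C', D, h⟩
    · change comp _ one = comp _ (comp _ one)
      rw [comp_one, comp_one]
      rfl
    · change comp _ zero = comp _ (comp _ zero)
      rw [comp_zero, comp_zero, comp_zero]
    by_cases hB : B = B'
    · subst hB
      by_cases hC : C = C'
      · subst hC
        rw [← arr_comp, ← arr_comp, ← arr_comp, ← arr_comp, Bicategory.Strict.assoc]
      · rw [← arr_comp, arr_mul_arr_of_ne _ _ hC, arr_mul_arr_of_ne _ _ hC]
        exact (comp_zero _).symm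
    · rw [arr_mul_arr_of_ne _ _ hB]
      refine (zero_comp _).trans ?_
      by_cases hC : C = C'
      · subst hC
        rw [← arr_comp, arr_mul_arr_of_ne _ _ hB]
        rfl
      · rw [arr_mul_arr_of_ne _ _ hC]
        exact (comp_zero _).symm

@[simp] theorem arr_id_mul [Bicategory.Strict V] {A B : V} (f : A ⟶ B) :
    arr (𝟙 A) * arr f = arr f := by
  rw [← arr_comp, Bicategory.Strict.id_comp]

end OneCell

open OneCell

/-! ### Untyped 2-cells under vertical composition and inversion -/

namespace TwoCell

instance : Zero (TwoCell V) := ⟨zero⟩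

/-- The source 1-cell. -/
noncomputable def src : TwoCell V → OneCell V
  | zero => 0
  | @iso _ _ _ _ f _ _ => arr f

/-- The target 1-cell. -/
noncomputable def tgt : TwoCell V → OneCell V
  | zero => 0
  | @iso _ _ _ _ _ g _ => arr g

open Classical in
/-- Vertical composition. -/
noncomputable def comp : TwoCell V → TwoCell V → TwoCell V
  | zero, _ => zero
  | _, zero => zero
  | @iso _ _ A B _ g η, @iso _ _ A' B' f' _ θ =>
    if h : ∃ (hA : A = A') (hB : B = B'), g = hcast f' hA hB then
      iso (η ≪≫ eqToIso h.choose_spec.choose_spec ≪≫ hcastIso θ h.choose h.choose_spec.choose)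
    else zero

noncomputable instance : Mul (TwoCell V) := ⟨comp⟩

/-- The inverse 2-cell. -/
def inv : TwoCell V → TwoCell V
  | zero => zero
  | iso η => iso η.symm

@[simp] theorem src_zero : src (0 : TwoCell V) = 0 := rfl
@[simp] theorem tgt_zero : tgt (0 : TwoCell V) = 0 := rfl
@[simp] theorem inv_zero : inv (0 : TwoCell V) = 0 := rfl
@[simp] theorem src_iso {A B : V} {f g : A ⟶ B} (η : f ≅ g) : src (iso η) = arr f := rfl
@[simp] theorem tgt_iso {A B : V} {f g : A ⟶ B} (η : f ≅ g) : tgt (iso η) = arr g := rfl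
theorem inv_iso {A B : V} {f g : A ⟶ B} (η : f ≅ g) : inv (iso η) = iso η.symm := rfl
@[simp] theorem src_inv (x : TwoCell V) : src (inv x) = tgt x := by cases x <;> rfl
@[simp] theorem tgt_inv (x : TwoCell V) : tgt (inv x) = src x := by cases x <;> rfl
@[simp] theorem inv_inv (x : TwoCell V) : inv (inv x) = x := by cases x <;> rfl

theorem eq_zero_of_src {x : TwoCell V} (h : src x = 0) : x = 0 := by
  rcases x with _ | ⟨η⟩
  · rfl
  · cases h

protected theorem zero_mul (x : TwoCell V) : 0 * x = 0 := by cases x <;> rfl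
protected theorem mul_zero (x : TwoCell V) : x * 0 = 0 := by cases x <;> rfl

theorem iso_trans {A B : V} {f g h : A ⟶ B} (η : f ≅ g) (θ : g ≅ h) :
    iso (η ≪≫ θ) = iso η * iso θ := by
  change _ = comp (iso η) (iso θ)
  have h : ∃ (hA : A = A) (hB : B = B), g = hcast g hA hB := ⟨rfl, rfl, rfl⟩
  rw [comp, dif_pos h]
  -- By proof irrelevance the chosen equalities are `rfl`, so the transport of `θ` computes away.
  change _ = iso (η ≪≫ eqToIso rfl ≪≫ θ)
  rw [eqToIso_refl, Iso.refl_trans]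

theorem iso_mul_iso_of_ne {A B A' B' : V} {f g : A ⟶ B} {f' g' : A' ⟶ B'} (η : f ≅ g)
    (θ : f' ≅ g') (h : arr g ≠ arr f') : iso η * iso θ = 0 := by
  change comp (iso η) (iso θ) = zero
  have h' : ¬ ∃ (hA : A = A') (hB : B = B'), g = hcast f' hA hB := by
    rintro ⟨rfl, rfl, rfl⟩
    exact h rfl
  simp [comp, h']

theorem mul_of_ne {x y : TwoCell V} (h : tgt x ≠ src y) : x * y = 0 := by
  rcases x with _ | ⟨η⟩
  · exact TwoCell.zero_mul y
  rcases y with _ | ⟨θ⟩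
  · rfl
  exact iso_mul_iso_of_ne η θ h

/-- Induction for composable pairs. -/
theorem composable_cases {P : TwoCell V → TwoCell V → Prop} {x y : TwoCell V}
    (h : tgt x = src y) (zero : P 0 0)
    (iso : ∀ {A B : V} {f g k : A ⟶ B} (η : f ≅ g) (θ : g ≅ k), P (iso η) (iso θ)) : P x y := by
  rcases x with _ | @⟨A, B, f, g, η⟩
  · rw [eq_zero_of_src h.symm]
    exact zero
  rcases y with _ | @⟨A', B', f', g', θ⟩
  · cases h
  change arr g = arr f' at h
  cases h
  exact iso η θ

theorem src_mul {x y : TwoCell V} (h : tgt x = src y) : src (x * y) = src x := by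
  refine composable_cases (P := fun x y => src (x * y) = src x) h ?_ fun η θ => ?_
  · rfl
  · rw [← iso_trans, src_iso, src_iso]

theorem tgt_mul {x y : TwoCell V} (h : tgt x = src y) : tgt (x * y) = tgt y := by
  refine composable_cases (P := fun x y => tgt (x * y) = tgt y) h ?_ fun η θ => ?_
  · rfl
  · rw [← iso_trans, tgt_iso, tgt_iso]

/-- Only a semigroup: vertical units depend on the 1-cell, and no formal unit is adjoined. If some
boundary fails to match, both bracketings vanish, because a nonmatching product is zero and a
matching one keeps its outer boundary. -/
noncomputable instance : Semigroup (TwoCell V) where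
  mul_assoc x y z := by
    by_cases hxy : tgt x = src y
    · by_cases hyz : tgt y = src z
      · revert hyz
        refine composable_cases (P := fun x y => tgt y = src z → x * y * z = x * (y * z)) hxy ?_ ?_
        · intro _
          rw [TwoCell.zero_mul, TwoCell.zero_mul, TwoCell.zero_mul]
        · intro A B f g k η θ hyz
          rcases z with _ | @⟨A', B', f', g', ζ⟩
          · cases hyz
          change arr k = arr f' at hyz
          cases hyz
          rw [← iso_trans, ← iso_trans, ← iso_trans, ← iso_trans, Iso.trans_assoc]
      · rw [mul_of_ne hyz, mul_of_ne ((tgt_mul hxy).trans_ne hyz), TwoCell.mul_zero]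
    · rw [mul_of_ne hxy, TwoCell.zero_mul]
      by_cases hyz : tgt y = src z
      · exact (mul_of_ne ((src_mul hyz).symm ▸ hxy)).symm
      · rw [mul_of_ne hyz, TwoCell.mul_zero]

theorem inv_mul_rev (x y : TwoCell V) : inv (x * y) = inv y * inv x := by
  by_cases h : tgt x = src y
  · refine composable_cases (P := fun x y => inv (x * y) = inv y * inv x) h rfl fun η θ => ?_
    simp only [← iso_trans, inv_iso, Iso.trans_symm]
  · rw [mul_of_ne h, mul_of_ne (by simpa using Ne.symm h), inv_zero]

/-- In the absence of a unit, cancellation has to be stated next to a further factor. The boundary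
condition makes that factor composable; otherwise the product would be zero. -/
theorem mul_inv_cancel_left {x y : TwoCell V} (h : src x = src y) : x * (inv x * y) = y := by
  have := composable_cases (P := fun x y => inv x * (x * y) = y) (x := inv x) (y := y)
    (by simpa using h) rfl (fun η θ => by simp [← iso_trans, inv_iso])
  simpa using this

theorem inv_mul_cancel_left {x y : TwoCell V} (h : tgt x = src y) : inv x * (x * y) = y := by
  have := mul_inv_cancel_left (x := inv x) (y := y) (by simpa using h)
  simpa using this

theorem mul_inv_cancel_right {x y : TwoCell V} (h : tgt y = src x) : y * x * inv x = y := by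
  have h' := congrArg inv (inv_mul_cancel_left (x := inv x) (y := inv y) (by simp [h]))
  simpa [inv_mul_rev] using h'

/-- Rotates a commuting square of invertible cells. The rotated forms of the naturality laws come
mostly from here. The two composability conditions exclude the case where `h` only says `0 = 0`. -/
theorem inv_mul_eq_mul_inv {a x y b : TwoCell V} (h : a * x = y * b) (hax : tgt a = src x)
    (hyb : tgt y = src b) : inv y * a = b * inv x := by
  have hs : src a = src y := by rw [← src_mul hax, h, src_mul hyb]
  rw [← inv_mul_cancel_left hyb, ← h, mul_assoc, mul_inv_cancel_right hax]

/-- The way back to typed 2-cells: between parallel 1-cells, forgetting the boundary loses nothing.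
-/
theorem iso_injective {A B : V} {f g : A ⟶ B} {η θ : f ≅ g} (h : iso η = iso θ) : η = θ := by
  cases h
  rfl

theorem iso_eq_of_heq {A B A' B' : V} {f g : A ⟶ B} {f' g' : A' ⟶ B'} {η : f ≅ g} {θ : f' ≅ g'}
    (hf : arr f = arr f') (hg : arr g = arr g') (h : HEq η.hom θ.hom) : iso η = iso θ := by
  cases hf
  cases hg
  rw [Iso.ext (eq_of_heq h)]

end TwoCell

open TwoCell

end Untyped

open OneCell TwoCell

/-! ### Whiskering and layers of pasting diagrams -/

section Whiskering

variable {V : Type u} [Bicategory.{w, v} V]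

namespace TwoCell

open Classical in
/-- Whiskering by a 1-cell before a 2-cell. -/
noncomputable def lw : OneCell V → TwoCell V → TwoCell V
  | one, x => x
  | OneCell.zero, _ => zero
  | _, zero => zero
  | @arr _ _ _ B p, @iso _ _ B' _ _ _ η =>
    if h : B = B' then iso (whiskerLeftIso p (hcastIso η h rfl)) else zero

open Classical in
/-- Whiskering by a 1-cell after a 2-cell. -/
noncomputable def rw : TwoCell V → OneCell V → TwoCell V
  | x, one => x
  | _, OneCell.zero => zero
  | zero, _ => zero
  | @iso _ _ _ B _ _ η, @arr _ _ B' _ q =>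
    if h : B' = B then iso (whiskerRightIso (hcastIso η rfl h) q) else zero

/-- One layer of a pasting diagram: the 2-cell `x` with `p` before it and `q` after it. -/
noncomputable def lay (p : OneCell V) (x : TwoCell V) (q : OneCell V) : TwoCell V :=
  lw p (rw x q)

theorem lw_arr_iso {A B C : V} (p : A ⟶ B) {f g : B ⟶ C} (η : f ≅ g) :
    lw (arr p) (iso η) = iso (whiskerLeftIso p η) := by
  rw [lw, dif_pos rfl]
  rfl

theorem rw_iso_arr {A B C : V} {f g : A ⟶ B} (η : f ≅ g) (q : B ⟶ C) :
    rw (iso η) (arr q) = iso (whiskerRightIso η q) := by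
  rw [rw, dif_pos rfl]
  rfl

theorem lw_of_ne {A B B' C : V} (p : A ⟶ B) {f g : B' ⟶ C} (η : f ≅ g) (h : B ≠ B') :
    lw (arr p) (iso η) = 0 := by
  simp only [lw, dif_neg h]
  rfl

theorem rw_of_ne {A B B' C : V} {f g : A ⟶ B} (η : f ≅ g) (q : B' ⟶ C) (h : B ≠ B') :
    rw (iso η) (arr q) = 0 := by
  simp only [rw, dif_neg (Ne.symm h)]
  rfl

@[simp] theorem lw_one (x : TwoCell V) : lw 1 x = x := by cases x <;> rfl
@[simp] theorem rw_one (x : TwoCell V) : rw x 1 = x := by cases x <;> rfl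
@[simp] theorem lw_zero (p : OneCell V) : lw p 0 = 0 := by cases p <;> rfl
@[simp] theorem zero_rw (q : OneCell V) : rw (0 : TwoCell V) q = 0 := by cases q <;> rfl
@[simp] theorem zero_lw (x : TwoCell V) : lw 0 x = 0 := by cases x <;> rfl
@[simp] theorem rw_zero (x : TwoCell V) : rw x 0 = 0 := by cases x <;> rfl

theorem iso_congr {A B : V} {f g f' g' : A ⟶ B} {η : f ≅ g} {θ : f' ≅ g'} (hf : f = f')
    (hg : g = g') (h : η.hom ≫ eqToHom hg = eqToHom hf ≫ θ.hom) : iso η = iso θ := by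
  subst hf hg
  have : η = θ := Iso.ext (by simpa using h)
  rw [this]

variable [Bicategory.Strict V]

theorem src_lw (p : OneCell V) (x : TwoCell V) : src (lw p x) = p * src x := by
  rcases p with _ | _ | @⟨A, B, p⟩
  · exact (congrArg src (lw_one x)).trans (one_mul _).symm
  · exact (congrArg src (zero_lw x)).trans (zero_mul _).symm
  rcases x with _ | @⟨B', C, f, g, η⟩
  · exact (mul_zero _).symm
  by_cases h : B = B'
  · subst h
    rw [lw_arr_iso, src_iso, src_iso, arr_comp]
  · rw [lw_of_ne _ _ h, src_iso, arr_mul_arr_of_ne _ _ h, src_zero]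

theorem tgt_lw (p : OneCell V) (x : TwoCell V) : tgt (lw p x) = p * tgt x := by
  rcases p with _ | _ | @⟨A, B, p⟩
  · exact (congrArg tgt (lw_one x)).trans (one_mul _).symm
  · exact (congrArg tgt (zero_lw x)).trans (zero_mul _).symm
  rcases x with _ | @⟨B', C, f, g, η⟩
  · exact (mul_zero _).symm
  by_cases h : B = B'
  · subst h
    rw [lw_arr_iso, tgt_iso, tgt_iso, arr_comp]
  · rw [lw_of_ne _ _ h, tgt_iso, arr_mul_arr_of_ne _ _ h, tgt_zero]

theorem src_rw (x : TwoCell V) (q : OneCell V) : src (rw x q) = src x * q := by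
  rcases q with _ | _ | @⟨B', C, q⟩
  · exact (congrArg src (rw_one x)).trans (mul_one _).symm
  · exact (congrArg src (rw_zero x)).trans (mul_zero _).symm
  rcases x with _ | @⟨A, B, f, g, η⟩
  · exact (zero_mul _).symm
  by_cases h : B = B'
  · subst h
    rw [rw_iso_arr, src_iso, src_iso, arr_comp]
  · rw [rw_of_ne _ _ h, src_iso, arr_mul_arr_of_ne _ _ h, src_zero]

theorem tgt_rw (x : TwoCell V) (q : OneCell V) : tgt (rw x q) = tgt x * q := by
  rcases q with _ | _ | @⟨B', C, q⟩
  · exact (congrArg tgt (rw_one x)).trans (mul_one _).symm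
  · exact (congrArg tgt (rw_zero x)).trans (mul_zero _).symm
  rcases x with _ | @⟨A, B, f, g, η⟩
  · exact (zero_mul _).symm
  by_cases h : B = B'
  · subst h
    rw [rw_iso_arr, tgt_iso, tgt_iso, arr_comp]
  · rw [rw_of_ne _ _ h, tgt_iso, arr_mul_arr_of_ne _ _ h, tgt_zero]

theorem inv_lw (p : OneCell V) (x : TwoCell V) : inv (lw p x) = lw p (inv x) := by
  rcases p with _ | _ | @⟨A, B, p⟩
  · exact (congrArg inv (lw_one x)).trans (lw_one _).symm
  · exact (congrArg inv (zero_lw x)).trans (zero_lw _).symm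
  rcases x with _ | @⟨B', C, f, g, η⟩
  · rfl
  by_cases h : B = B'
  · subst h
    rw [lw_arr_iso, inv_iso, inv_iso, lw_arr_iso]
    rfl
  · rw [lw_of_ne _ _ h, inv_iso, lw_of_ne _ _ h, inv_zero]

theorem inv_rw (x : TwoCell V) (q : OneCell V) : inv (rw x q) = rw (inv x) q := by
  rcases q with _ | _ | @⟨B', C, q⟩
  · exact (congrArg inv (rw_one x)).trans (rw_one _).symm
  · exact (congrArg inv (rw_zero x)).trans (rw_zero _).symm
  rcases x with _ | @⟨A, B, f, g, η⟩
  · rfl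
  by_cases h : B = B'
  · subst h
    rw [rw_iso_arr, inv_iso, inv_iso, rw_iso_arr]
    rfl
  · rw [rw_of_ne _ _ h, inv_iso, rw_of_ne _ _ h, inv_zero]

/-- In a strict bicategory the associator is an `eqToIso`, which disappears once boundaries are
untyped. No typing hypothesis is needed, since mismatched whiskerings are zero on both sides. -/
theorem lw_lw (p q : OneCell V) (x : TwoCell V) : lw p (lw q x) = lw (p * q) x := by
  rcases p with _ | _ | @⟨A, B, p⟩
  · exact (lw_one _).trans (congrArg (lw · x) (one_mul q).symm)
  · exact (zero_lw _).trans ((zero_lw x).symm.trans (congrArg (lw · x) (zero_mul q).symm))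
  rcases q with _ | _ | @⟨B', C, q⟩
  · exact (congrArg (lw (arr p)) (lw_one x)).trans (congrArg (lw · x) (mul_one (arr p)).symm)
  · exact (congrArg (lw (arr p)) (zero_lw x)).trans
      ((zero_lw x).symm.trans (congrArg (lw · x) (mul_zero (arr p)).symm))
  rcases x with _ | @⟨C', D, f, g, η⟩
  · exact (lw_zero _).symm
  by_cases hC : C = C'
  · subst hC
    rw [lw_arr_iso]
    by_cases hB : B = B'
    · subst hB
      rw [lw_arr_iso, ← arr_comp, lw_arr_iso]
      refine iso_congr (Bicategory.Strict.assoc _ _ _).symm (Bicategory.Strict.assoc _ _ _).symm ?_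
      simp [Bicategory.Strict.associator_eqToIso]
    · rw [lw_of_ne _ _ hB, arr_mul_arr_of_ne _ _ hB, zero_lw]
  · rw [lw_of_ne _ _ hC, lw_zero]
    by_cases hB : B = B'
    · subst hB
      rw [← arr_comp, lw_of_ne _ _ hC]
    · rw [arr_mul_arr_of_ne _ _ hB, zero_lw]

theorem rw_rw (x : TwoCell V) (p q : OneCell V) : rw (rw x p) q = rw x (p * q) := by
  rcases q with _ | _ | @⟨C', D, q⟩
  · exact (rw_one _).trans (congrArg (rw x ·) (mul_one p).symm)
  · exact (rw_zero _).trans ((rw_zero x).symm.trans (congrArg (rw x ·) (mul_zero p).symm))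
  rcases p with _ | _ | @⟨B', C, p⟩
  · exact (congrArg (rw · (arr q)) (rw_one x)).trans (congrArg (rw x ·) (one_mul (arr q)).symm)
  · exact (congrArg (rw · (arr q)) (rw_zero x)).trans
      ((rw_zero x).symm.trans (congrArg (rw x ·) (zero_mul (arr q)).symm))
  rcases x with _ | @⟨A, B, f, g, η⟩
  · exact (zero_rw _).symm
  by_cases hB : B = B'
  · subst hB
    rw [rw_iso_arr]
    by_cases hC : C = C'
    · subst hC
      rw [rw_iso_arr, ← arr_comp, rw_iso_arr]
      refine iso_congr (Bicategory.Strict.assoc _ _ _) (Bicategory.Strict.assoc _ _ _) ?_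
      simp [Bicategory.Strict.associator_eqToIso]
    · rw [rw_of_ne _ _ hC, arr_mul_arr_of_ne _ _ hC, rw_zero]
  · rw [rw_of_ne _ _ hB, zero_rw]
    by_cases hC : C = C'
    · subst hC
      rw [← arr_comp, rw_of_ne _ _ hB]
    · rw [arr_mul_arr_of_ne _ _ hC, rw_zero]

theorem rw_lw (p : OneCell V) (x : TwoCell V) (q : OneCell V) :
    rw (lw p x) q = lw p (rw x q) := by
  rcases p with _ | _ | @⟨A, B, p⟩
  · exact (congrArg (rw · q) (lw_one x)).trans (lw_one _).symm
  · exact (congrArg (rw · q) (zero_lw x)).trans ((zero_rw q).trans (zero_lw _).symm)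
  rcases q with _ | _ | @⟨D', E, q⟩
  · exact (rw_one _).trans (congrArg (lw (arr p)) (rw_one x).symm)
  · exact (rw_zero _).trans (congrArg (lw (arr p)) (rw_zero x).symm)
  rcases x with _ | @⟨C, D, f, g, η⟩
  · rfl
  by_cases hB : B = C
  · subst hB
    rw [lw_arr_iso]
    by_cases hD : D = D'
    · subst hD
      rw [rw_iso_arr, rw_iso_arr, lw_arr_iso]
      refine iso_congr (Bicategory.Strict.assoc _ _ _) (Bicategory.Strict.assoc _ _ _) ?_
      simp [Bicategory.Strict.associator_eqToIso]
    · rw [rw_of_ne _ _ hD, rw_of_ne _ _ hD, lw_zero]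
  · rw [lw_of_ne _ _ hB, zero_rw]
    by_cases hD : D = D'
    · subst hD
      rw [rw_iso_arr, lw_of_ne _ _ hB]
    · rw [rw_of_ne _ _ hD, lw_zero]

/-! ### Layers and their calculus -/

@[simp] theorem src_lay (p : OneCell V) (x : TwoCell V) (q : OneCell V) :
    src (lay p x q) = p * (src x * q) := by
  rw [lay, src_lw, src_rw]

@[simp] theorem tgt_lay (p : OneCell V) (x : TwoCell V) (q : OneCell V) :
    tgt (lay p x q) = p * (tgt x * q) := by
  rw [lay, tgt_lw, tgt_rw]

@[simp] theorem inv_lay (p : OneCell V) (x : TwoCell V) (q : OneCell V) :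
    inv (lay p x q) = lay p (inv x) q := by
  rw [lay, inv_lw, inv_rw, lay]

@[simp] theorem lay_one_one (x : TwoCell V) : lay 1 x 1 = x := by
  rw [lay, lw_one, rw_one]

@[simp] theorem lay_lay (p p' : OneCell V) (x : TwoCell V) (q' q : OneCell V) :
    lay p (lay p' x q') q = lay (p * p') x (q' * q) := by
  rw [lay, lay, lay, rw_lw, lw_lw, rw_rw]

/-- Composability of `x` and `y` must be assumed: `p * tgt x * q = p * src y * q` does not force
`tgt x = src y`, so the right side may be nonzero when `x * y = 0`. -/
theorem lay_mul (p : OneCell V) {x y : TwoCell V} (q : OneCell V) (h : tgt x = src y) :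
    lay p (x * y) q = lay p x q * lay p y q := by
  have hl : ∀ {x y : TwoCell V}, tgt x = src y → lw p (x * y) = lw p x * lw p y := by
    intro x y h
    refine composable_cases (P := fun x y => lw p (x * y) = lw p x * lw p y) h ?_ ?_
    · simp [TwoCell.zero_mul]
    · intro A B f g k η θ
      rcases p with _ | _ | @⟨C, A', p⟩
      · change lw 1 _ = lw 1 _ * lw 1 _
        simp
      · exact (zero_lw _).trans (TwoCell.zero_mul _).symm
      by_cases hA : A' = A
      · subst hA
        rw [← iso_trans, lw_arr_iso, lw_arr_iso, lw_arr_iso, ← iso_trans]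
        congr 1
        ext
        simp
      · rw [← iso_trans, lw_of_ne _ _ hA, lw_of_ne _ _ hA, TwoCell.zero_mul]
  have hr : ∀ {x y : TwoCell V}, tgt x = src y → rw (x * y) q = rw x q * rw y q := by
    intro x y h
    refine composable_cases (P := fun x y => rw (x * y) q = rw x q * rw y q) h ?_ ?_
    · simp [TwoCell.zero_mul]
    · intro A B f g k η θ
      rcases q with _ | _ | @⟨B', C, q⟩
      · change rw _ 1 = rw _ 1 * rw _ 1
        simp
      · exact (rw_zero _).trans (TwoCell.zero_mul _).symm
      by_cases hB : B = B'
      · subst hB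
        rw [← iso_trans, rw_iso_arr, rw_iso_arr, rw_iso_arr, ← iso_trans]
        congr 1
        ext
        simp
      · rw [← iso_trans, rw_of_ne _ _ hB, rw_of_ne _ _ hB, TwoCell.zero_mul]
  rw [lay, lay, lay, hr h, hl (by rw [tgt_rw, src_rw, h])]

theorem lay_iso_trans (p q : OneCell V) {A B : V} {f g h : A ⟶ B} (η : f ≅ g) (θ : g ≅ h) :
    lay p (iso (η ≪≫ θ)) q = lay p (iso η) q * lay p (iso θ) q := by
  rw [iso_trans, lay_mul _ _ (by simp)]

/-- This is `whisker_exchange`; it holds without hypotheses because both sides are zero when `x` and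
`y` do not meet in a common object. -/
theorem lw_tgt_mul (x y : TwoCell V) :
    rw x (src y) * lw (tgt x) y = lw (src x) y * rw x (tgt y) := by
  rcases x with _ | @⟨A, B, f, f', η⟩
  · change rw 0 _ * lw (tgt 0) _ = lw (src 0) _ * rw 0 _
    simp [TwoCell.zero_mul]
  rcases y with _ | @⟨B', C, g, g', θ⟩
  · change rw _ (src 0) * lw _ 0 = lw _ 0 * rw _ (tgt 0)
    simp [TwoCell.zero_mul]
  simp only [src_iso, tgt_iso]
  by_cases hB : B = B'
  · subst hB
    rw [lw_arr_iso, lw_arr_iso, rw_iso_arr, rw_iso_arr, ← iso_trans, ← iso_trans]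
    congr 1
    ext
    exact (whisker_exchange η.hom θ.hom).symm
  · rw [rw_of_ne _ _ hB, rw_of_ne _ _ hB, TwoCell.zero_mul, TwoCell.mul_zero]

/-- The interchange law: two layers on disjoint strands commute. -/
theorem lay_comm (p : OneCell V) (x : TwoCell V) (q : OneCell V) (y : TwoCell V) (r : OneCell V) :
    lay p x (q * (src y * r)) * lay (p * (tgt x * q)) y r =
      lay (p * (src x * q)) y r * lay p x (q * (tgt y * r)) := by
  have h := congrArg (fun z => lay p z r) (lw_tgt_mul (rw x q) y)
  change lay p (_ * _) r = lay p (_ * _) r at h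
  rw [lay_mul, lay_mul] at h
  · simpa only [lay, src_rw, tgt_rw, rw_rw, lw_lw, rw_lw, mul_assoc] using h
  all_goals simp only [src_rw, tgt_rw, src_lw, tgt_lw]

theorem lay_inv_mul {p p' q q' : OneCell V} {x y : TwoCell V}
    (h : p * (tgt x * q) = p' * (src y * q')) (z : TwoCell V) :
    lay p (inv x) q * (lay p x q * (lay p' y q' * z)) = lay p' y q' * z := by
  have := inv_mul_cancel_left (x := lay p x q) (y := lay p' y q') (by simpa using h)
  rw [← mul_assoc (lay p x q), ← mul_assoc (lay p (inv x) q), ← inv_lay, this]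

/-- An actual identity 1-cell is not the formal unit, but it acts as one on a cell with the right
boundary, since the left unitor is an `eqToIso`. -/
theorem lay_arr_id {A B : V} {f g : A ⟶ B} (η : f ≅ g) (q : OneCell V) :
    lay (arr (𝟙 A)) (iso η) q = lay 1 (iso η) q := by
  have : lw (arr (𝟙 A)) (iso η) = iso η := by
    rw [lw_arr_iso]
    refine iso_congr (Bicategory.Strict.id_comp _) (Bicategory.Strict.id_comp _) ?_
    simp [Bicategory.Strict.leftUnitor_eqToIso]
  rw [lay, lay, ← rw_lw, this, lw_one]

theorem lay_iso_arr_id {A B : V} {f g : A ⟶ B} (η : f ≅ g) (p : OneCell V) :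
    lay p (iso η) (arr (𝟙 B)) = lay p (iso η) 1 := by
  have : rw (iso η) (arr (𝟙 B)) = iso η := by
    rw [rw_iso_arr]
    refine iso_congr (Bicategory.Strict.comp_id _) (Bicategory.Strict.comp_id _) ?_
    simp [Bicategory.Strict.rightUnitor_eqToIso]
  rw [lay, lay, this, rw_one]

-- Every typed pasting step is a layer. The priorities make `simp` try the versions with identity
-- whiskers first, so that these become the formal `1`, which is absorbed, instead of `arr (𝟙 _)`.
@[simp low] theorem iso_step {W X Y Z A B : V} (p : W ⟶ X) {f g : A ⟶ B} (η : f ≅ g) (q : Y ⟶ Z)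
    {F G : W ⟶ Z} (hX : X = A) (hY : Y = B) (hF : F = p ≫ hcast f hX hY ≫ q)
    (hG : G = p ≫ hcast g hX hY ≫ q) :
    iso (step p η q hX hY hF hG) = lay (arr p) (iso η) (arr q) := by
  subst hX hY hF hG
  rw [step, lay, rw_iso_arr, lw_arr_iso]
  change iso (eqToIso rfl ≪≫ whiskerLeftIso p (whiskerRightIso η q) ≪≫ eqToIso rfl) = _
  rw [eqToIso_refl, eqToIso_refl, Iso.refl_trans, Iso.trans_refl]

@[simp high] theorem iso_id_step {W Y Z A B : V} {f g : A ⟶ B} (η : f ≅ g) (q : Y ⟶ Z)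
    {F G : W ⟶ Z} (hX : W = A) (hY : Y = B) (hF : F = 𝟙 W ≫ hcast f hX hY ≫ q)
    (hG : G = 𝟙 W ≫ hcast g hX hY ≫ q) :
    iso (step (𝟙 W) η q hX hY hF hG) = lay 1 (iso η) (arr q) := by
  subst hX
  rw [iso_step, lay_arr_id]

@[simp high] theorem iso_step_id {W X Z A B : V} (p : W ⟶ X) {f g : A ⟶ B} (η : f ≅ g)
    {F G : W ⟶ Z} (hX : X = A) (hY : Z = B) (hF : F = p ≫ hcast f hX hY ≫ 𝟙 Z)
    (hG : G = p ≫ hcast g hX hY ≫ 𝟙 Z) :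
    iso (step p η (𝟙 Z) hX hY hF hG) = lay (arr p) (iso η) 1 := by
  subst hY
  rw [iso_step, lay_iso_arr_id]

@[simp 20000] theorem iso_id_step_id {W Z A B : V} {f g : A ⟶ B} (η : f ≅ g)
    {F G : W ⟶ Z} (hX : W = A) (hY : Z = B) (hF : F = 𝟙 W ≫ hcast f hX hY ≫ 𝟙 Z)
    (hG : G = 𝟙 W ≫ hcast g hX hY ≫ 𝟙 Z) :
    iso (step (𝟙 W) η (𝟙 Z) hX hY hF hG) = iso η := by
  subst hX
  rw [iso_step_id, lay_arr_id, lay_one_one]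

end TwoCell

end Whiskering

/-! ### The Gray tensor product of untyped cells -/

section Gray

variable {V : Type u} [Bicategory.{w, v} V]

/-- The 1-cell `x` goes from `A` to `B`. -/
class OneCell.Typed (x : OneCell V) (A B : outParam V) : Prop where
  exists_eq : ∃ f : A ⟶ B, x = arr f

instance OneCell.typed_arr {A B : V} (f : A ⟶ B) : Typed (arr f) A B := ⟨f, rfl⟩

variable [Bicategory.Strict V] [GrayMonoid V]

/-- `A ⊗ x`. -/
def OneCell.lt (A : V) : OneCell V → OneCell V
  | one => one
  | OneCell.zero => OneCell.zero
  | arr f => arr (A ⊗ₗ f)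

/-- `x ⊗ A`. -/
def OneCell.rt : OneCell V → V → OneCell V
  | one, _ => one
  | OneCell.zero, _ => OneCell.zero
  | arr f, A => arr (f ⊗ᵣ A)

/-- `A ⊗ x`. -/
def TwoCell.ltt (A : V) : TwoCell V → TwoCell V
  | zero => zero
  | iso η => iso (tensorLIso A η)

/-- `x ⊗ A`. -/
def TwoCell.rtt : TwoCell V → V → TwoCell V
  | zero, _ => zero
  | iso η, A => iso (tensorRIso η A)

/-- The interchanger of two 1-cells. -/
def TwoCell.sg : OneCell V → OneCell V → TwoCell V
  | arr f, arr g => iso (interchanger f g)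
  | _, _ => zero

namespace OneCell

instance typed_lt (C : V) (x : OneCell V) {A B : V} [h : Typed x A B] :
    Typed (lt C x) (C * A) (C * B) := by
  obtain ⟨f, rfl⟩ := h.exists_eq
  exact ⟨C ⊗ₗ f, rfl⟩

instance typed_rt (x : OneCell V) (C : V) {A B : V} [h : Typed x A B] :
    Typed (rt x C) (A * C) (B * C) := by
  obtain ⟨f, rfl⟩ := h.exists_eq
  exact ⟨f ⊗ᵣ C, rfl⟩

@[simp] theorem arr_tensorL (A : V) {B B' : V} (f : B ⟶ B') : arr (A ⊗ₗ f) = lt A (arr f) := rfl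
@[simp] theorem arr_tensorR {B B' : V} (f : B ⟶ B') (A : V) : arr (f ⊗ᵣ A) = rt (arr f) A := rfl

@[simp] theorem lt_mul_obj (A B : V) (x : OneCell V) : lt (A * B) x = lt A (lt B x) := by
  rcases x with _ | _ | ⟨f⟩
  · rfl
  · rfl
  · exact arr_eq_of_heq (mul_assoc _ _ _) (mul_assoc _ _ _) (mul_tensorL A B f)

@[simp] theorem rt_mul_obj (x : OneCell V) (A B : V) : rt x (A * B) = rt (rt x A) B := by
  rcases x with _ | _ | ⟨f⟩
  · rfl
  · rfl
  · exact arr_eq_of_heq (mul_assoc _ _ _).symm (mul_assoc _ _ _).symm (tensorR_mul f A B)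

@[simp] theorem rt_lt (A : V) (x : OneCell V) (B : V) : rt (lt A x) B = lt A (rt x B) := by
  rcases x with _ | _ | ⟨f⟩
  · rfl
  · rfl
  · exact arr_eq_of_heq (mul_assoc _ _ _) (mul_assoc _ _ _) (tensorL_tensorR A f B)

@[simp] theorem lt_one_obj (x : OneCell V) : lt 1 x = x := by
  rcases x with _ | _ | ⟨f⟩
  · rfl
  · rfl
  · exact arr_eq_of_heq (one_mul _) (one_mul _) (one_tensorL f)

-- Typing is needed because `D * B = D * B'` does not imply `B = B'`: tensoring could make a
-- noncomposable pair composable. The middle object appears twice, with an equation, so that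
-- inferred types may be bracketed differently.
@[simp] theorem lt_mul (D : V) {x y : OneCell V} {A B B' C : V} [hx : Typed x A B] [hy : Typed y B'
    C]
    (h : B = B') : lt D (x * y) = lt D x * lt D y := by
  obtain ⟨f, rfl⟩ := hx.exists_eq
  subst h
  obtain ⟨g, rfl⟩ := hy.exists_eq
  rw [← arr_comp, ← arr_tensorL, tensorL_comp, arr_comp]
  rfl

@[simp] theorem rt_mul (D : V) {x y : OneCell V} {A B B' C : V} [hx : Typed x A B] [hy : Typed y B'
    C]
    (h : B = B') : rt (x * y) D = rt x D * rt y D := by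
  obtain ⟨f, rfl⟩ := hx.exists_eq
  subst h
  obtain ⟨g, rfl⟩ := hy.exists_eq
  rw [← arr_comp, ← arr_tensorR, tensorR_comp, arr_comp]
  rfl

end OneCell

namespace TwoCell

@[simp] theorem iso_tensorLIso (A : V) {B B' : V} {f g : B ⟶ B'} (η : f ≅ g) :
    iso (tensorLIso A η) = ltt A (iso η) := rfl
@[simp] theorem iso_tensorRIso {B B' : V} {f g : B ⟶ B'} (η : f ≅ g) (A : V) :
    iso (tensorRIso η A) = rtt (iso η) A := rfl
@[simp] theorem iso_interchanger {A A' B B' : V} (f : A ⟶ A') (g : B ⟶ B') :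
    iso (interchanger f g) = sg (arr f) (arr g) := rfl
@[simp] theorem iso_symm {A B : V} {f g : A ⟶ B} (η : f ≅ g) : iso η.symm = inv (iso η) := rfl

@[simp] theorem src_ltt (A : V) (x : TwoCell V) : src (ltt A x) = lt A (src x) := by
  cases x <;> rfl
@[simp] theorem tgt_ltt (A : V) (x : TwoCell V) : tgt (ltt A x) = lt A (tgt x) := by
  cases x <;> rfl
@[simp] theorem src_rtt (x : TwoCell V) (A : V) : src (rtt x A) = rt (src x) A := by
  cases x <;> rfl
@[simp] theorem tgt_rtt (x : TwoCell V) (A : V) : tgt (rtt x A) = rt (tgt x) A := by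
  cases x <;> rfl
@[simp] theorem inv_ltt (A : V) (x : TwoCell V) : inv (ltt A x) = ltt A (inv x) := by
  cases x <;> rfl
@[simp] theorem inv_rtt (x : TwoCell V) (A : V) : inv (rtt x A) = rtt (inv x) A := by
  cases x <;> rfl

theorem ltt_mul (A : V) {x y : TwoCell V} (h : tgt x = src y) :
    ltt A (x * y) = ltt A x * ltt A y := by
  refine composable_cases (P := fun x y => ltt A (x * y) = ltt A x * ltt A y) h rfl fun η θ => ?_
  rw [← iso_trans, ← iso_tensorLIso, ← iso_tensorLIso, ← iso_tensorLIso, ← iso_trans]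
  congr 1
  ext
  simp [tensorL₂_comp]

theorem rtt_mul (A : V) {x y : TwoCell V} (h : tgt x = src y) :
    rtt (x * y) A = rtt x A * rtt y A := by
  refine composable_cases (P := fun x y => rtt (x * y) A = rtt x A * rtt y A) h rfl fun η θ => ?_
  rw [← iso_trans, ← iso_tensorRIso, ← iso_tensorRIso, ← iso_tensorRIso, ← iso_trans]
  congr 1
  ext
  simp [tensorR₂_comp]

theorem ltt_lay_left (D : V) {p : OneCell V} {x : TwoCell V} {A B B' C : V}
    [hp : Typed p A B] (hx : Typed (src x) B' C) (h : B = B') :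
    ltt D (lay p x 1) = lay (lt D p) (ltt D x) 1 := by
  obtain ⟨f, rfl⟩ := hp.exists_eq
  subst h
  obtain ⟨g, hg⟩ := hx.exists_eq
  rcases x with _ | @⟨_, _, g, g', η⟩
  · cases hg
  cases hg
  rw [lay, lay, rw_one, rw_one, lw_arr_iso, ← iso_tensorLIso, ← iso_tensorLIso, ← arr_tensorL,
    lw_arr_iso]
  exact iso_eq_of_heq (by rw [tensorL_comp]) (by rw [tensorL_comp])
    (tensorL₂_whiskerLeft D f η.hom)

theorem ltt_lay_right (D : V) {q : OneCell V} {x : TwoCell V} {A B B' C : V}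
    [hq : Typed q B C] (hx : Typed (src x) A B') (h : B' = B) :
    ltt D (lay 1 x q) = lay 1 (ltt D x) (lt D q) := by
  obtain ⟨f, rfl⟩ := hq.exists_eq
  subst h
  obtain ⟨g, hg⟩ := hx.exists_eq
  rcases x with _ | @⟨_, _, g, g', η⟩
  · cases hg
  cases hg
  rw [lay, lay, lw_one, lw_one, rw_iso_arr, ← iso_tensorLIso, ← iso_tensorLIso, ← arr_tensorL,
    rw_iso_arr]
  exact iso_eq_of_heq (by rw [tensorL_comp]) (by rw [tensorL_comp])
    (tensorL₂_whiskerRight D η.hom f)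

theorem rtt_lay_left (D : V) {p : OneCell V} {x : TwoCell V} {A B B' C : V}
    [hp : Typed p A B] (hx : Typed (src x) B' C) (h : B = B') :
    rtt (lay p x 1) D = lay (rt p D) (rtt x D) 1 := by
  obtain ⟨f, rfl⟩ := hp.exists_eq
  subst h
  obtain ⟨g, hg⟩ := hx.exists_eq
  rcases x with _ | @⟨_, _, g, g', η⟩
  · cases hg
  cases hg
  rw [lay, lay, rw_one, rw_one, lw_arr_iso, ← iso_tensorRIso, ← iso_tensorRIso, ← arr_tensorR,
    lw_arr_iso]
  exact iso_eq_of_heq (by rw [tensorR_comp]) (by rw [tensorR_comp])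
    (tensorR₂_whiskerLeft f η.hom D)

theorem rtt_lay_right (D : V) {q : OneCell V} {x : TwoCell V} {A B B' C : V}
    [hq : Typed q B C] (hx : Typed (src x) A B') (h : B' = B) :
    rtt (lay 1 x q) D = lay 1 (rtt x D) (rt q D) := by
  obtain ⟨f, rfl⟩ := hq.exists_eq
  subst h
  obtain ⟨g, hg⟩ := hx.exists_eq
  rcases x with _ | @⟨_, _, g, g', η⟩
  · cases hg
  cases hg
  rw [lay, lay, lw_one, lw_one, rw_iso_arr, ← iso_tensorRIso, ← iso_tensorRIso, ← arr_tensorR,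
    rw_iso_arr]
  exact iso_eq_of_heq (by rw [tensorR_comp]) (by rw [tensorR_comp])
    (tensorR₂_whiskerRight η.hom f D)

@[simp] theorem src_sg (x y : OneCell V) {A A' B B' : V} [hx : Typed x A A'] [hy : Typed y B B'] :
    src (sg x y) = lt A y * rt x B' := by
  obtain ⟨f, rfl⟩ := hx.exists_eq
  obtain ⟨g, rfl⟩ := hy.exists_eq
  exact arr_comp _ _

@[simp] theorem tgt_sg (x y : OneCell V) {A A' B B' : V} [hx : Typed x A A'] [hy : Typed y B B'] :
    tgt (sg x y) = rt x B * lt A' y := by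
  obtain ⟨f, rfl⟩ := hx.exists_eq
  obtain ⟨g, rfl⟩ := hy.exists_eq
  exact arr_comp _ _

/-- Associators become identities, which lets the lemmas below delete them from the composition
axioms of interchangers and of `β`. -/
theorem iso_associator {A B C D : V} (f : A ⟶ B) (g : B ⟶ C) (h : C ⟶ D) :
    iso (α_ f g h) = iso (Iso.refl (f ≫ g ≫ h)) := by
  refine iso_congr (Bicategory.Strict.assoc _ _ _) rfl ?_
  simp [Bicategory.Strict.associator_eqToIso]

theorem mul_iso_refl (x : TwoCell V) {A B : V} (f : A ⟶ B) (h : tgt x = arr f) :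
    x * iso (Iso.refl f) = x := by
  rcases x with _ | ⟨η⟩
  · rfl
  cases h
  rw [← iso_trans, Iso.trans_refl]

theorem iso_refl_mul (x : TwoCell V) {A B : V} (f : A ⟶ B) (h : src x = arr f) :
    iso (Iso.refl f) * x = x := by
  rcases x with _ | ⟨η⟩
  · rfl
  cases h
  rw [← iso_trans, Iso.refl_trans]

theorem mul_iso_associator (x : TwoCell V) {A B C D : V} (f : A ⟶ B) (g : B ⟶ C) (h : C ⟶ D)
    (hx : tgt x = arr f * (arr g * arr h)) : x * iso (α_ f g h) = x := by
  rw [iso_associator, mul_iso_refl _ _ (by rw [hx, arr_comp, arr_comp])]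

theorem iso_associator_mul (x : TwoCell V) {A B C D : V} (f : A ⟶ B) (g : B ⟶ C) (h : C ⟶ D)
    (hx : src x = arr f * (arr g * arr h)) : iso (α_ f g h) * x = x := by
  rw [iso_associator, iso_refl_mul _ _ (by rw [hx, arr_comp, arr_comp])]

theorem inv_iso_associator_mul (x : TwoCell V) {A B C D : V} (f : A ⟶ B) (g : B ⟶ C) (h : C ⟶ D)
    (hx : src x = arr f * (arr g * arr h)) : inv (iso (α_ f g h)) * x = x := by
  rw [iso_associator, inv_iso, Iso.refl_symm, iso_refl_mul _ _ (by rw [hx, arr_comp, arr_comp])]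

theorem iso_whiskerLeftIso {A B C : V} (p : A ⟶ B) {f g : B ⟶ C} (η : f ≅ g) :
    iso (whiskerLeftIso p η) = lay (arr p) (iso η) 1 := by
  rw [lay, rw_one, lw_arr_iso]

theorem iso_whiskerRightIso {A B C : V} {f g : A ⟶ B} (η : f ≅ g) (q : B ⟶ C) :
    iso (whiskerRightIso η q) = lay 1 (iso η) (arr q) := by
  rw [lay, lw_one, rw_iso_arr]

/-- The interchanger axiom for composites, freed of its associator and of the heterogeneous
equality. -/
theorem sg_mul_left {x x' y : OneCell V} {A A' A₂ A'' B B' : V} [hx : Typed x A A']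
    [hx' : Typed x' A₂ A''] [hy : Typed y B B'] (h : A' = A₂) :
    sg (x * x') y = lay 1 (sg x y) (rt x' B') * lay (rt x B) (sg x' y) 1 := by
  obtain ⟨f, rfl⟩ := hx.exists_eq
  subst h
  obtain ⟨f', rfl⟩ := hx'.exists_eq
  obtain ⟨g, rfl⟩ := hy.exists_eq
  have key : iso (interchanger (f ≫ f') g) = iso (whiskerRightIso (interchanger f g) (f' ⊗ᵣ B') ≪≫
      α_ _ _ _ ≪≫ whiskerLeftIso (f ⊗ᵣ B) (interchanger f' g)) := by
    refine iso_eq_of_heq ?_ ?_ (interchanger_comp_left f f' g)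
    · simp only [arr_comp, tensorR_comp, mul_assoc]
    · simp only [arr_comp, tensorR_comp, mul_assoc]
  rw [iso_trans, iso_trans, iso_associator_mul, iso_whiskerLeftIso, iso_whiskerRightIso] at key
  · simpa only [arr_comp, iso_interchanger, arr_tensorR] using key
  · rw [src_iso, arr_comp, arr_comp]

theorem sg_mul_right {x y y' : OneCell V} {A A' B B' B₂ B'' : V} [hx : Typed x A A']
    [hy : Typed y B B'] [hy' : Typed y' B₂ B''] (h : B' = B₂) :
    sg x (y * y') = lay (lt A y) (sg x y') 1 * lay 1 (sg x y) (lt A' y') := by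
  obtain ⟨f, rfl⟩ := hx.exists_eq
  obtain ⟨g, rfl⟩ := hy.exists_eq
  subst h
  obtain ⟨g', rfl⟩ := hy'.exists_eq
  have key : iso (interchanger f (g ≫ g')) = iso (whiskerLeftIso (A ⊗ₗ g) (interchanger f g') ≪≫
      (α_ _ _ _).symm ≪≫ whiskerRightIso (interchanger f g) (A' ⊗ₗ g')) := by
    refine iso_eq_of_heq ?_ ?_ (interchanger_comp_right f g g')
    · simp only [arr_comp, tensorL_comp, mul_assoc]
    · simp only [arr_comp, tensorL_comp, mul_assoc]
  rw [iso_trans, iso_trans, iso_symm, inv_iso_associator_mul, iso_whiskerLeftIso,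
    iso_whiskerRightIso] at key
  · simpa only [arr_comp, iso_interchanger, arr_tensorL] using key
  · rw [src_iso, arr_comp, arr_comp, mul_assoc]

end TwoCell

end Gray

/-! ### The braiding -/

section Braiding

variable {V : Type u} [Bicategory.{w, v} V] [Bicategory.Strict V] [GrayMonoid V]

theorem OneCell.Typed.mul {x y : OneCell V} {A B B' C : V} (hx : Typed x A B) (hy : Typed y B' C)
    (h : B = B') : Typed (x * y) A C := by
  obtain ⟨f, rfl⟩ := hx.exists_eq
  subst h
  obtain ⟨g, rfl⟩ := hy.exists_eq
  exact ⟨f ≫ g, (arr_comp f g).symm⟩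

variable [GrayBraiding V]

/-- The braiding 1-cell. -/
def OneCell.bt (A B : V) : OneCell V := arr (β A B)

/-- Naturality of the braiding in the left variable. -/
def TwoCell.bl : OneCell V → V → TwoCell V
  | arr f, B => iso (βL f B)
  | _, _ => zero

/-- Naturality of the braiding in the right variable. -/
def TwoCell.br (A : V) : OneCell V → TwoCell V
  | arr g => iso (βR A g)
  | _ => zero

/-- The 2-cell `R` of the braiding. -/
def TwoCell.Rt (A B C : V) : TwoCell V := iso (R A B C)

/-- The 2-cell `S` of the braiding. -/
def TwoCell.St (A B C : V) : TwoCell V := iso (S A B C)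

instance OneCell.typed_bt (A B : V) : Typed (bt A B) (A * B) (B * A) := ⟨β A B, rfl⟩

@[simp] theorem OneCell.arr_β (A B : V) : arr (β A B) = bt A B := rfl

namespace TwoCell

@[simp] theorem iso_βL {A A' : V} (f : A ⟶ A') (B : V) : iso (βL f B) = bl (arr f) B := rfl
@[simp] theorem iso_βR (A : V) {B B' : V} (g : B ⟶ B') : iso (βR A g) = br A (arr g) := rfl
@[simp] theorem iso_R (A B C : V) : iso (R A B C) = Rt A B C := rfl
@[simp] theorem iso_S (A B C : V) : iso (S A B C) = St A B C := rfl

@[simp] theorem src_bl (x : OneCell V) (B : V) {A A' : V} [hx : Typed x A A'] :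
    src (bl x B) = rt x B * bt A' B := by
  obtain ⟨f, rfl⟩ := hx.exists_eq
  exact arr_comp _ _

@[simp] theorem tgt_bl (x : OneCell V) (B : V) {A A' : V} [hx : Typed x A A'] :
    tgt (bl x B) = bt A B * lt B x := by
  obtain ⟨f, rfl⟩ := hx.exists_eq
  exact arr_comp _ _

@[simp] theorem src_br (A : V) (y : OneCell V) {B B' : V} [hy : Typed y B B'] :
    src (br A y) = lt A y * bt A B' := by
  obtain ⟨g, rfl⟩ := hy.exists_eq
  exact arr_comp _ _

@[simp] theorem tgt_br (A : V) (y : OneCell V) {B B' : V} [hy : Typed y B B'] :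
    tgt (br A y) = bt A B * rt y A := by
  obtain ⟨g, rfl⟩ := hy.exists_eq
  exact arr_comp _ _

@[simp] theorem src_Rt (A B C : V) : src (Rt A B C) = bt A (B * C) :=
  arr_hcast _ _ _

@[simp] theorem tgt_Rt (A B C : V) : tgt (Rt A B C) = rt (bt A B) C * lt B (bt A C) :=
  (arr_comp _ _).trans (congrArg _ (arr_hcast _ _ _))

@[simp] theorem src_St (A B C : V) : src (St A B C) = bt (A * B) C :=
  arr_hcast _ _ _

@[simp] theorem tgt_St (A B C : V) : tgt (St A B C) = lt A (bt B C) * rt (bt A C) B :=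
  (arr_comp _ _).trans (congrArg (· * _) (arr_hcast _ _ _))

instance typed_src_inv_Rt (A B C : V) : Typed (src (inv (Rt A B C))) (A * B * C) (B * C * A) :=
  ⟨_, rfl⟩

instance typed_src_St (A B C : V) : Typed (src (St A B C)) (A * B * C) (C * A * B) :=
  ⟨_, rfl⟩

instance typed_src_bl (x : OneCell V) (B : V) {A A' : V} [hx : Typed x A A'] :
    Typed (src (bl x B)) (A * B) (B * A') := by
  obtain ⟨f, rfl⟩ := hx.exists_eq
  exact ⟨_, rfl⟩

variable [BraidedGrayMonoid V]

open BraidedGrayMonoid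

theorem bl_mul {x y : OneCell V} (B : V) {A A' A₂ A'' : V} [hx : Typed x A A']
    [hy : Typed y A₂ A''] (h : A' = A₂) :
    bl (x * y) B = lay (rt x B) (bl y B) 1 * lay 1 (bl x B) (lt B y) := by
  obtain ⟨f, rfl⟩ := hx.exists_eq
  subst h
  obtain ⟨g, rfl⟩ := hy.exists_eq
  have key : iso (βL (f ≫ g) B) = iso (whiskerLeftIso (f ⊗ᵣ B) (βL g B) ≪≫
      (α_ _ _ _).symm ≪≫ whiskerRightIso (βL f B) (B ⊗ₗ g)) := by
    refine iso_eq_of_heq ?_ ?_ (βL_comp f g B)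
    · simp only [arr_comp, tensorR_comp, mul_assoc]
    · simp only [arr_comp, tensorL_comp, mul_assoc]
  rw [iso_trans, iso_trans, iso_symm, inv_iso_associator_mul, iso_whiskerLeftIso,
    iso_whiskerRightIso] at key
  · simpa only [arr_comp, iso_βL, arr_tensorR, arr_tensorL] using key
  · rw [src_iso, arr_comp, arr_comp, mul_assoc]

theorem br_mul (A : V) {x y : OneCell V} {B B' B₂ B'' : V} [hx : Typed x B B']
    [hy : Typed y B₂ B''] (h : B' = B₂) :
    br A (x * y) = lay (lt A x) (br A y) 1 * lay 1 (br A x) (rt y A) := by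
  obtain ⟨f, rfl⟩ := hx.exists_eq
  subst h
  obtain ⟨g, rfl⟩ := hy.exists_eq
  have key : iso (βR A (f ≫ g)) = iso (whiskerLeftIso (A ⊗ₗ f) (βR A g) ≪≫
      (α_ _ _ _).symm ≪≫ whiskerRightIso (βR A f) (g ⊗ᵣ A)) := by
    refine iso_eq_of_heq ?_ ?_ (βR_comp A f g)
    · simp only [arr_comp, tensorL_comp, mul_assoc]
    · simp only [arr_comp, tensorR_comp, mul_assoc]
  rw [iso_trans, iso_trans, iso_symm, inv_iso_associator_mul, iso_whiskerLeftIso,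
    iso_whiskerRightIso] at key
  · simpa only [arr_comp, iso_βR, arr_tensorR, arr_tensorL] using key
  · rw [src_iso, arr_comp, arr_comp, mul_assoc]

theorem bl_natural (x : TwoCell V) (B : V) {A A' : V} (hx : Typed (src x) A A') :
    lay 1 (rtt x B) (bt A' B) * bl (tgt x) B = bl (src x) B * lay (bt A B) (ltt B x) 1 := by
  obtain ⟨f, hf⟩ := hx.exists_eq
  rcases x with _ | @⟨_, _, f, g, η⟩
  · cases hf
  cases hf
  have key : whiskerRightIso (tensorRIso η B) (β A' B) ≪≫ βL g B =
      βL f B ≪≫ whiskerLeftIso (β A B) (tensorLIso B η) := Iso.ext (βL_natural η.hom B)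
  have h := congrArg iso key
  rw [iso_trans, iso_trans, iso_whiskerRightIso, iso_whiskerLeftIso] at h
  exact h

theorem br_natural (A : V) (y : TwoCell V) {B B' : V} (hy : Typed (src y) B B') :
    lay 1 (ltt A y) (bt A B') * br A (tgt y) = br A (src y) * lay (bt A B) (rtt y A) 1 := by
  obtain ⟨f, hf⟩ := hy.exists_eq
  rcases y with _ | @⟨_, _, f, g, η⟩
  · cases hf
  cases hf
  have key : whiskerRightIso (tensorLIso A η) (β A B') ≪≫ βR A g =
      βR A f ≪≫ whiskerLeftIso (β A B) (tensorRIso η A) := Iso.ext (βR_natural A η.hom)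
  have h := congrArg iso key
  rw [iso_trans, iso_trans, iso_whiskerRightIso, iso_whiskerLeftIso] at h
  exact h

theorem bl_br_sg (x y : OneCell V) {A A' B B' : V} [hx : Typed x A A'] [hy : Typed y B B'] :
    lay 1 (sg x y) (bt A' B') * (lay (rt x B) (br A' y) 1 * lay 1 (bl x B) (rt y A')) =
      lay (lt A y) (bl x B') 1 * (lay 1 (br A y) (lt B' x) * lay (bt A B) (inv (sg y x)) 1) := by
  obtain ⟨f, rfl⟩ := hx.exists_eq
  obtain ⟨g, rfl⟩ := hy.exists_eq
  have key : whiskerRightIso (interchanger f g) (β A' B') ≪≫ α_ _ _ _ ≪≫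
      whiskerLeftIso (f ⊗ᵣ B) (βR A' g) ≪≫ (α_ _ _ _).symm ≪≫
        whiskerRightIso (βL f B) (g ⊗ᵣ A') ≪≫ α_ _ _ _ =
      α_ _ _ _ ≪≫ whiskerLeftIso (A ⊗ₗ g) (βL f B') ≪≫ (α_ _ _ _).symm ≪≫
        whiskerRightIso (βR A g) (B' ⊗ₗ f) ≪≫ α_ _ _ _ ≪≫
          whiskerLeftIso (β A B) (interchanger g f).symm := Iso.ext (β_interchanger f g)
  have h := congrArg iso key
  simp only [iso_trans, iso_whiskerRightIso, iso_whiskerLeftIso, iso_symm] at h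
  rw [mul_iso_associator, iso_associator_mul (lay (arr (β A B)) _ 1),
    inv_iso_associator_mul (lay 1 (iso (βR A g)) _ * _), inv_iso_associator_mul,
    iso_associator_mul, iso_associator_mul] at h
  · exact h
  all_goals simp [src_mul, arr_comp, mul_assoc]

/-- The compatibility of `β` with interchangers, rotated into the form that trades the inverse
interchanger of `x, y` before the braiding for the interchanger of `y, x` after it. -/
theorem br_sg_bl (x y : OneCell V) {A A' B B' : V} [hx : Typed x A A'] [hy : Typed y B B'] :
    lay (rt x B) (inv (br A' y)) 1 * (lay 1 (inv (sg x y)) (bt A' B') * lay (lt A y) (bl x B') 1) =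
      lay 1 (bl x B) (rt y A') *
        (lay (bt A B) (sg y x) 1 * lay 1 (inv (br A y)) (lt B' x)) := by
  have h := (bl_br_sg x y).symm
  rw [← mul_assoc (lay 1 (sg x y) _)] at h
  have h' := inv_mul_eq_mul_inv h (by rw [src_mul] <;> simp [mul_assoc])
    (by rw [tgt_mul] <;> simp [mul_assoc])
  simpa [inv_mul_rev, mul_assoc] using h'

variable (p q : OneCell V)

theorem lay_br_sg_bl (x y : OneCell V) {A A' B B' : V} [hx : Typed x A A'] [hy : Typed y B B'] :
    lay (p * rt x B) (inv (br A' y)) q *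
        (lay p (inv (sg x y)) (bt A' B' * q) * lay (p * lt A y) (bl x B') q) =
      lay p (bl x B) (rt y A' * q) *
        (lay (p * bt A B) (sg y x) q * lay p (inv (br A y)) (lt B' x * q)) := by
  have h := congrArg (fun e => lay p e q) (br_sg_bl x y)
  have h₁ : tgt (lay 1 (inv (sg x y)) (bt A' B')) = src (lay (lt A y) (bl x B') 1) := by
    simp [mul_assoc]
  have h₂ : tgt (lay (bt A B) (sg y x) 1) = src (lay 1 (inv (br A y)) (lt B' x)) := by
    simp [mul_assoc]
  have h₃ : tgt (lay (rt x B) (inv (br A' y)) 1) =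
      src (lay 1 (inv (sg x y)) (bt A' B') * lay (lt A y) (bl x B') 1) := by
    simp [src_mul h₁, mul_assoc]
  have h₄ : tgt (lay 1 (bl x B) (rt y A')) =
      src (lay (bt A B) (sg y x) 1 * lay 1 (inv (br A y)) (lt B' x)) := by
    simp [src_mul h₂, mul_assoc]
  simpa [lay_mul, h₁, h₂, h₃, h₄] using h

/-! ### Modification and braiding axioms in layer form, within an arbitrary context `p`, `q` -/

theorem Rt_natural₁ {A A' : V} (f : A ⟶ A') (B C : V) :
    lay p (bl (arr f) (B * C)) q * (lay p (Rt A B C) (lt B (lt C (arr f)) * q)) =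
      lay (p * rt (rt (arr f) B) C) (Rt A' B C) q *
        (lay p (rtt (bl (arr f) B) C) (lt B (bt A' C) * q) * (lay (p *
          rt (bt A B) C) (ltt B (bl (arr f) C)) q)) := by
  have h := congrArg (fun e => lay p (iso e) q) (R_natural₁ f B C)
  -- The arrow makes `simp` split the chain of steps before it simplifies the individual ones.
  simpa [↓lay_iso_trans, arr_comp, mul_assoc] using h

theorem Rt_natural₂ (A : V) {B B' : V} (g : B ⟶ B') (C : V) :
    lay p (br A (rt (arr g) C)) q * (lay p (Rt A B C) (rt (rt (arr g) C) A * q)) =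
      lay (p * lt A (rt (arr g) C)) (Rt A B' C) q *
        (lay p (rtt (br A (arr g)) C) (lt B' (bt A C) * q) * (lay (p *
          rt (bt A B) C) (inv (sg (arr g) (bt A C))) q)) := by
  have h := congrArg (fun e => lay p (iso e) q) (R_natural₂ A g C)
  simpa [↓lay_iso_trans, arr_comp, mul_assoc] using h

theorem Rt_natural₃ (A B : V) {C C' : V} (h : C ⟶ C') :
    lay p (br A (lt B (arr h))) q * (lay p (Rt A B C) (lt B (rt (arr h) A) * q)) =
      lay (p * lt A (lt B (arr h))) (Rt A B C') q *
        (lay p (sg (bt A B) (arr h)) (lt B (bt A C') * q) * (lay (p *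
          rt (bt A B) C) (ltt B (br A (arr h))) q)) := by
  have h := congrArg (fun e => lay p (iso e) q) (R_natural₃ A B h)
  simpa [↓lay_iso_trans, arr_comp, mul_assoc] using h

theorem St_natural₁ {A A' : V} (f : A ⟶ A') (B C : V) :
    lay p (bl (rt (arr f) B) C) q * (lay p (St A B C) (lt C (rt (arr f) B) * q)) =
      lay (p * rt (rt (arr f) B) C) (St A' B C) q *
        (lay p (inv (sg (arr f) (bt B C))) (rt (bt A' C) B * q) * (lay (p *
          lt A (bt B C)) (rtt (bl (arr f) C) B) q)) := by
  have h := congrArg (fun e => lay p (iso e) q) (S_natural₁ f B C)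
  simpa [↓lay_iso_trans, arr_comp, mul_assoc] using h

theorem St_natural₂ (A : V) {B B' : V} (g : B ⟶ B') (C : V) :
    lay p (bl (lt A (arr g)) C) q * (lay p (St A B C) (lt C (lt A (arr g)) * q)) =
      lay (p * lt A (rt (arr g) C)) (St A B' C) q *
        (lay p (ltt A (bl (arr g) C)) (rt (bt A C) B' * q) * (lay (p *
          lt A (bt B C)) (sg (bt A C) (arr g)) q)) := by
  have h := congrArg (fun e => lay p (iso e) q) (S_natural₂ A g C)
  simpa [↓lay_iso_trans, arr_comp, mul_assoc] using h

theorem St_natural₃ (A B : V) {C C' : V} (h : C ⟶ C') :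
    lay p (br (A * B) (arr h)) q * (lay p (St A B C) (rt (rt (arr h) A) B * q)) =
      lay (p * lt A (lt B (arr h))) (St A B C') q *
        (lay p (ltt A (br B (arr h))) (rt (bt A C') B * q) * (lay (p *
          lt A (bt B C)) (rtt (br A (arr h)) B) q)) := by
  have h := congrArg (fun e => lay p (iso e) q) (S_natural₃ A B h)
  simpa [↓lay_iso_trans, arr_comp, mul_assoc] using h

theorem bt_coherence₁ (A B C D : V) :
    lay p (Rt A B (C * D)) q * (lay (p * rt (rt (bt A B) C) D) (ltt B (Rt A C D)) q) =
      lay p (Rt A (B * C) D) q * (lay p (rtt (Rt A B C) D) (lt B (lt C (bt A D)) * q)) := by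
  have h := congrArg (fun e => lay p (iso e) q) (braiding₁ A B C D)
  simpa [↓lay_iso_trans, arr_comp, mul_assoc] using h

theorem bt_coherence₂ (A B C D : V) :
    lay p (St (A * B) C D) q * (lay (p * lt A (lt B (bt C D))) (rtt (St A B D) C) q) =
      lay p (St A (B * C) D) q * (lay p (ltt A (St B C D)) (rt (rt (bt A D) B) C * q)) := by
  have h := congrArg (fun e => lay p (iso e) q) (braiding₂ A B C D)
  simpa [↓lay_iso_trans, arr_comp, mul_assoc] using h

theorem bt_coherence₃ (A B C D : V) :
    lay p (rtt (St A B C) D) (lt C (bt (A * B) D) * q) * (lay (p * (lt A (rt (bt B C) D) *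
      rt (rt (bt A C) B) D)) (ltt C (St A B D)) q * (lay (p *
        lt A (rt (bt B C) D)) (inv (sg (bt A C) (bt B D))) (lt C (rt (bt A D) B) * q) * (lay (p *
          (lt A (rt (bt B C) D) * lt A (lt C (bt B D)))) (rtt (inv (Rt A C D)) B) q *
            (lay p (ltt A (inv (Rt B C D))) (rt (bt A (C * D)) B * q))))) =
      lay p (inv (Rt (A * B) C D)) q * (lay p (St A B (C * D)) q) := by
  have h := congrArg (fun e => lay p (iso e) q) (braiding₃ A B C D)
  simpa [↓lay_iso_trans, arr_comp, mul_assoc] using h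

theorem bt_coherence₄ (A B C : V) :
    lay p (inv (Rt A B C)) (rt (bt B C) A * q) * (lay p (inv (br A (bt B C))) q * (lay (p *
      lt A (bt B C)) (Rt A C B) q)) =
      lay (p * rt (bt A B) C) (inv (St B A C)) q * (lay p (bl (bt A B) C) q *
        (lay p (St A B C) (lt C (bt A B) * q))) := by
  have h := congrArg (fun e => lay p (iso e) q) (braiding₄ A B C)
  simpa [↓lay_iso_trans, arr_comp, mul_assoc] using h

end TwoCell
end Braiding

/-! ### Reversal of triple tensor products -/

section Reversal

/-- With words bracketed to the right, a relation between two or three adjacent layers does not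
occur as a subterm when more layers follow; the tail `z` makes it applicable. -/
theorem mul₂_assoc_of {S : Type*} [Semigroup S] {a b c : S} (h : a * b = c) (z : S) :
    a * (b * z) = c * z := by
  rw [← mul_assoc, h]

theorem mul₃_assoc_of {S : Type*} [Semigroup S] {a b c d : S} (h : a * (b * c) = d) (z : S) :
    a * (b * (c * z)) = d * z := by
  rw [← h, mul_assoc, mul_assoc]

variable {V : Type u} [Bicategory.{w, v} V] [Bicategory.Strict V] [GrayMonoid V]
  [GrayBraiding V]

namespace TwoCell

/-- The comparison 2-cell between the two ways of reversing a triple tensor product. -/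
noncomputable def Om (A B C : V) : TwoCell V :=
  lay (rt (bt A B) C) (St B A C) 1 *
    (lay 1 (inv (Rt A B C)) (rt (bt B C) A) * inv (br A (bt B C)))

@[simp] theorem src_Om (A B C : V) : src (Om A B C) = rt (bt A B) C * bt (B * A) C := by
  rw [Om, src_mul]
  · simp
  · rw [src_mul] <;> simp [mul_assoc]

@[simp] theorem tgt_Om (A B C : V) : tgt (Om A B C) = lt A (bt B C) * bt A (C * B) := by
  rw [Om, tgt_mul, tgt_mul]
  · simp
  · simp
  · rw [src_mul] <;> simp [mul_assoc]

variable (p q : OneCell V)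

theorem lay_Om (A B C : V) : lay p (Om A B C) q =
    lay (p * rt (bt A B) C) (St B A C) q *
      (lay p (inv (Rt A B C)) (rt (bt B C) A * q) * lay p (inv (br A (bt B C))) q) := by
  rw [Om, lay_mul, lay_mul]
  · simp
  · simp
  · rw [src_mul] <;> simp [mul_assoc]

theorem lay_rtt_Om (A B C D : V) : lay p (rtt (Om A B C) D) q =
    lay (p * rt (rt (bt A B) C) D) (rtt (St B A C) D) q *
      (lay p (rtt (inv (Rt A B C)) D) (rt (rt (bt B C) A) D * q) *
        lay p (rtt (inv (br A (bt B C))) D) q) := by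
  have h : tgt (lay 1 (inv (Rt A B C)) (rt (bt B C) A)) = src (inv (br A (bt B C))) := by simp
  have h' : tgt (lay (rt (bt A B) C) (St B A C) 1) =
      src (lay 1 (inv (Rt A B C)) (rt (bt B C) A) * inv (br A (bt B C))) := by
    rw [src_mul h]
    simp [mul_assoc]
  rw [Om, rtt_mul _ h', rtt_mul _ h, lay_mul, lay_mul,
    rtt_lay_left D (typed_src_St B A C) (by simp [mul_assoc]),
    rtt_lay_right D (typed_src_inv_Rt A B C) (by simp [mul_assoc])]
  · simp
  · rw [tgt_rtt, src_rtt, h]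
  · rw [src_mul (by rw [tgt_rtt, src_rtt, h]), tgt_rtt, src_rtt, h', src_mul h]

variable [BraidedGrayMonoid V]

/-- Pastes three squares, one for each factor of `Om`: `S` is natural in its middle variable, `R` in
its first, and the factor `br A (bt B C)` is handled by compatibility of `β` with the interchanger
of `f` and `β_{B,C}`. The remaining moves slide layers on disjoint strands. -/
theorem Om_natural₁ (f : OneCell V) (B C : V) {A A' : V} [hf : Typed f A A'] :
    lay p (rtt (bl f B) C) (bt (B * A') C * q) *
        (lay (p * rt (bt A B) C) (bl (lt B f) C) q *
          lay p (Om A B C) (lt C (lt B f) * q)) =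
      lay (p * rt (rt f B) C) (Om A' B C) q *
        (lay p (inv (sg f (bt B C))) (bt A' (C * B) * q) *
          lay (p * lt A (bt B C)) (bl f (C * B)) q) := by
  obtain ⟨f, rfl⟩ := hf.exists_eq
  have e1 := St_natural₂ (p * rt (bt A B) C) q B f C
  have e2 := inv_mul_eq_mul_inv (Rt_natural₁ p (rt (bt B C) A' * q) f B C) (by simp [mul_assoc])
    (by rw [src_mul] <;> simp [mul_assoc])
  have e3 := lay_br_sg_bl p q (arr f) (bt B C)
  have c1 := lay_comm p (rtt (bl (arr f) B) C) 1 (St B A' C) q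
  have c2 := lay_comm p (inv (Rt A B C)) 1 (sg (bt B C) (arr f)) q
  simp [mul_assoc] at e1 e2 e3 c1 c2
  simp only [lay_Om, mul_assoc]
  rw [mul₂_assoc_of e1]
  simp only [mul_assoc]
  rw [mul₂_assoc_of c1, e3, mul₂_assoc_of e2]
  simp only [mul_assoc]
  rw [mul₂_assoc_of c2]
  simp only [mul_assoc]

/-- Naturality of `β` at a 2-cell between composites, expanded by `br_mul` and rotated. It is what
the third factor of `Om` needs when the varying 1-cell lies in the second or third variable, with
`x` itself a naturality cell of `β`. -/
theorem lay_br_natural (A : V) {x : TwoCell V} {a b c d : OneCell V} {B B' E F : V}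
    [Typed a B E] [Typed b E B'] [Typed c B F] [Typed d F B'] (hs : src x = a * b)
    (ht : tgt x = c * d) :
    lay (p * lt A a) (inv (br A b)) q *
        (lay p (ltt A x) (bt A B' * q) * lay (p * lt A c) (br A d) q) =
      lay p (br A a) (rt b A * q) *
        (lay (p * bt A B) (rtt x A) q * lay p (inv (br A c)) (rt d A * q)) := by
  have h := br_natural A x (B := B) (B' := B') (by rw [hs]; exact .mul ‹_› ‹_› rfl)
  rw [ht, hs, br_mul A rfl, br_mul A rfl, ← mul_assoc,
    mul_assoc (lay (lt A a) _ _)] at h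
  have h' := inv_mul_eq_mul_inv h (by rw [tgt_mul] <;> simp [ht, mul_assoc])
    (by rw [src_mul] <;> simp [hs, mul_assoc])
  have h₁ : tgt (lay 1 (ltt A x) (bt A B')) = src (lay (lt A c) (br A d) 1) := by
    simp [ht, mul_assoc]
  have h₂ : tgt (lay (bt A B) (rtt x A) 1) = src (lay 1 (inv (br A c)) (rt d A)) := by
    simp [ht, mul_assoc]
  have h₃ : tgt (lay (lt A a) (inv (br A b)) 1) =
      src (lay 1 (ltt A x) (bt A B') * lay (lt A c) (br A d) 1) := by
    simp [src_mul h₁, hs, mul_assoc]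
  have h₄ : tgt (lay 1 (br A a) (rt b A)) =
      src (lay (bt A B) (rtt x A) 1 * lay 1 (inv (br A c)) (rt d A)) := by
    simp [src_mul h₂, hs, mul_assoc]
  rw [inv_lay, inv_lay, mul_assoc] at h'
  have h'' := congrArg (fun e => lay p e q) h'
  simpa [lay_mul, h₁, h₂, h₃, h₄] using h''

/-- Same pattern: `S` in its first variable, `R` in its second, and naturality of `β` at the 2-cell
`bl g C`. -/
theorem Om_natural₂ (A : V) (g : OneCell V) (C : V) {B B' : V} [hg : Typed g B B'] :
    lay p (rtt (br A g) C) (bt (B' * A) C * q) *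
        (lay (p * rt (bt A B) C) (bl (rt g A) C) q *
          lay p (Om A B C) (lt C (rt g A) * q)) =
      lay (p * lt A (rt g C)) (Om A B' C) q *
        (lay p (ltt A (bl g C)) (bt A (C * B') * q) *
          lay (p * lt A (bt B C)) (br A (lt C g)) q) := by
  obtain ⟨g, rfl⟩ := hg.exists_eq
  have e1 := St_natural₁ (p * rt (bt A B) C) q g A C
  have e2 := inv_mul_eq_mul_inv (Rt_natural₂ p (rt (bt B' C) A * q) A g C) (by simp [mul_assoc])
    (by rw [src_mul] <;> simp [mul_assoc])
  have e3 := lay_br_natural p q A (x := bl (arr g) C) (a := rt (arr g) C) (b := bt B' C)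
    (c := bt B C) (d := lt C (arr g)) (by simp) (by simp)
  have c1 := lay_comm p (rtt (br A (arr g)) C) 1 (St B' A C) q
  have c2 := lay_comm p (inv (Rt A B C)) 1 (rtt (bl (arr g) C) A) q
  simp [mul_assoc] at e1 e2 e3 c1 c2
  simp only [lay_Om, mul_assoc]
  rw [mul₂_assoc_of e1]
  simp only [mul_assoc]
  rw [mul₂_assoc_of c1, e3, mul₂_assoc_of e2]
  simp only [mul_assoc]
  rw [mul₂_assoc_of c2]
  simp only [mul_assoc]

/-- Same pattern: `S` and `R` in their third variables, and naturality of `β` at the 2-cell `br B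
h`. -/
theorem Om_natural₃ (A B : V) (h : OneCell V) {C C' : V} [hh : Typed h C C'] :
    lay p (sg (bt A B) h) (bt (B * A) C' * q) *
        (lay (p * rt (bt A B) C) (br (B * A) h) q *
          lay p (Om A B C) (rt (rt h B) A * q)) =
      lay (p * lt A (lt B h)) (Om A B C') q *
        (lay p (ltt A (br B h)) (bt A (C' * B) * q) *
          lay (p * lt A (bt B C)) (br A (rt h B)) q) := by
  obtain ⟨h, rfl⟩ := hh.exists_eq
  have e1 := St_natural₃ (p * rt (bt A B) C) q B A h
  have e2 := inv_mul_eq_mul_inv (Rt_natural₃ p (rt (bt B C') A * q) A B h) (by simp [mul_assoc])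
    (by rw [src_mul] <;> simp [mul_assoc])
  have e3 := lay_br_natural p q A (x := br B (arr h)) (a := lt B (arr h)) (b := bt B C')
    (c := bt B C) (d := rt (arr h) B) (by simp) (by simp)
  have c1 := lay_comm p (sg (bt A B) (arr h)) 1 (St B A C') q
  have c2 := lay_comm p (inv (Rt A B C)) 1 (rtt (br B (arr h)) A) q
  simp [mul_assoc] at e1 e2 e3 c1 c2
  simp only [lay_Om, mul_assoc]
  rw [mul₂_assoc_of e1]
  simp only [mul_assoc]
  rw [mul₂_assoc_of c1, e3, mul₂_assoc_of e2]
  simp only [mul_assoc]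
  rw [mul₂_assoc_of c2]
  simp only [mul_assoc]

end TwoCell
end Reversal

/-! ### Coherence of the reversal for four objects -/

section ReversalCoherence

variable {V : Type u} [Bicategory.{w, v} V] [Bicategory.Strict V] [GrayMonoid V]
  [GrayBraiding V] [BraidedGrayMonoid V]

namespace TwoCell

variable (p q : OneCell V)

/-- The fourth braiding axiom, solved for `Om`. Having both expressions is essential: the coherence
proof switches between them, and this one is what occurs in the associator of the opposite. -/
theorem Om_eq (A B C : V) : Om A B C = bl (bt A B) C *
    (lay 1 (St A B C) (lt C (bt A B)) * lay (lt A (bt B C)) (inv (Rt A C B)) 1) := by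
  have h := bt_coherence₄ 1 1 A B C
  simp only [one_mul, mul_one, lay_one_one] at h
  have h₁ : Om A B C * lay (lt A (bt B C)) (Rt A C B) 1 =
      bl (bt A B) C * lay 1 (St A B C) (lt C (bt A B)) := by
    rw [Om, mul_assoc, mul_assoc, h, ← inv_lay, mul_inv_cancel_left]
    rw [src_mul] <;> simp
  rw [← mul_assoc, ← h₁, ← inv_lay, mul_inv_cancel_right]
  simp

theorem lay_Om' (A B C : V) : lay p (Om A B C) q =
    lay p (bl (bt A B) C) q * (lay p (St A B C) (lt C (bt A B) * q) *
      lay (p * lt A (bt B C)) (inv (Rt A C B)) q) := by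
  rw [Om_eq, lay_mul, lay_mul]
  · simp
  · simp [mul_assoc]
  · rw [src_mul] <;> simp [mul_assoc]

theorem lay_ltt_Om' (D A B C : V) : lay p (ltt D (Om A B C)) q =
    lay p (ltt D (bl (bt A B) C)) q *
      (lay p (ltt D (St A B C)) (lt D (lt C (bt A B)) * q) *
        lay (p * lt D (lt A (bt B C))) (ltt D (inv (Rt A C B))) q) := by
  have h : tgt (lay 1 (St A B C) (lt C (bt A B))) =
      src (lay (lt A (bt B C)) (inv (Rt A C B)) 1) := by simp [mul_assoc]
  have h' : tgt (bl (bt A B) C) = src (lay 1 (St A B C) (lt C (bt A B)) *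
      lay (lt A (bt B C)) (inv (Rt A C B)) 1) := by
    rw [src_mul h]
    simp
  rw [Om_eq, ltt_mul _ h', ltt_mul _ h, lay_mul, lay_mul,
    ltt_lay_right D (typed_src_St A B C) (by simp [mul_assoc]),
    ltt_lay_left D (typed_src_inv_Rt A C B) (by simp [mul_assoc])]
  · simp
  · rw [tgt_ltt, src_ltt, h]
  · rw [src_mul (by rw [tgt_ltt, src_ltt, h]), tgt_ltt, src_ltt, h', src_mul h]

theorem lay_rtt_Om' (A B C D : V) : lay p (rtt (Om A B C) D) q =
    lay p (rtt (bl (bt A B) C) D) q *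
      (lay p (rtt (St A B C) D) (lt C (rt (bt A B) D) * q) *
        lay (p * lt A (rt (bt B C) D)) (rtt (inv (Rt A C B)) D) q) := by
  have h : tgt (lay 1 (St A B C) (lt C (bt A B))) =
      src (lay (lt A (bt B C)) (inv (Rt A C B)) 1) := by simp [mul_assoc]
  have h' : tgt (bl (bt A B) C) = src (lay 1 (St A B C) (lt C (bt A B)) *
      lay (lt A (bt B C)) (inv (Rt A C B)) 1) := by
    rw [src_mul h]
    simp
  rw [Om_eq, rtt_mul _ h', rtt_mul _ h, lay_mul, lay_mul,
    rtt_lay_right D (typed_src_St A B C) (by simp [mul_assoc]),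
    rtt_lay_left D (typed_src_inv_Rt A C B) (by simp [mul_assoc])]
  · simp
  · rw [tgt_rtt, src_rtt, h]
  · rw [src_mul (by rw [tgt_rtt, src_rtt, h]), tgt_rtt, src_rtt, h', src_mul h]

theorem Om_natural₂' (A : V) (g : OneCell V) (C : V) {B B' : V} [Typed g B B'] :
    lay p (rtt (inv (br A g)) C) (bt (B' * A) C * q) *
        (lay (p * lt A (rt g C)) (Om A B' C) q *
          lay p (ltt A (bl g C)) (bt A (C * B') * q)) =
      lay (p * rt (bt A B) C) (bl (rt g A) C) q *
        (lay p (Om A B C) (lt C (rt g A) * q) *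
          lay (p * lt A (bt B C)) (inv (br A (lt C g))) q) := by
  have h := (Om_natural₂ p q A g C).symm
  rw [← mul_assoc] at h
  have h' := inv_mul_eq_mul_inv h (by rw [tgt_mul] <;> simp [mul_assoc])
    (by rw [src_mul] <;> simp [mul_assoc])
  simpa [mul_assoc] using h'

theorem Om_natural₃' (A B : V) (h : OneCell V) {C C' : V} [Typed h C C'] :
    lay (p * rt (bt A B) C) (inv (br (B * A) h)) q *
        (lay p (inv (sg (bt A B) h)) (bt (B * A) C' * q) *
          lay (p * lt A (lt B h)) (Om A B C') q) =
      lay p (Om A B C) (rt (rt h B) A * q) *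
        (lay (p * lt A (bt B C)) (inv (br A (rt h B))) q *
          lay p (ltt A (inv (br B h))) (bt A (C' * B) * q)) := by
  have e := (Om_natural₃ p q A B h).symm
  rw [← mul_assoc (lay p (sg _ _) _)] at e
  have e' := inv_mul_eq_mul_inv e (by rw [src_mul] <;> simp [mul_assoc])
    (by rw [tgt_mul] <;> simp [mul_assoc])
  simpa [inv_mul_rev, mul_assoc] using e'

/-- The companion of `lay_br_natural` with both naturality cells inverted on each side. The
duplicated objects and their equations absorb differing bracketings of the inferred types. -/
theorem lay_inv_br_natural (A : V) {x : TwoCell V} {a b c d : OneCell V} {B B' E F : V}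
    {B₁ B₂ E' F' : V} [Typed a B E] [Typed b E' B'] [Typed c B₁ F] [Typed d F' B₂]
    (hE : E = E') (hF : F = F') (h₁ : B₁ = B) (h₂ : B₂ = B') (hs : src x = a * b)
    (ht : tgt x = c * d) :
    lay p (inv (br A a)) (rt b A * q) *
        (lay (p * lt A a) (inv (br A b)) q * lay p (ltt A x) (bt A B' * q)) =
      lay (p * bt A B) (rtt x A) q *
        (lay p (inv (br A c)) (rt d A * q) * lay (p * lt A c) (inv (br A d)) q) := by
  subst hE hF h₁ h₂
  have h := br_natural A x (B := B₁) (B' := B₂) (by rw [hs]; exact .mul ‹_› ‹_› rfl)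
  rw [ht, hs, br_mul A rfl, br_mul A rfl] at h
  have h' := inv_mul_eq_mul_inv h (by rw [src_mul] <;> simp [ht, mul_assoc])
    (by rw [tgt_mul] <;> simp [hs, mul_assoc])
  rw [inv_mul_rev, inv_mul_rev, mul_assoc] at h'
  have h₁ : tgt (lay (lt A a) (inv (br A b)) 1) = src (lay 1 (ltt A x) (bt A B₂)) := by
    simp [hs, mul_assoc]
  have h₂ : tgt (lay 1 (inv (br A c)) (rt d A)) = src (lay (lt A c) (inv (br A d)) 1) := by
    simp [mul_assoc]
  have h₃ : tgt (lay 1 (inv (br A a)) (rt b A)) =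
      src (lay (lt A a) (inv (br A b)) 1 * lay 1 (ltt A x) (bt A B₂)) := by
    simp [src_mul h₁, mul_assoc]
  have h₄ : tgt (lay (bt A B₁) (rtt x A) 1) =
      src (lay 1 (inv (br A c)) (rt d A) * lay (lt A c) (inv (br A d)) 1) := by
    simp [src_mul h₂, ht, mul_assoc]
  have h'' := congrArg (fun e => lay p e q) h'
  simpa [lay_mul, h₁, h₂, h₃, h₄] using h''

/-- The two ways of reversing a fourfold tensor product by reversing triple ones agree. -/
theorem Om_coherence (A B C D : V) :
    lay p (rtt (Om A B C) D) (bt (C * (B * A)) D * q) *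
        (lay (p * lt A (rt (bt B C) D)) (Om A (C * B) D) q *
          lay p (ltt A (Om B C D)) (bt A (D * (C * B)) * q)) =
      lay (p * rt (rt (bt A B) C) D) (Om (B * A) C D) q *
        (lay p (inv (sg (bt A B) (bt C D))) (bt (B * A) (D * C) * q) *
          lay (p * lt A (lt B (bt C D))) (Om A B (D * C)) q) := by
  have n₂ := Om_natural₂' p q A (bt B C) D
  have n₃ := Om_natural₃' p q A B (bt C D)
  -- Naturality of `β` at the composite 2-cell `S` followed by `R⁻¹`, the part of `Om B C D` left
  -- after its `bl` factor has been absorbed by `n₂`.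
  have t₁ := lay_inv_br_natural p q A (a := bt (B * C) D) (b := lt D (bt B C))
    (c := lt B (bt C D)) (d := bt B (D * C))
    (x := lay 1 (St B C D) (lt D (bt B C)) * lay (lt B (bt C D)) (inv (Rt B D C)) 1)
    (by simp [mul_assoc]) (by simp [mul_assoc]) (by simp [mul_assoc]) (by simp [mul_assoc])
    (by rw [src_mul] <;> simp [mul_assoc]) (by rw [tgt_mul] <;> simp [mul_assoc])
  rw [ltt_mul _ (by simp [mul_assoc]), rtt_mul _ (by simp [mul_assoc])] at t₁
  rw [lay_mul, lay_mul, ltt_lay_right A (typed_src_St B C D) (by simp [mul_assoc]),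
    ltt_lay_left A (typed_src_inv_Rt B D C) (by simp [mul_assoc]),
    rtt_lay_right A (typed_src_St B C D) (by simp [mul_assoc]),
    rtt_lay_left A (typed_src_inv_Rt B D C) (by simp [mul_assoc])] at t₁
  rotate_left
  · simp [mul_assoc]
  · simp [mul_assoc]
  have t₂ := lay_inv_br_natural p q A (x := inv (br B (bt C D))) (a := bt B (C * D))
    (b := rt (bt C D) B) (c := lt B (bt C D)) (d := bt B (D *
      C)) (by simp [mul_assoc]) (by simp [mul_assoc]) (by simp [mul_assoc])
    (by simp [mul_assoc]) (by simp) (by simp)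
  simp [mul_assoc] at n₂ n₃ t₁ t₂
  -- The first three braiding axioms, each in the context where it will be applied.
  have a₁ := congrArg inv (bt_coherence₁ p ((rt (bt (B * C) D) A) * (lt D (rt (bt B C) A) * q))
    A B C D)
  have a₂ := bt_coherence₂
    (p * (rt (rt (bt A B) C) D * (lt B (rt (bt A C) D) * rt (rt (bt B C) A) D))) q C B A D
  have a₃ := bt_coherence₃ (p * rt (rt (bt A B) C) D) (rt (rt (bt C D) B) A * q) B A C D
  have s₁ := St_natural₁ (p * (rt (rt (bt A B) C) D * lt B (rt (bt A C) D))) q (β B C) A D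
  -- The two expressions for `Om B C D ⊗ A` are equated: a second use of the fourth axiom, after the
  -- one in expanding `A ⊗ Om B C D`.
  have r₁ := lay_rtt_Om (p * (rt (rt (bt A B) C) D * (lt B (rt (bt A C) D) * lt B (lt C (bt A D)))))
    q B C D A
  rw [lay_rtt_Om'] at r₁
  -- The remaining equations only exchange layers on disjoint strands.
  have c₁ := lay_comm p (rtt (inv (Rt A B C)) D) 1 (bl (rt (bt B C) A) D) q
  have c₂ := lay_comm p (rtt (inv (Rt A B C)) D) 1 (St (B * C) A D) (lt D (rt (bt B C) A) * q)
  have c₃ := lay_comm p (inv (Rt A B (C * D))) 1 (rtt (St B C D) A) (lt D (rt (bt B C) A) * q)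
  have c₄ := lay_comm p (inv (Rt A B (C * D))) (lt B (rt (bt C D) A)) (rtt (inv (Rt B D C)) A) q
  have c₅ := lay_comm p (inv (Rt A B (C * D))) 1 (rtt (inv (br B (bt C D))) A) q
  have c₆ := lay_comm (p * rt (rt (bt A B) C) D) (ltt B (inv (Rt A C D))) 1 (rtt (St B C D) A)
    (lt D (rt (bt B C) A) * q)
  have c₇ := lay_comm (p * rt (rt (bt A B) C) D) (ltt B (inv (Rt A C D))) (lt B (rt (bt C D) A))
    (rtt (inv (Rt B D C)) A) q
  have c₈ := lay_comm (p * rt (rt (bt A B) C) D) (ltt B (inv (Rt A C D))) 1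
    (rtt (inv (br B (bt C D))) A) q
  have c₉ := lay_comm (p * rt (rt (bt A B) C) D) (rtt (St B A C) D) 1 (St C (B * A) D) q
  have c₀ := lay_comm (p * (rt (rt (bt A B) C) D * lt B (rt (bt A C) D)))
    (inv (sg (bt B C) (bt A D))) 1 (rtt (St C B D) A) q
  simp [mul_assoc, inv_mul_rev] at n₂ n₃ t₁ t₂ a₁ a₂ a₃ s₁ r₁ c₁ c₂ c₃ c₄ c₅ c₆ c₇ c₈ c₉ c₀
  -- The outer two reversals are expanded by different formulas, so that naturality cells at
  -- `β_{B,C}` stand on both sides of the middle one; `n₂` then replaces `CB` by `BC` in it.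
  simp only [lay_rtt_Om, lay_ltt_Om', mul_assoc]
  rw [mul₃_assoc_of n₂]
  simp only [mul_assoc]
  rw [lay_Om]
  simp only [mul_assoc]
  rw [t₁, mul₂_assoc_of c₁]
  simp only [mul_assoc]
  rw [mul₂_assoc_of c₂]
  simp only [mul_assoc]
  rw [mul₂_assoc_of a₁.symm]
  simp only [mul_assoc]
  rw [mul₂_assoc_of c₃]
  simp only [mul_assoc]
  rw [mul₂_assoc_of c₄]
  simp only [mul_assoc]
  rw [mul₂_assoc_of c₆]
  simp only [mul_assoc]
  rw [mul₂_assoc_of c₇]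
  simp only [mul_assoc]
  rw [mul₂_assoc_of s₁]
  simp only [mul_assoc]
  rw [mul₃_assoc_of r₁]
  simp only [mul_assoc]
  -- From here the right side is rewritten: naturality along `β_{C,D}` turns `DC` into `CD`, and the
  -- third and second axioms bring it to the form reached on the left.
  rw [lay_Om _ _ (B * A) C D]
  simp only [mul_assoc, rt_mul_obj]
  rw [n₃, lay_Om _ _ A B (C * D)]
  simp only [mul_assoc, rt_mul_obj]
  rw [t₂, mul₂_assoc_of c₅]
  simp only [mul_assoc]
  rw [mul₂_assoc_of a₃.symm]
  simp only [mul_assoc]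
  rw [mul₂_assoc_of c₈]
  simp only [mul_assoc]
  rw [mul₂_assoc_of c₉.symm]
  simp only [mul_assoc]
  rw [mul₂_assoc_of a₂.symm]
  simp only [mul_assoc]
  rw [mul₂_assoc_of c₀.symm]
  simp only [mul_assoc]

end TwoCell
end ReversalCoherence

/-! ### Further forms of the naturality of the reversal -/

section ReversedPentagon

variable {V : Type u} [Bicategory.{w, v} V] [Bicategory.Strict V] [GrayMonoid V]
  [GrayBraiding V] [BraidedGrayMonoid V]

namespace TwoCell

variable (p q : OneCell V)

theorem lay_bl_natural (B : V) {x : TwoCell V} {a b c d : OneCell V} {A A' E F : V}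
    {A₁ A₂ E' F' : V} [Typed a A E] [Typed b E' A'] [Typed c A₁ F] [Typed d F' A₂]
    (hE : E = E') (hF : F = F') (h₁ : A₁ = A) (h₂ : A₂ = A') (hs : src x = a * b)
    (ht : tgt x = c * d) :
    lay p (rtt x B) (bt A' B * q) * lay (p * rt c B) (bl d B) q =
      lay (p * rt a B) (bl b B) q * (lay p (bl a B) (lt B b * q) *
        (lay (p * bt A B) (ltt B x) q * lay p (inv (bl c B)) (lt B d * q))) := by
  subst hE hF h₁ h₂
  have h := bl_natural x B (A := A₁) (A' := A₂) (by rw [hs]; exact .mul ‹_› ‹_› rfl)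
  rw [ht, hs, bl_mul B rfl, bl_mul B rfl, ← mul_assoc, mul_assoc (lay (rt a B) _ _)] at h
  have h' := congrArg (· * inv (lay 1 (bl c B) (lt B d))) h
  have h₁ : tgt (lay 1 (rtt x B) (bt A₂ B)) = src (lay (rt c B) (bl d B) 1) := by
    simp [ht, mul_assoc]
  rw [mul_inv_cancel_right (by rw [tgt_mul h₁]; simp [mul_assoc])] at h'
  have h₂ : tgt (lay (bt A₁ B) (ltt B x) 1) = src (lay 1 (inv (bl c B)) (lt B d)) := by
    simp [ht, mul_assoc]
  have h₃ : tgt (lay 1 (bl a B) (lt B b)) =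
      src (lay (bt A₁ B) (ltt B x) 1 * lay 1 (inv (bl c B)) (lt B d)) := by
    simp [src_mul h₂, hs, mul_assoc]
  have h₄ : tgt (lay (rt a B) (bl b B) 1) = src (lay 1 (bl a B) (lt B b) *
      (lay (bt A₁ B) (ltt B x) 1 * lay 1 (inv (bl c B)) (lt B d))) := by
    simp [src_mul h₃, mul_assoc]
  have h'' := congrArg (fun e => lay p e q) h'
  simpa [lay_mul, h₁, h₂, h₃, h₄, mul_assoc] using h''

/-- Naturality in the first variable solved for the reversal after `f`, so that a composition
standing before a reversal can be moved behind it. -/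
theorem Om_natural₁' (f : OneCell V) (B C : V) {A A' : V} [Typed f A A'] :
    lay (p * rt (rt f B) C) (Om A' B C) q =
      lay p (rtt (bl f B) C) (bt (B * A') C * q) *
        (lay (p * rt (bt A B) C) (bl (lt B f) C) q *
          (lay p (Om A B C) (lt C (lt B f) * q) *
            (lay (p * lt A (bt B C)) (inv (bl f (C * B))) q *
              lay p (sg f (bt B C)) (bt A' (C * B) * q)))) := by
  have h := congrArg (· * inv (lay p (inv (sg f (bt B C))) (bt A' (C * B) * q) *
    lay (p * lt A (bt B C)) (bl f (C * B)) q)) (Om_natural₁ p q f B C)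
  rw [mul_inv_cancel_right (by rw [src_mul] <;> simp [mul_assoc])] at h
  simpa [inv_mul_rev, mul_assoc] using h.symm

theorem Om_natural₂'' (A : V) (g : OneCell V) (C : V) {B B' : V} [Typed g B B'] :
    lay (p * rt (bt A B) C) (inv (bl (rt g A) C)) q *
        (lay p (rtt (inv (br A g)) C) (bt (B' * A) C * q) *
          lay (p * lt A (rt g C)) (Om A B' C) q) =
      lay p (Om A B C) (lt C (rt g A) * q) *
        (lay (p * lt A (bt B C)) (inv (br A (lt C g))) q *
          lay p (ltt A (inv (bl g C))) (bt A (C * B') * q)) := by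
  have h := (Om_natural₂ p q A g C).symm
  rw [← mul_assoc (lay p (rtt _ _) _)] at h
  have h' := inv_mul_eq_mul_inv h (by rw [src_mul] <;> simp [mul_assoc])
    (by rw [tgt_mul] <;> simp [mul_assoc])
  simpa [inv_mul_rev, mul_assoc] using h'

/-- An interchanger of two composites is tiled by a two-by-two grid of interchangers. -/
theorem lay_inv_sg_mul_mul {x x' y y' : OneCell V} {A A' A'' B B' B'' : V} [Typed x A A']
    [Typed x' A' A''] [Typed y B B'] [Typed y' B' B''] :
    lay p (inv (sg (x * x') (y * y'))) q =
      lay (p * rt x B) (inv (sg x' y)) (lt A'' y' * q) *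
        (lay (p * (rt x B * lt A' y)) (inv (sg x' y')) q *
          (lay p (inv (sg x y)) (lt A' y' * (rt x' B'' * q)) *
            lay (p * lt A y) (inv (sg x y')) (rt x' B'' * q))) := by
  have : Typed (y * y') B B'' := .mul ‹_› ‹_› rfl
  have h := sg_mul_left (x := x) (x' := x') (y := y * y') rfl
  rw [sg_mul_right (x := x) (y := y) (y' := y') rfl,
    sg_mul_right (x := x') (y := y) (y' := y') rfl] at h
  have h₁ : tgt (lay (lt A y) (sg x y') 1) = src (lay 1 (sg x y) (lt A' y')) := by
    simp [mul_assoc]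
  have h₂ : tgt (lay (lt A' y) (sg x' y') 1) = src (lay 1 (sg x' y) (lt A'' y')) := by
    simp [mul_assoc]
  rw [lay_mul _ _ h₁, lay_mul _ _ h₂] at h
  have h₃ := congrArg (fun e => inv (lay p e q)) h
  rw [mul_assoc, lay_mul, lay_mul, lay_mul] at h₃
  · simpa [inv_mul_rev, mul_assoc] using h₃
  all_goals simp [src_mul, mul_assoc]

end TwoCell
end ReversedPentagon

/-! ### The reversed associativity axiom -/

section ReversedAssociativity

variable {V : Type u} [Bicategory.{w, v} V] [Bicategory.Strict V] [GrayMonoid V]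
  [GrayBraiding V] [BraidedGrayMonoid V]

namespace TwoCell

variable (p q : OneCell V)

/-- One side of the reversed associativity axiom, with all the reversals moved to the front. -/
theorem reversed_associativity_left {W X Y Z XW YX ZY T U : V}
    {m₁ m₂ m₃ n₁ n₂ n₃ n₄ k₁ k₃ : OneCell V} {a₁ a₂ a₅ : TwoCell V}
    [Typed m₁ (X * W) XW] [Typed m₂ (Y * X) YX] [Typed m₃ (Z * Y) ZY] [Typed n₁ (Y * XW) T]
    [Typed n₂ (YX * W) T] [Typed n₃ (Z * YX) U] [Typed n₄ (ZY * X) U]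
    (hs₁ : src a₁ = rt m₂ W * n₂) (ht₁ : tgt a₁ = lt Y m₁ * n₁)
    (hs₂ : src a₂ = rt m₃ X * n₄) (ht₂ : tgt a₂ = lt Z m₂ * n₃)
    (hs₅ : src a₅ = rt n₃ W * k₃) (ht₅ : tgt a₅ = lt Z n₂ * k₁) :
    lay (p * rt (rt (bt W X) Y) Z) (rtt (bl m₁ Y) Z) (rt n₁ Z * (bt T Z * (k₁ * q))) *
      (lay p (rtt (Om W X Y) Z) (lt Y (rt m₁ Z) * (rt n₁ Z * (bt T Z * (k₁ * q)))) *
      (lay (p * (lt W (rt (bt X Y) Z) * rt (bt W (Y * X)) Z)) (rtt (inv a₁) Z)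
        (bt T Z * (k₁ * q)) *
      (lay (p * lt W (rt (bt X Y) Z)) (rtt (inv (br W m₂)) Z) (rt n₂ Z * (bt T Z * (k₁ * q))) *
      (lay (p * (lt W (rt (bt X Y) Z) * (lt W (rt m₂ Z) * rt (bt W YX) Z))) (bl n₂ Z) (k₁ * q) *
      (lay (p * (lt W (rt (bt X Y) Z) * lt W (rt m₂ Z))) (Om W YX Z) (lt Z n₂ * (k₁ * q)) *
      (lay (p * (lt W (rt (bt X Y) Z) * (lt W (rt m₂ Z) * (lt W (bt YX Z) * bt W (Z * YX)))))
        (inv a₅) q *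
      (lay (p * (lt W (rt (bt X Y) Z) * (lt W (rt m₂ Z) * lt W (bt YX Z)))) (inv (br W n₃))
        (k₃ * q) *
      (lay (p * lt W (rt (bt X Y) Z)) (ltt W (bl m₂ Z)) (lt W n₃ * (bt W U * (k₃ * q))) *
      (lay p (ltt W (Om X Y Z)) (lt W (lt Z m₂) * (lt W n₃ * (bt W U * (k₃ * q)))) *
      (lay (p * (lt W (lt X (bt Y Z)) * lt W (bt X (Z * Y)))) (ltt W (inv a₂))
        (bt W U * (k₃ * q)) *
      lay (p * lt W (lt X (bt Y Z))) (ltt W (inv (br X m₃)))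
        (lt W n₄ * (bt W U * (k₃ * q))))))))))))) =
    lay (p * rt (rt (bt W X) Y) Z) (rtt (bl m₁ Y) Z) (rt n₁ Z * (bt T Z * (k₁ * q))) *
      (lay (p * (rt (rt (bt W X) Y) Z * (rt (bt (X * W) Y) Z * lt Y (rt m₁ Z)))) (bl n₁ Z)
        (k₁ * q) *
      (lay (p * (rt (rt (bt W X) Y) Z * rt (bt (X * W) Y) Z)) (bl (lt Y m₁) Z)
        (lt Z n₁ * (k₁ * q)) *
      (lay p (rtt (Om W X Y) Z) (bt (Y * (X * W)) Z * (lt Z (lt Y m₁) * (lt Z n₁ * (k₁ * q)))) *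
      (lay (p * lt W (rt (bt X Y) Z)) (Om W (Y * X) Z)
        (lt Z (lt Y m₁) * (lt Z n₁ * (k₁ * q))) *
      (lay p (ltt W (Om X Y Z)) (bt W (Z * (Y * X)) * (lt Z (lt Y m₁) * (lt Z n₁ * (k₁ * q)))) *
      (lay (p * (lt W (lt X (bt Y Z)) * (lt W (bt X (Z * Y)) * bt W (Z * (Y * X)))))
        (ltt Z (inv a₁)) (k₁ * q) *
      (lay (p * (lt W (lt X (bt Y Z)) * (lt W (bt X (Z * Y)) *
          (bt W (Z * (Y * X)) * lt Z (rt m₂ W))))) (inv a₅) q *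
      (lay (p * (lt W (lt X (bt Y Z)) * (lt W (bt X (Z * Y)) * bt W (Z * (Y * X)))))
        (rtt (inv a₂) W) (k₃ * q) *
      (lay (p * (lt W (lt X (bt Y Z)) * lt W (bt X (Z * Y)))) (inv (br W (rt m₃ X)))
        (rt n₄ W * (k₃ * q)) *
      (lay (p * (lt W (lt X (bt Y Z)) * (lt W (bt X (Z * Y)) * lt W (rt m₃ X)))) (inv (br W n₄))
        (k₃ * q) *
      lay (p * lt W (lt X (bt Y Z))) (ltt W (inv (br X m₃)))
        (lt W n₄ * (bt W U * (k₃ * q))))))))))))) := by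
  have e₁ := lay_comm (p * lt W (rt (bt X Y) Z)) (rtt (inv (br W m₂)) Z) 1 (bl n₂ Z) (k₁ * q)
  -- Naturality of `β` at `a₁⁻¹` carries this associator across the strand `Z`.
  have e₂ := lay_bl_natural (p * (lt W (rt (bt X Y) Z) * rt (bt W (Y * X)) Z)) (k₁ * q) Z
    (x := inv a₁) (a := lt Y m₁) (b := n₁) (c := rt m₂ W) (d := n₂) rfl rfl
    (by simp [mul_assoc]) rfl (by simp [*]) (by simp [*])
  have e₃ := lay_comm p (rtt (Om W X Y) Z) (lt Y (rt m₁ Z)) (bl n₁ Z) (k₁ * q)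
  have e₄ := lay_comm p (rtt (Om W X Y) Z) 1 (bl (lt Y m₁) Z) (lt Z n₁ * (k₁ * q))
  -- Moves `m₂` behind the middle reversal. The cell `ltt W (inv (bl m₂ Z))` produced here is slid
  -- along by `e₆` and `e₈` and cancelled in `f₀` against its inverse from the third associator.
  have e₅ := Om_natural₂'' (p * lt W (rt (bt X Y) Z)) (lt Z n₂ * (k₁ * q)) W m₂ Z
  have e₆ := lay_comm (p * lt W (rt (bt X Y) Z)) (ltt W (inv (bl m₂ Z))) (bt W (Z * YX)) (inv a₅) q
  have e₇ := lay_comm (p * (lt W (rt (bt X Y) Z) * lt W (bt (Y * X) Z)))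
    (inv (br W (lt Z m₂))) 1 (inv a₅) q
  have e₈ := lay_comm (p * lt W (rt (bt X Y) Z)) (ltt W (inv (bl m₂ Z))) 1 (inv (br W n₃)) (k₃ * q)
  have e₀ := lay_comm p (ltt W (Om X Y Z)) (lt W (lt Z m₂)) (inv (br W n₃)) (k₃ * q)
  have f₀ := lay_inv_mul (p := p * lt W (rt (bt X Y) Z)) (x := ltt W (bl m₂ Z))
    (q := lt W n₃ * (bt W U * (k₃ * q))) (p' := p) (y := ltt W (Om X Y Z))
    (q' := lt W (lt Z m₂) * (lt W n₃ * (bt W U * (k₃ * q)))) (by simp [mul_assoc])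
  have e₉ := lay_comm p (ltt W (Om X Y Z)) 1 (inv (br W (lt Z m₂))) (rt n₃ W * (k₃ * q))
  have f₁ := lay_comm p (ltt W (Om X Y Z)) (bt W (Z * (Y * X)) * lt Z (rt m₂ W)) (inv a₅) q
  -- Naturality of `β` at `a₂⁻¹` carries this associator across the strand `W`.
  have f₂ := lay_inv_br_natural (p * (lt W (lt X (bt Y Z)) * lt W (bt X (Z * Y)))) (k₃ * q) W
    (x := inv a₂) (a := lt Z m₂) (b := n₃) (c := rt m₃ X) (d := n₄) rfl rfl
    (by simp [mul_assoc]) rfl (by simp [*]) (by simp [*])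
  have f₃ := lay_comm (p * lt W (rt (bt X Y) Z)) (Om W (Y * X) Z) 1 (ltt Z (inv a₁)) (k₁ * q)
  have f₄ := lay_comm p (ltt W (Om X Y Z)) (bt W (Z * (Y * X))) (ltt Z (inv a₁)) (k₁ * q)
  simp [mul_assoc, hs₁, ht₁, hs₅, ht₅] at e₁ e₂ e₃ e₄ e₅ e₆ e₇ e₈ e₉ e₀ f₀ f₁ f₂ f₃ f₄
  rw [mul₂_assoc_of e₁]
  simp only [mul_assoc]
  rw [mul₂_assoc_of e₂]
  simp only [mul_assoc]
  rw [mul₂_assoc_of e₃]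
  simp only [mul_assoc]
  rw [mul₂_assoc_of e₄]
  simp only [mul_assoc]
  rw [mul₃_assoc_of e₅]
  simp only [mul_assoc]
  rw [mul₂_assoc_of e₆]
  simp only [mul_assoc]
  rw [mul₂_assoc_of e₇]
  simp only [mul_assoc]
  rw [mul₂_assoc_of e₈]
  simp only [mul_assoc]
  rw [f₀]
  rw [mul₂_assoc_of e₀.symm]
  simp only [mul_assoc]
  rw [mul₂_assoc_of e₉.symm]
  simp only [mul_assoc]
  rw [mul₂_assoc_of f₁.symm]
  simp only [mul_assoc]
  rw [mul₃_assoc_of f₂]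
  simp only [mul_assoc]
  rw [mul₂_assoc_of f₃.symm]
  simp only [mul_assoc]
  rw [mul₂_assoc_of f₄.symm]
  simp only [mul_assoc]

/-- The other side of the reversed associativity axiom, with all the reversals moved to the
front. -/
theorem reversed_associativity_right {W X Y Z XW ZY T U : V}
    {m₁ m₃ n₁ n₄ k₁ k₂ k₃ : OneCell V} {a₃ a₄ : TwoCell V}
    [Typed m₁ (X * W) XW] [Typed m₃ (Z * Y) ZY] [Typed n₁ (Y * XW) T] [Typed n₄ (ZY * X) U]
    (hs₃ : src a₃ = rt m₃ XW * k₂) (ht₃ : tgt a₃ = lt Z n₁ * k₁)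
    (hs₄ : src a₄ = rt n₄ W * k₃) (ht₄ : tgt a₄ = lt ZY m₁ * k₂) :
    lay (p * (rt (rt (bt W X) Y) Z * (rt (rt m₁ Y) Z * rt (bt XW Y) Z))) (bl n₁ Z) (k₁ * q) *
      (lay (p * (rt (rt (bt W X) Y) Z * rt (rt m₁ Y) Z)) (Om XW Y Z) (lt Z n₁ * (k₁ * q)) *
      (lay (p * (rt (rt (bt W X) Y) Z * (rt (rt m₁ Y) Z * (lt XW (bt Y Z) * bt XW (Z * Y)))))
        (inv a₃) q *
      (lay (p * (rt (rt (bt W X) Y) Z * (rt (rt m₁ Y) Z * lt XW (bt Y Z)))) (inv (br XW m₃))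
        (k₂ * q) *
      (lay p (inv (sg (bt W X * m₁) (bt Y Z * m₃))) (bt XW ZY * (k₂ * q)) *
      (lay (p * (lt W (lt X (bt Y Z)) * (lt W (lt X m₃) * rt (bt W X) ZY))) (bl m₁ ZY) (k₂ * q) *
      (lay (p * (lt W (lt X (bt Y Z)) * lt W (lt X m₃))) (Om W X ZY) (lt ZY m₁ * (k₂ * q)) *
      (lay (p * (lt W (lt X (bt Y Z)) * (lt W (lt X m₃) * (lt W (bt X ZY) * bt W (ZY * X)))))
        (inv a₄) q *
      lay (p * (lt W (lt X (bt Y Z)) * (lt W (lt X m₃) * lt W (bt X ZY)))) (inv (br W n₄))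
        (k₃ * q)))))))) =
    lay (p * rt (rt (bt W X) Y) Z) (rtt (bl m₁ Y) Z) (rt n₁ Z * (bt T Z * (k₁ * q))) *
      (lay (p * (rt (rt (bt W X) Y) Z * (rt (bt (X * W) Y) Z * lt Y (rt m₁ Z)))) (bl n₁ Z)
        (k₁ * q) *
      (lay (p * (rt (rt (bt W X) Y) Z * rt (bt (X * W) Y) Z)) (bl (lt Y m₁) Z)
        (lt Z n₁ * (k₁ * q)) *
      (lay (p * rt (rt (bt W X) Y) Z) (Om (X * W) Y Z) (lt Z (lt Y m₁) * (lt Z n₁ * (k₁ * q))) *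
      (lay p (inv (sg (bt W X) (bt Y Z)))
        (bt (X * W) (Z * Y) * (lt Z (lt Y m₁) * (lt Z n₁ * (k₁ * q)))) *
      (lay (p * lt W (lt X (bt Y Z))) (Om W X (Z * Y)) (lt Z (lt Y m₁) * (lt Z n₁ * (k₁ * q))) *
      (lay (p * (lt W (lt X (bt Y Z)) * (lt W (bt X (Z * Y)) *
          (bt W (Z * (Y * X)) * lt Z (lt Y m₁))))) (inv a₃) q *
      (lay (p * (lt W (lt X (bt Y Z)) * (lt W (bt X (Z * Y)) * bt W (Z * (Y * X)))))
        (sg m₃ m₁) (k₂ * q) *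
      (lay (p * (lt W (lt X (bt Y Z)) * (lt W (bt X (Z * Y)) *
          (bt W (Z * (Y * X)) * rt (rt m₃ X) W)))) (inv a₄) q *
      (lay (p * (lt W (lt X (bt Y Z)) * lt W (bt X (Z * Y)))) (inv (br W (rt m₃ X)))
        (rt n₄ W * (k₃ * q)) *
      (lay (p * (lt W (lt X (bt Y Z)) * (lt W (bt X (Z * Y)) * lt W (rt m₃ X)))) (inv (br W n₄))
        (k₃ * q) *
      lay (p * lt W (lt X (bt Y Z))) (ltt W (inv (br X m₃)))
        (lt W n₄ * (bt W U * (k₃ * q))))))))))))) := by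
  -- Moves `m₁` behind the first reversal. The interchanger of `m₁` with `β_{Y,Z}` created here
  -- cancels in `e₆` against a tile of the interchanger split by `e₅`.
  have e₁ := Om_natural₁' (p * rt (rt (bt W X) Y) Z) (lt Z n₁ * (k₁ * q)) m₁ Y Z
  have e₂ := lay_comm (p * rt (rt (bt W X) Y) Z) (rtt (bl m₁ Y) Z) 1 (bl n₁ Z) (k₁ * q)
  have e₃ := lay_comm (p * rt (rt (bt W X) Y) Z) (sg m₁ (bt Y Z)) (bt XW (Z * Y)) (inv a₃) q
  have e₄ := lay_comm (p * rt (rt (bt W X) Y) Z) (sg m₁ (bt Y Z)) 1 (inv (br XW m₃)) (k₂ * q)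
  have e₅ := lay_inv_sg_mul_mul p (bt XW ZY * (k₂ * q)) (x := bt W X) (x' := m₁) (y := bt Y Z)
    (y' := m₃)
  have e₆ := lay_inv_mul (p := p * rt (rt (bt W X) Y) Z) (x := inv (sg m₁ (bt Y Z)))
    (q := lt XW m₃ * (bt XW ZY * (k₂ * q))) (y := inv (sg m₁ m₃))
    (p' := p * (rt (rt (bt W X) Y) Z * lt X (lt W (bt Y Z)))) (q' := bt XW ZY * (k₂ * q))
    (by simp [mul_assoc])
  have e₇ := lay_comm (p * lt W (lt X (bt Y Z))) (inv (sg (bt W X) m₃)) 1 (bl m₁ ZY) (k₂ * q)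
  have e₈ := lay_comm p (inv (sg (bt W X) (bt Y Z))) (lt X (lt W m₃)) (bl m₁ ZY) (k₂ * q)
  -- The interchanger of the opposite pentagon, inverse at `m₁, m₃`, becomes the one at `m₃, m₁`
  -- occurring in the inverted pentagon of `C`. The leftover `bl m₁ (Z * Y)` is cancelled by `f₂`.
  have e₉ := lay_br_sg_bl (p * (rt (rt (bt W X) Y) Z * lt X (lt W (bt Y Z)))) (k₂ * q) m₁ m₃
  have f₁ := lay_comm (p * (rt (rt (bt W X) Y) Z * lt X (lt W (bt Y Z)))) (inv (bl m₁ (Z * Y))) 1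
    (inv a₃) q
  have f₂ := lay_inv_mul (p := p * (rt (rt (bt W X) Y) Z * lt X (lt W (bt Y Z))))
    (x := bl m₁ (Z * Y)) (q := rt m₃ XW * (k₂ * q)) (y := sg m₃ m₁)
    (p' := p * (rt (rt (bt W X) Y) Z * (lt X (lt W (bt Y Z)) * bt (X * W) (Z * Y))))
    (q' := k₂ * q) (by simp [mul_assoc])
  have f₃ := lay_comm p (inv (sg (bt W X) (bt Y Z))) 1 (inv (br (X * W) m₃))
    (lt ZY m₁ * (k₂ * q))
  -- Moves `m₃` behind the last reversal.
  have f₄ := Om_natural₃' (p * lt W (lt X (bt Y Z))) (lt ZY m₁ * (k₂ * q)) W X m₃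
  have f₅ := lay_comm (p * lt W (lt X (bt Y Z))) (ltt W (inv (br X m₃))) (bt W (ZY * X)) (inv a₄) q
  have f₆ := lay_comm (p * (lt W (lt X (bt Y Z)) * lt W (bt X (Z * Y)))) (inv (br W (rt m₃ X))) 1
    (inv a₄) q
  have f₇ := lay_comm (p * lt W (lt X (bt Y Z))) (ltt W (inv (br X m₃))) 1 (inv (br W n₄)) (k₃ * q)
  have f₈ := lay_comm p (inv (sg (bt W X) (bt Y Z))) (bt (X * W) (Z * Y)) (sg m₃ m₁) (k₂ * q)
  have f₉ := lay_comm (p * lt W (lt X (bt Y Z))) (Om W X (Z * Y)) 1 (sg m₃ m₁) (k₂ * q)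
  have g₁ := lay_comm p (inv (sg (bt W X) (bt Y Z)))
    (bt (X * W) (Z * Y) * lt Z (lt Y m₁)) (inv a₃) q
  have g₂ := lay_comm (p * lt W (lt X (bt Y Z))) (Om W X (Z * Y)) (lt Z (lt Y m₁)) (inv a₃) q
  simp [mul_assoc, hs₃, ht₃] at e₁ e₂ e₃ e₄ e₅ e₆ e₇ e₈ e₉ f₁
  simp [mul_assoc, hs₃, ht₃, hs₄, ht₄] at f₂ f₃ f₄ f₅ f₆ f₇ f₈ f₉ g₁ g₂
  rw [e₁]
  simp only [mul_assoc]
  rw [mul₂_assoc_of e₂.symm]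
  simp only [mul_assoc]
  rw [mul₂_assoc_of e₃]
  simp only [mul_assoc]
  rw [mul₂_assoc_of e₄]
  simp only [mul_assoc]
  rw [e₅]
  simp only [mul_assoc]
  rw [e₆]
  rw [mul₂_assoc_of e₇]
  simp only [mul_assoc]
  rw [mul₂_assoc_of e₈]
  simp only [mul_assoc]
  rw [mul₃_assoc_of e₉]
  simp only [mul_assoc]
  rw [mul₂_assoc_of f₁]
  simp only [mul_assoc]
  rw [f₂]
  rw [mul₂_assoc_of f₃.symm]
  simp only [mul_assoc]
  rw [mul₃_assoc_of f₄]
  simp only [mul_assoc]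
  rw [mul₂_assoc_of f₅]
  simp only [mul_assoc]
  rw [mul₂_assoc_of f₆]
  simp only [mul_assoc]
  rw [f₇]
  rw [mul₂_assoc_of f₈.symm]
  simp only [mul_assoc]
  rw [mul₂_assoc_of f₉.symm]
  simp only [mul_assoc]
  rw [mul₂_assoc_of g₁.symm]
  simp only [mul_assoc]
  rw [mul₂_assoc_of g₂.symm]
  simp only [mul_assoc]

/-- The associativity axiom for a composition precomposed with the braiding. -/
theorem reversed_associativity {W X Y Z XW YX ZY T U : V}
    {m₁ m₂ m₃ n₁ n₂ n₃ n₄ k₁ k₂ k₃ : OneCell V} {a₁ a₂ a₃ a₄ a₅ : TwoCell V}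
    [Typed m₁ (X * W) XW] [Typed m₂ (Y * X) YX] [Typed m₃ (Z * Y) ZY] [Typed n₁ (Y * XW) T]
    [Typed n₂ (YX * W) T] [Typed n₃ (Z * YX) U] [Typed n₄ (ZY * X) U]
    (hs₁ : src a₁ = rt m₂ W * n₂) (ht₁ : tgt a₁ = lt Y m₁ * n₁)
    (hs₂ : src a₂ = rt m₃ X * n₄) (ht₂ : tgt a₂ = lt Z m₂ * n₃)
    (hs₃ : src a₃ = rt m₃ XW * k₂) (ht₃ : tgt a₃ = lt Z n₁ * k₁)
    (hs₄ : src a₄ = rt n₄ W * k₃) (ht₄ : tgt a₄ = lt ZY m₁ * k₂)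
    (hs₅ : src a₅ = rt n₃ W * k₃) (ht₅ : tgt a₅ = lt Z n₂ * k₁)
    (h : ∀ p q : OneCell V, lay p (rtt a₂ W) (k₃ * q) *
        (lay (p * lt Z (rt m₂ W)) a₅ q * lay p (ltt Z a₁) (k₁ * q)) =
      lay (p * rt (rt m₃ X) W) a₄ q *
        (lay p (inv (sg m₃ m₁)) (k₂ * q) * lay (p * lt Z (lt Y m₁)) a₃ q)) :
    lay (p * rt (rt (bt W X) Y) Z) (rtt (bl m₁ Y) Z) (rt n₁ Z * (bt T Z * (k₁ * q))) *
      (lay p (rtt (Om W X Y) Z) (lt Y (rt m₁ Z) * (rt n₁ Z * (bt T Z * (k₁ * q)))) *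
      (lay (p * (lt W (rt (bt X Y) Z) * rt (bt W (Y * X)) Z)) (rtt (inv a₁) Z)
        (bt T Z * (k₁ * q)) *
      (lay (p * lt W (rt (bt X Y) Z)) (rtt (inv (br W m₂)) Z) (rt n₂ Z * (bt T Z * (k₁ * q))) *
      (lay (p * (lt W (rt (bt X Y) Z) * (lt W (rt m₂ Z) * rt (bt W YX) Z))) (bl n₂ Z) (k₁ * q) *
      (lay (p * (lt W (rt (bt X Y) Z) * lt W (rt m₂ Z))) (Om W YX Z) (lt Z n₂ * (k₁ * q)) *
      (lay (p * (lt W (rt (bt X Y) Z) * (lt W (rt m₂ Z) * (lt W (bt YX Z) * bt W (Z * YX)))))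
        (inv a₅) q *
      (lay (p * (lt W (rt (bt X Y) Z) * (lt W (rt m₂ Z) * lt W (bt YX Z)))) (inv (br W n₃))
        (k₃ * q) *
      (lay (p * lt W (rt (bt X Y) Z)) (ltt W (bl m₂ Z)) (lt W n₃ * (bt W U * (k₃ * q))) *
      (lay p (ltt W (Om X Y Z)) (lt W (lt Z m₂) * (lt W n₃ * (bt W U * (k₃ * q)))) *
      (lay (p * (lt W (lt X (bt Y Z)) * lt W (bt X (Z * Y)))) (ltt W (inv a₂))
        (bt W U * (k₃ * q)) *
      lay (p * lt W (lt X (bt Y Z))) (ltt W (inv (br X m₃)))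
        (lt W n₄ * (bt W U * (k₃ * q))))))))))))) =
    lay (p * (rt (rt (bt W X) Y) Z * (rt (rt m₁ Y) Z * rt (bt XW Y) Z))) (bl n₁ Z) (k₁ * q) *
      (lay (p * (rt (rt (bt W X) Y) Z * rt (rt m₁ Y) Z)) (Om XW Y Z) (lt Z n₁ * (k₁ * q)) *
      (lay (p * (rt (rt (bt W X) Y) Z * (rt (rt m₁ Y) Z * (lt XW (bt Y Z) * bt XW (Z * Y)))))
        (inv a₃) q *
      (lay (p * (rt (rt (bt W X) Y) Z * (rt (rt m₁ Y) Z * lt XW (bt Y Z)))) (inv (br XW m₃))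
        (k₂ * q) *
      (lay p (inv (sg (bt W X * m₁) (bt Y Z * m₃))) (bt XW ZY * (k₂ * q)) *
      (lay (p * (lt W (lt X (bt Y Z)) * (lt W (lt X m₃) * rt (bt W X) ZY))) (bl m₁ ZY) (k₂ * q) *
      (lay (p * (lt W (lt X (bt Y Z)) * lt W (lt X m₃))) (Om W X ZY) (lt ZY m₁ * (k₂ * q)) *
      (lay (p * (lt W (lt X (bt Y Z)) * (lt W (lt X m₃) * (lt W (bt X ZY) * bt W (ZY * X)))))
        (inv a₄) q *
      lay (p * (lt W (lt X (bt Y Z)) * (lt W (lt X m₃) * lt W (bt X ZY)))) (inv (br W n₄))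
        (k₃ * q)))))))) := by
  rw [reversed_associativity_left p q hs₁ ht₁ hs₂ ht₂ hs₅ ht₅,
    reversed_associativity_right p q hs₃ ht₃ hs₄ ht₄]
  -- The normalised sides agree outside two blocks: the reversals, compared by `e₁`, and the
  -- associators, compared by the inverted pentagon `e₂`.
  have e₁ := Om_coherence p (lt Z (lt Y m₁) * (lt Z n₁ * (k₁ * q))) W X Y Z
  have e₂ := congrArg inv
    (h (p * (lt W (lt X (bt Y Z)) * (lt W (bt X (Z * Y)) * bt W (Z * (Y * X))))) q)
  simp [inv_mul_rev, mul_assoc] at e₁ e₂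
  rw [mul₃_assoc_of e₁]
  simp only [mul_assoc]
  rw [mul₃_assoc_of e₂]
  simp only [mul_assoc]

end TwoCell
end ReversedAssociativity

/-! ### Associativity coherence of the opposite -/

section Opposite

variable {V : Type u} [Bicategory.{w, v} V] [Bicategory.Strict V] [GrayMonoid V]

namespace TwoCell

/-! ### Tensoring steps and naturality cells with an object -/

theorem ltt_iso_step (D : V) {W X Y Z A B : V} (p : W ⟶ X) {f g : A ⟶ B} (η : f ≅ g) (q : Y ⟶ Z)
    {F G : W ⟶ Z} (hX : X = A) (hY : Y = B) (hF : F = p ≫ hcast f hX hY ≫ q)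
    (hG : G = p ≫ hcast g hX hY ≫ q) :
    ltt D (iso (step p η q hX hY hF hG)) = lay (lt D (arr p)) (ltt D (iso η)) (lt D (arr q)) := by
  subst hX hY
  have e : lay (arr p) (iso η) (arr q) = lay (arr p) (lay 1 (iso η) (arr q)) 1 := by simp
  rw [iso_step, e]
  have h : Typed (src (iso η)) X Y := ⟨f, rfl⟩
  rw [ltt_lay_left D (B' := X) (C := Z) (by rw [src_lay, one_mul]; exact .mul h inferInstance rfl)
    rfl,
    ltt_lay_right D h rfl, lay_lay, mul_one, mul_one]

theorem ltt_iso_id_step (D : V) {W Y Z A B : V} {f g : A ⟶ B} (η : f ≅ g) (q : Y ⟶ Z)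
    {F G : W ⟶ Z} (hX : W = A) (hY : Y = B) (hF : F = 𝟙 W ≫ hcast f hX hY ≫ q)
    (hG : G = 𝟙 W ≫ hcast g hX hY ≫ q) :
    ltt D (iso (step (𝟙 W) η q hX hY hF hG)) = lay 1 (ltt D (iso η)) (lt D (arr q)) := by
  subst hX hY
  rw [iso_id_step, ltt_lay_right D (A := W) (B' := Y) ⟨f, rfl⟩ rfl]

theorem ltt_iso_step_id (D : V) {W X Z A B : V} (p : W ⟶ X) {f g : A ⟶ B} (η : f ≅ g)
    {F G : W ⟶ Z} (hX : X = A) (hY : Z = B) (hF : F = p ≫ hcast f hX hY ≫ 𝟙 Z)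
    (hG : G = p ≫ hcast g hX hY ≫ 𝟙 Z) :
    ltt D (iso (step p η (𝟙 Z) hX hY hF hG)) = lay (lt D (arr p)) (ltt D (iso η)) 1 := by
  subst hX hY
  rw [iso_step_id, ltt_lay_left D (B' := X) (C := Z) ⟨f, rfl⟩ rfl]

theorem rtt_iso_step (D : V) {W X Y Z A B : V} (p : W ⟶ X) {f g : A ⟶ B} (η : f ≅ g) (q : Y ⟶ Z)
    {F G : W ⟶ Z} (hX : X = A) (hY : Y = B) (hF : F = p ≫ hcast f hX hY ≫ q)
    (hG : G = p ≫ hcast g hX hY ≫ q) :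
    rtt (iso (step p η q hX hY hF hG)) D = lay (rt (arr p) D) (rtt (iso η) D) (rt (arr q) D) := by
  subst hX hY
  have e : lay (arr p) (iso η) (arr q) = lay (arr p) (lay 1 (iso η) (arr q)) 1 := by simp
  rw [iso_step, e]
  have h : Typed (src (iso η)) X Y := ⟨f, rfl⟩
  rw [rtt_lay_left D (B' := X) (C := Z) (by rw [src_lay, one_mul]; exact .mul h inferInstance rfl)
    rfl,
    rtt_lay_right D h rfl, lay_lay, mul_one, mul_one]

theorem rtt_iso_id_step (D : V) {W Y Z A B : V} {f g : A ⟶ B} (η : f ≅ g) (q : Y ⟶ Z)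
    {F G : W ⟶ Z} (hX : W = A) (hY : Y = B) (hF : F = 𝟙 W ≫ hcast f hX hY ≫ q)
    (hG : G = 𝟙 W ≫ hcast g hX hY ≫ q) :
    rtt (iso (step (𝟙 W) η q hX hY hF hG)) D = lay 1 (rtt (iso η) D) (rt (arr q) D) := by
  subst hX hY
  rw [iso_id_step, rtt_lay_right D (A := W) (B' := Y) ⟨f, rfl⟩ rfl]

theorem rtt_iso_step_id (D : V) {W X Z A B : V} (p : W ⟶ X) {f g : A ⟶ B} (η : f ≅ g)
    {F G : W ⟶ Z} (hX : X = A) (hY : Z = B) (hF : F = p ≫ hcast f hX hY ≫ 𝟙 Z)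
    (hG : G = p ≫ hcast g hX hY ≫ 𝟙 Z) :
    rtt (iso (step p η (𝟙 Z) hX hY hF hG)) D = lay (rt (arr p) D) (rtt (iso η) D) 1 := by
  subst hX hY
  rw [iso_step_id, rtt_lay_left D (B' := X) (C := Z) ⟨f, rfl⟩ rfl]

theorem lay_ltt_iso_trans (p q : OneCell V) (D : V) {A B : V} {f g h : A ⟶ B} (η : f ≅ g)
    (θ : g ≅ h) : lay p (ltt D (iso (η ≪≫ θ))) q =
      lay p (ltt D (iso η)) q * lay p (ltt D (iso θ)) q := by
  rw [iso_trans, ltt_mul, lay_mul] <;> rfl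

theorem lay_rtt_iso_trans (p q : OneCell V) (D : V) {A B : V} {f g h : A ⟶ B} (η : f ≅ g)
    (θ : g ≅ h) : lay p (rtt (iso (η ≪≫ θ)) D) q =
      lay p (rtt (iso η) D) q * lay p (rtt (iso θ) D) q := by
  rw [iso_trans, rtt_mul, lay_mul] <;> rfl

variable [GrayBraiding V] [BraidedGrayMonoid V]

theorem lay_bl_mul (p q : OneCell V) {x y : OneCell V} (B : V) {A A' A₂ A'' : V} [Typed x A A']
    [Typed y A₂ A''] (h : A' = A₂) : lay p (bl (x * y) B) q =
      lay (p * rt x B) (bl y B) q * lay p (bl x B) (lt B y * q) := by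
  subst h
  rw [bl_mul B rfl, lay_mul]
  · simp
  · simp [mul_assoc]

theorem lay_ltt_bl_mul (p q : OneCell V) (D : V) {x y : OneCell V} (B : V) {A A' A₂ A'' : V}
    [Typed x A A'] [Typed y A₂ A''] (h : A' = A₂) : lay p (ltt D (bl (x * y) B)) q =
      lay (p * lt D (rt x B)) (ltt D (bl y B)) q * lay p (ltt D (bl x B)) (lt D (lt B y) * q) := by
  subst h
  rw [bl_mul B rfl, ltt_mul, lay_mul, ltt_lay_left D (typed_src_bl y B) rfl,
    ltt_lay_right D (typed_src_bl x B) rfl]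
  · simp
  all_goals simp [mul_assoc]

theorem lay_rtt_bl_mul (p q : OneCell V) (D : V) {x y : OneCell V} (B : V) {A A' A₂ A'' : V}
    [Typed x A A'] [Typed y A₂ A''] (h : A' = A₂) : lay p (rtt (bl (x * y) B) D) q =
      lay (p * rt (rt x B) D) (rtt (bl y B) D) q *
        lay p (rtt (bl x B) D) (rt (lt B y) D * q) := by
  subst h
  rw [bl_mul B rfl, rtt_mul, lay_mul, rtt_lay_left D (typed_src_bl y B) rfl,
    rtt_lay_right D (typed_src_bl x B) rfl]
  · simp
  all_goals simp [mul_assoc]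

end TwoCell

namespace VBicategoryData

variable [GrayBraiding V] [SemistrictBraided V] {Obj : Type t}

/-! ### The pentagons of `C` and of its opposite in layer form -/

theorem lay_associativityCoherence {C : VBicategoryData V Obj} (h : C.AssociativityCoherence)
    (c d e f g : Obj) (p q : OneCell V) :
    lay p (rtt (iso (C.assoc d e f g)) (C.hom c d)) (arr (C.m c d g) * q) *
        (lay (p * lt (C.hom f g) (rt (arr (C.m d e f)) (C.hom c d))) (iso (C.assoc c d f g)) q *
          lay p (ltt (C.hom f g) (iso (C.assoc c d e f))) (arr (C.m c f g) * q)) =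
      lay (p * rt (rt (arr (C.m e f g)) (C.hom d e)) (C.hom c d)) (iso (C.assoc c d e g)) q *
        (lay p (inv (sg (arr (C.m e f g)) (arr (C.m c d e)))) (arr (C.m c e g) * q) *
          lay (p * lt (C.hom f g) (lt (C.hom e f) (arr (C.m c d e)))) (iso (C.assoc c e f g)) q) :=
            by
  have h' := congrArg (fun e => lay p (iso e) q) (h c d e f g)
  simpa [↓lay_iso_trans, mul_assoc] using h'

theorem associativityCoherence_of_iso {C : VBicategoryData V Obj} (h : ∀ c d e f g : Obj,
    lay 1 (rtt (iso (C.assoc d e f g)) (C.hom c d)) (arr (C.m c d g) * 1) *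
        (lay (lt (C.hom f g) (rt (arr (C.m d e f)) (C.hom c d))) (iso (C.assoc c d f g)) 1 *
          lay 1 (ltt (C.hom f g) (iso (C.assoc c d e f))) (arr (C.m c f g) * 1)) =
      lay (rt (rt (arr (C.m e f g)) (C.hom d e)) (C.hom c d)) (iso (C.assoc c d e g)) 1 *
        (lay 1 (inv (sg (arr (C.m e f g)) (arr (C.m c d e)))) (arr (C.m c e g) * 1) *
          lay (lt (C.hom f g) (lt (C.hom e f) (arr (C.m c d e)))) (iso (C.assoc c e f g)) 1)) :
    C.AssociativityCoherence := by
  intro c d e f g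
  apply iso_injective
  simpa [iso_trans, mul_assoc] using h c d e f g

theorem arr_op_m (C : VBicategoryData V Obj) (c d e : Obj) :
    arr (C.op.m c d e) = bt (C.hom e d) (C.hom d c) * arr (C.m e d c) :=
  arr_comp _ _

/-- Naturality of `β` at the composite of a braiding and `m` splits into a part at `m` and a part at
the braiding; the latter, with `S` and `R⁻¹`, is `Om` in the form given by `Om_eq`. -/
theorem lay_op_assoc (C : VBicategoryData V Obj) (c d e f : Obj) (p q : OneCell V) :
    lay p (iso (C.op.assoc c d e f)) q =
      lay (p * rt (bt (C.hom f e) (C.hom e d)) (C.hom d c)) (bl (arr (C.m f e d)) (C.hom d c))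
          (arr (C.m f d c) * q) *
        (lay p (Om (C.hom f e) (C.hom e d) (C.hom d c))
          (lt (C.hom d c) (arr (C.m f e d)) * (arr (C.m f d c) * q)) *
        (lay (p * (lt (C.hom f e) (bt (C.hom e d) (C.hom d c)) *
          bt (C.hom f e) (C.hom d c * C.hom e d))) (inv (iso (C.assoc f e d c))) q *
        lay (p * lt (C.hom f e) (bt (C.hom e d) (C.hom d c)))
          (inv (br (C.hom f e) (arr (C.m e d c)))) (arr (C.m f e c) * q))) := by
  rw [lay_Om']
  simp [VBicategoryData.op, ↓lay_iso_trans, arr_comp, mul_assoc]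
  simp [lay_bl_mul, mul_assoc]

theorem lay_ltt_op_assoc (C : VBicategoryData V Obj) (c d e f : Obj) (D : V) (p q : OneCell V) :
    lay p (ltt D (iso (C.op.assoc c d e f))) q =
      lay (p * lt D (rt (bt (C.hom f e) (C.hom e d)) (C.hom d c)))
          (ltt D (bl (arr (C.m f e d)) (C.hom d c))) (lt D (arr (C.m f d c)) * q) *
        (lay p (ltt D (Om (C.hom f e) (C.hom e d) (C.hom d c)))
          (lt D (lt (C.hom d c) (arr (C.m f e d))) * (lt D (arr (C.m f d c)) * q)) *
        (lay (p * (lt D (lt (C.hom f e) (bt (C.hom e d) (C.hom d c))) *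
          lt D (bt (C.hom f e) (C.hom d c * C.hom e d)))) (ltt D (inv (iso (C.assoc f e d c)))) q *
        lay (p * lt D (lt (C.hom f e) (bt (C.hom e d) (C.hom d c))))
          (ltt D (inv (br (C.hom f e) (arr (C.m e d c))))) (lt D (arr (C.m f e c)) * q))) := by
  have := Typed.mul (x := lt (C.hom d c) (arr (C.m f e d))) (y := arr (C.m f d c)) inferInstance
    inferInstance rfl
  rw [lay_ltt_Om']
  simp only [VBicategoryData.op, ↓lay_ltt_iso_trans, ltt_iso_id_step, ltt_iso_step_id]
  simp only [ltt_iso_step]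
  simp [arr_comp, mul_assoc]
  simp [lay_ltt_bl_mul, mul_assoc]

theorem lay_rtt_op_assoc (C : VBicategoryData V Obj) (c d e f : Obj) (D : V) (p q : OneCell V) :
    lay p (rtt (iso (C.op.assoc c d e f)) D) q =
      lay (p * rt (rt (bt (C.hom f e) (C.hom e d)) (C.hom d c)) D)
          (rtt (bl (arr (C.m f e d)) (C.hom d c)) D) (rt (arr (C.m f d c)) D * q) *
        (lay p (rtt (Om (C.hom f e) (C.hom e d) (C.hom d c)) D)
          (lt (C.hom d c) (rt (arr (C.m f e d)) D) * (rt (arr (C.m f d c)) D * q)) *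
        (lay (p * (lt (C.hom f e) (rt (bt (C.hom e d) (C.hom d c)) D) *
          rt (bt (C.hom f e) (C.hom d c * C.hom e d)) D)) (rtt (inv (iso (C.assoc f e d c))) D) q *
        lay (p * lt (C.hom f e) (rt (bt (C.hom e d) (C.hom d c)) D))
          (rtt (inv (br (C.hom f e) (arr (C.m e d c)))) D) (rt (arr (C.m f e c)) D * q))) := by
  have := Typed.mul (x := lt (C.hom d c) (arr (C.m f e d))) (y := arr (C.m f d c)) inferInstance
    inferInstance rfl
  rw [lay_rtt_Om']
  simp only [VBicategoryData.op, ↓lay_rtt_iso_trans, rtt_iso_id_step, rtt_iso_step_id]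
  simp only [rtt_iso_step]
  simp [arr_comp, mul_assoc]
  simp [lay_rtt_bl_mul, mul_assoc]

theorem op_hom (C : VBicategoryData V Obj) (c d : Obj) : C.op.hom c d = C.hom d c := rfl

theorem op_associativityCoherence {C : VBicategoryData V Obj} (h : C.AssociativityCoherence) :
    C.op.AssociativityCoherence := by
  refine associativityCoherence_of_iso fun c d e f g => ?_
  -- Here `W`, `X`, `Y`, `Z` are the homs of `C` from `g` to `f`, `f` to `e`, `e` to `d` and `d` to
  -- `c`; the pentagon of `C` is used for the string `g, f, e, d, c`.
  have key := reversed_associativity 1 1 (a₁ := iso (C.assoc g f e d)) (a₂ := iso (C.assoc f e d c))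
    (a₃ := iso (C.assoc g e d c)) (a₄ := iso (C.assoc g f e c)) (a₅ := iso (C.assoc g f d c))
    (m₁ := arr (C.m g f e)) (m₂ := arr (C.m f e d)) (m₃ := arr (C.m e d c))
    (n₁ := arr (C.m g e d)) (n₂ := arr (C.m g f d)) (n₃ := arr (C.m f d c))
    (n₄ := arr (C.m f e c)) (k₁ := arr (C.m g d c)) (k₂ := arr (C.m g e c))
    (k₃ := arr (C.m g f c)) (by simp [arr_comp]) (by simp [arr_comp]) (by simp [arr_comp])
    (by simp [arr_comp]) (by simp [arr_comp]) (by simp [arr_comp]) (by simp [arr_comp])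
    (by simp [arr_comp]) (by simp [arr_comp]) (by simp [arr_comp])
    (lay_associativityCoherence h g f e d c)
  rw [lay_rtt_op_assoc, lay_op_assoc, lay_ltt_op_assoc, lay_op_assoc, lay_op_assoc]
  simp only [arr_op_m]
  simp [op_hom, mul_assoc] at key ⊢
  exact key

end VBicategoryData

end Opposite

/-! ### Units and identity coherence of the opposite -/

section OppositeIdentity

variable {V : Type u} [Bicategory.{w, v} V] [Bicategory.Strict V] [GrayMonoid V]

theorem OneCell.rt_arr_id (A B : V) : rt (arr (𝟙 A)) B = arr (𝟙 (A * B)) := by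
  rw [← arr_tensorR, tensorR_id]

theorem OneCell.lt_arr_id (A B : V) : lt A (arr (𝟙 B)) = arr (𝟙 (A * B)) := by
  rw [← arr_tensorL, tensorL_id]

theorem OneCell.id_mul_of_typed {A A' B : V} (x : OneCell V) [hx : Typed x A B] (h : A' = A) :
    arr (𝟙 A') * x = x := by
  subst h
  obtain ⟨f, rfl⟩ := hx.exists_eq
  rw [← arr_comp, Bicategory.Strict.id_comp]

theorem OneCell.mul_id_of_typed {A B B' : V} (x : OneCell V) [hx : Typed x A B] (h : B' = B) :
    x * arr (𝟙 B') = x := by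
  subst h
  obtain ⟨f, rfl⟩ := hx.exists_eq
  rw [← arr_comp, Bicategory.Strict.comp_id]

namespace TwoCell

theorem lay_mul_id {A A' B : V} {x : TwoCell V} (hx : Typed (src x) A B) (h : A' = A)
    (p q : OneCell V) : lay (p * arr (𝟙 A')) x q = lay p x q := by
  subst h
  obtain ⟨f, hf⟩ := hx.exists_eq
  rcases x with _ | ⟨η⟩
  · cases hf
  cases hf
  rw [← mul_one p, ← one_mul q, mul_assoc p 1, one_mul (arr _), ← lay_lay, lay_arr_id, lay_lay]

/-- A layer on an identity 2-cell is idempotent and invertible, so it acts as a unit on whatever it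
composes with. -/
theorem lay_iso_refl_mul {A B : V} {p q : OneCell V} {f : A ⟶ B} {x : TwoCell V}
    (h : src x = p * (arr f * q)) : lay p (iso (Iso.refl f)) q * x = x := by
  have h₁ : tgt (lay p (iso (Iso.refl f)) q) = src x := by rw [h, tgt_lay]; rfl
  have h₂ := lay_mul p q (x := iso (Iso.refl f)) (y := iso (Iso.refl f)) rfl
  rw [← iso_trans, Iso.refl_trans] at h₂
  have h₃ := congrArg (inv (lay p (iso (Iso.refl f)) q) * ·) (congrArg (· * x) h₂)
  simp only [mul_assoc] at h₃
  rw [inv_mul_cancel_left h₁, inv_mul_cancel_left (by rw [src_mul h₁, tgt_lay, src_lay]; rfl)] at h₃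
  exact h₃.symm

theorem mul_lay_iso_refl {A B : V} {p q : OneCell V} {f : A ⟶ B} {x : TwoCell V}
    (h : tgt x = p * (arr f * q)) : x * lay p (iso (Iso.refl f)) q = x := by
  have h' := congrArg inv (lay_iso_refl_mul (p := p) (q := q) (f := f) (x := inv x) (by rw [← h,
    src_inv]))
  simpa [inv_mul_rev, inv_iso] using h'

end TwoCell

variable [GrayBraiding V] [SemistrictBraided V]

theorem OneCell.bt_one_right (A : V) : bt A 1 = arr (𝟙 A) :=
  arr_eq_of_heq (mul_one A) (one_mul A) (β_one_right A)

theorem OneCell.bt_one_left (A : V) : bt 1 A = arr (𝟙 A) :=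
  arr_eq_of_heq (one_mul A) (mul_one A) (β_one_left A)

/-! ### Reversal with the unit object in the middle -/

namespace TwoCell

theorem Rt_one_middle (A B : V) : Rt A 1 B = iso (Iso.refl (β A B)) := by
  refine iso_eq_of_heq ?_ ?_ (R_one_middle A B)
  · simp
  · simp [arr_comp, bt_one_right, rt_arr_id, id_mul_of_typed]

theorem St_one_left (A B : V) : St 1 A B = iso (Iso.refl (β A B)) := by
  refine iso_eq_of_heq ?_ ?_ (S_one_left A B)
  · simp
  · simp [arr_comp, bt_one_left, rt_arr_id, mul_id_of_typed]

theorem bl_id (A B : V) : bl (arr (𝟙 A)) B = iso (Iso.refl (β A B)) := by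
  refine iso_eq_of_heq ?_ ?_ (BraidedGrayMonoid.βL_id A B)
  · rw [tensorR_id, Bicategory.Strict.id_comp]
  · rw [tensorL_id, Bicategory.Strict.comp_id]

theorem br_id (A B : V) : br A (arr (𝟙 B)) = iso (Iso.refl (β A B)) := by
  refine iso_eq_of_heq ?_ ?_ (BraidedGrayMonoid.βR_id A B)
  · rw [tensorL_id, Bicategory.Strict.id_comp]
  · rw [tensorR_id, Bicategory.Strict.comp_id]

/-- Every factor is an identity: `S_{1,A,B}` and `R_{A,1,B}` by the unit axioms, and the naturality
cell because `β_{1,B}` is an identity 1-cell. -/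
theorem Om_one_middle (A B : V) : Om A 1 B = iso (Iso.refl (β A B)) := by
  rw [Om, Rt_one_middle, St_one_left, bt_one_right, bt_one_left, br_id, rt_arr_id, rt_arr_id,
    lay_arr_id, inv_iso, Iso.refl_symm, lay_iso_arr_id, lay_one_one, ← iso_trans,
    ← iso_trans, Iso.refl_trans, Iso.refl_trans]

theorem typed_src_br (A : V) (y : OneCell V) {B B' : V} [hy : Typed y B B'] :
    Typed (src (br A y)) (A * B) (B' * A) := by
  obtain ⟨g, rfl⟩ := hy.exists_eq
  exact ⟨_, rfl⟩

theorem Om_natural_unit (p q : OneCell V) (A : V) (g : OneCell V) (C : V) {B : V} [Typed g 1 B] :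
    lay p (rtt (br A g) C) (bt (B * A) C * q) * lay p (bl (rt g A) C) q =
      lay (p * lt A (rt g C)) (Om A B C) q *
        (lay p (ltt A (bl g C)) (bt A (C * B) * q) * lay p (br A (lt C g)) q) := by
  have h := Om_natural₂ p q A g C
  have t₁ : Typed (src (bl (rt g A) C)) (A * C) (C * (B * A)) := by
    simpa using typed_src_bl (rt g A) C
  have t₂ : Typed (src (br A (lt C g))) (A * C) (C * B * A) := by
    simpa only [mul_one] using typed_src_br A (lt C g)
  rw [Om_one_middle, bt_one_right, bt_one_left, rt_arr_id, lt_arr_id,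
    lay_mul_id t₁ rfl, lay_mul_id t₂ rfl, mul_lay_iso_refl] at h
  · exact h
  · simp [mul_assoc]

/-- Naturality of `Om` along `g : 1 ⟶ B` has the trivial `Om A 1 C` at its other end, so after `g`
the reversal is made of naturality cells of `β` only. -/
theorem lay_Om_unit (p q : OneCell V) (A : V) (g : OneCell V) (C : V) {B : V} [Typed g 1 B] :
    lay (p * lt A (rt g C)) (Om A B C) q =
      lay p (rtt (br A g) C) (bt (B * A) C * q) * (lay p (bl (rt g A) C) q *
        (lay p (inv (br A (lt C g))) q * lay p (ltt A (inv (bl g C))) (bt A (C * B) * q))) := by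
  have h := congrArg (· * inv (lay p (ltt A (bl g C)) (bt A (C * B) * q) *
    lay p (br A (lt C g)) q)) (Om_natural_unit p q A g C)
  rw [mul_inv_cancel_right] at h
  · simpa [inv_mul_rev, mul_assoc] using h.symm
  · rw [src_mul] <;> simp [mul_assoc, bt_one_left, id_mul_of_typed]

theorem lay_bl_natural_unit (p q : OneCell V) (B : V) {x : TwoCell V} {a b : OneCell V}
    {A A' A₁ E E' : V} [Typed a A E] [Typed b E' A'] (hE : E = E') (h₁ : A₁ = A) (h₂ : A₁ = A')
    (hs : src x = a * b) (ht : tgt x = arr (𝟙 A₁)) :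
    lay p (rtt x B) (bt A₁ B * q) =
      lay (p * rt a B) (bl b B) q * (lay p (bl a B) (lt B b * q) *
        lay (p * bt A₁ B) (ltt B x) q) := by
  subst h₁ h₂
  have h := lay_bl_natural p q B (x := x) (a := a) (b := b) (c := arr (𝟙 A₁)) (d := arr (𝟙 A₁))
    hE rfl rfl rfl hs (by rw [ht, arr_id_mul])
  rwa [bl_id, inv_iso, Iso.refl_symm, rt_arr_id, lt_arr_id, mul_lay_iso_refl, mul_lay_iso_refl] at h
  · simp [ht, lt_arr_id, mul_assoc]
  · simp [ht, rt_arr_id, mul_assoc]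

theorem lay_inv_br_natural_unit (p q : OneCell V) (A : V) {x : TwoCell V} {a b : OneCell V}
    {B B' B₁ E E' : V} [Typed a B E] [Typed b E' B'] (hE : E = E') (h₁ : B₁ = B) (h₂ : B₁ = B')
    (hs : src x = a * b) (ht : tgt x = arr (𝟙 B₁)) :
    lay p (inv (br A a)) (rt b A * q) *
        (lay (p * lt A a) (inv (br A b)) q * lay p (ltt A x) (bt A B₁ * q)) =
      lay (p * bt A B₁) (rtt x A) q := by
  subst h₁ h₂
  have h := lay_inv_br_natural p q A (x := x) (a := a) (b := b) (c := arr (𝟙 B₁))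
    (d := arr (𝟙 B₁)) hE rfl rfl rfl hs (by rw [ht, arr_id_mul])
  rwa [br_id, inv_iso, Iso.refl_symm, rt_arr_id, lt_arr_id, mul_lay_iso_refl, mul_lay_iso_refl] at h
  · simp [ht, rt_arr_id, mul_assoc]
  · simp only [tgt_lay, tgt_iso, arr_β]
    rw [← mul_assoc (bt A B₁), mul_id_of_typed _ rfl, mul_assoc, ← mul_assoc (arr _),
      id_mul_of_typed _ rfl]

/-- The identity axiom for a composition precomposed with the braiding. -/
theorem reversed_identity (p q : OneCell V) {X Y Z : V} {u r s n : OneCell V} {a l k : TwoCell V}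
    [Typed u 1 Y] [Typed r (Y * X) X] [Typed s (Z * Y) Z]
    (hs : src a = rt s X * n) (ht : tgt a = lt Z r * n)
    (hs₁ : src l = rt u X * r) (ht₁ : tgt l = arr (𝟙 X))
    (hs₂ : src k = lt Z u * s) (ht₂ : tgt k = arr (𝟙 Z))
    (h : ∀ p q : OneCell V, lay (p * lt Z (rt u X)) a q * lay p (ltt Z l) (n * q) =
      lay p (rtt k X) (n * q)) :
    lay (p * (lt X (rt u Z) * rt (bt X Y) Z)) (bl r Z) (n * q) *
      (lay (p * lt X (rt u Z)) (Om X Y Z) (lt Z r * (n * q)) *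
      (lay (p * (lt X (rt u Z) * (lt X (bt Y Z) * bt X (Z * Y)))) (inv a) q *
      (lay (p * (lt X (rt u Z) * lt X (bt Y Z))) (inv (br X s)) (n * q) *
      (lay p (ltt X (bl u Z)) (lt X s * (bt X Z * (n * q))) *
      lay p (ltt X k) (bt X Z * (n * q)))))) =
    lay p (rtt (br X u) Z) (rt r Z * (bt X Z * (n * q))) *
      lay p (rtt l Z) (bt X Z * (n * q)) := by
  have e₁ := lay_comm p (rtt (br X u) Z) 1 (bl r Z) (n * q)
  have e₂ := lay_comm p (ltt X (inv (bl u Z))) (bt X (Z * Y)) (inv a) q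
  have e₃ := lay_comm p (ltt X (inv (bl u Z))) 1 (inv (br X s)) (n * q)
  -- The naturality cell in the left unitor of the opposite cancels the inverse one supplied by
  -- `lay_Om_unit`.
  have e₄ := inv_mul_cancel_left (x := lay p (ltt X (bl u Z)) (lt X s * (bt X Z * (n * q))))
    (y := lay p (ltt X k) (bt X Z * (n * q)))
    (by simp [hs₂, mul_assoc, bt_one_left, id_mul_of_typed])
  have e₅ := lay_comm p (inv (br X (lt Z u))) 1 (inv a) q
  have e₆ := lay_inv_br_natural_unit p (n * q) X (x := k) (a := lt Z u) (b := s) (B₁ := Z) rfl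
    (by simp) rfl hs₂ ht₂
  have e₇ := lay_bl_natural_unit p (n * q) Z (x := l) (a := rt u X) (b := r) (A₁ := X) rfl
    (by simp) rfl hs₁ ht₁
  have e₈ := h (p * bt X Z) q
  have e₉ := inv_mul_cancel_left (x := lay (p * bt X Z * lt Z (rt u X)) a q)
    (y := lay (p * bt X Z) (ltt Z l) (n * q)) (by simp [hs₁, ht, mul_assoc])
  simp [mul_assoc, hs, ht, bt_one_left, bt_one_right, id_mul_of_typed]
    at e₁ e₂ e₃ e₄ e₅ e₆ e₇ e₈ e₉
  rw [lay_Om_unit]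
  simp only [mul_assoc]
  rw [mul₂_assoc_of e₁.symm]
  simp only [mul_assoc]
  rw [mul₂_assoc_of e₂]
  simp only [mul_assoc]
  rw [mul₂_assoc_of e₃]
  simp only [mul_assoc]
  rw [e₄, mul₂_assoc_of e₅]
  simp only [mul_assoc]
  -- Naturality of `β` at `k` produces `k ⊗ X`; (IC) for `C` replaces it by `a` followed by `Z ⊗ l`;
  -- `a` cancels `a⁻¹`; naturality of `β` at `l` gives the other side.
  rw [e₆, ← e₈, e₉, ← e₇]

end TwoCell

namespace VBicategoryData

variable {Obj : Type t}

theorem lay_identityCoherence {C : VBicategoryData V Obj} (h : C.IdentityCoherence)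
    (c d e : Obj) (p q : OneCell V) :
    lay (p * lt (C.hom d e) (rt (arr (C.unit d)) (C.hom c d))) (iso (C.assoc c d d e)) q *
        lay p (ltt (C.hom d e) (iso (C.leftUnitor c d))) (arr (C.m c d e) * q) =
      lay p (rtt (iso (C.rightUnitor d e)) (C.hom c d)) (arr (C.m c d e) * q) := by
  have h' := congrArg (fun e => lay p (iso e) q) (h c d e)
  simpa [↓lay_iso_trans, mul_assoc] using h'

theorem identityCoherence_of_iso {C : VBicategoryData V Obj} (h : ∀ c d e : Obj,
    lay (lt (C.hom d e) (rt (arr (C.unit d)) (C.hom c d))) (iso (C.assoc c d d e)) 1 *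
        lay 1 (ltt (C.hom d e) (iso (C.leftUnitor c d))) (arr (C.m c d e)) =
      lay 1 (rtt (iso (C.rightUnitor d e)) (C.hom c d)) (arr (C.m c d e))) :
    C.IdentityCoherence := by
  intro c d e
  apply iso_injective
  simpa [iso_trans, mul_assoc] using h c d e

theorem lay_ltt_op_leftUnitor (C : VBicategoryData V Obj) (c d : Obj) (D : V) (p q : OneCell V) :
    lay p (ltt D (iso (C.op.leftUnitor c d))) q =
      lay p (ltt D (bl (arr (C.unit d)) (C.hom d c))) (lt D (arr (C.m d d c)) * q) *
        lay p (ltt D (iso (C.rightUnitor d c))) q := by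
  simp only [VBicategoryData.op, ↓lay_ltt_iso_trans, ltt_iso_id_step]
  simp

theorem lay_rtt_op_rightUnitor (C : VBicategoryData V Obj) (c d : Obj) (D : V) (p q : OneCell V) :
    lay p (rtt (iso (C.op.rightUnitor c d)) D) q =
      lay p (rtt (br (C.hom d c) (arr (C.unit c))) D) (rt (arr (C.m d c c)) D * q) *
        lay p (rtt (iso (C.leftUnitor d c)) D) q := by
  simp only [VBicategoryData.op, ↓lay_rtt_iso_trans, rtt_iso_id_step]
  simp

theorem op_unit (C : VBicategoryData V Obj) (c : Obj) : C.op.unit c = C.unit c := rfl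

theorem op_identityCoherence {C : VBicategoryData V Obj} (h : C.IdentityCoherence) :
    C.op.IdentityCoherence := by
  refine identityCoherence_of_iso fun c d e => ?_
  -- Here `X`, `Y`, `Z` are the homs of `C` from `e` to `d`, `d` to `d` and `d` to `c`; the two
  -- unitors exchange roles.
  have key := reversed_identity 1 1 (a := iso (C.assoc e d d c)) (l := iso (C.leftUnitor e d))
    (k := iso (C.rightUnitor d c)) (u := arr (C.unit d)) (r := arr (C.m e d d))
    (s := arr (C.m d d c)) (n := arr (C.m e d c)) (by simp [arr_comp]) (by simp [arr_comp])
    (by simp [arr_comp]) (by simp) (by simp [arr_comp]) (by simp)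
    (lay_identityCoherence h e d c)
  rw [lay_op_assoc, lay_ltt_op_leftUnitor, lay_rtt_op_rightUnitor]
  simp only [arr_op_m, op_unit]
  simp [op_hom, mul_assoc] at key ⊢
  exact key

end VBicategoryData

end OppositeIdentity

theorem mainTheorem1 {V : Type u} [Bicategory.{w, v} V] [Bicategory.Strict V] [GrayMonoid V]
    [GrayBraiding V] [SemistrictBraided V] {Obj : Type t} (C : VBicategory V Obj) :
    C.toVBicategoryData.op.IsVBicategory :=
  ⟨VBicategoryData.op_identityCoherence C.isVBicategory.identity_coherence,
    VBicategoryData.op_associativityCoherence C.isVBicategory.associativity_coherence⟩
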